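/- **Sequences.** For a sequence $A=\langle A[0],\dots,A[n-1]\rangle$ of $n\ge 0$ real numbers let $A[i..j]=\langle A[i],\dots,A[j]\rangle$ if $0\le i\le j<n$, and $A[i..j]=\langle\rangle$ otherwise. The possibly circular subsequence induced by $i,j$ is $A^{c}[i..j]=A[i..n-1]+A[0..j]$ if $0\le j<i<n$, and $A^c[i..j]=A[i..j]$ otherwise. The maximal circular sum $\mathrm{mcs}(A)$ is the greatest sum of a (possibly empty) sequence $A^c[i..j]$; $\Sigma A$ is the sum of $A$; $A_p[x]$ is $A$ with $x$ inserted at position $p\in\{0,\dots,n\}$. Put $\mathrm{MCS}[i]=\max_{0\le j<n}\Sigma A^c[j..i]$, and let $\mathrm{OMCS}[i]$ be the circularly leftmost $j$, relative to $i$, with $\Sigma A^c[j..i]=\mathrm{MCS}[i]$. $A$ has type 1 if all its elements are $\ge 0$ or all are $\le 0$; otherwise it has type 2 if $\mathrm{MCS}[i]<0$ for some $i$, and type 3 if not. **Machine.** A real RAM: each arithmetic operation or comparison of real numbers or of indices and each access to a memory cell takes one step. Each loop iteration or recursive call takes one step in addition to the steps of its body. **Preprocessing.** Compute $\Sigma A$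 and check whether $A$ has type 1; if so, stop. Otherwise compute $\mathrm{MCS}$ and $\mathrm{OMCS}$ with a max-queue: a FIFO queue of keys (with satellite data) in which one can peek at the oldest element of greatest key, and in which each insertion first adds a given real number to all stored keys. It is implemented by a deque that keeps only those keys not exceeded by a younger one, with, for each, the accumulated increment up to the next older kept key and the number of discarded keys between the two. Insert $A[0],\dots,A[n-1]$, each after adding it to all keys, and peek to get the values at $n-1$; then for $i=0,\dots,n-2$ remove the oldest element, add $A[i]$ to all keys, insert $A[i]$, and peek to get the values at $i$. Circularly shift $A$, $\mathrm{MCS}$, $\mathrm{OMCS}$ (with its values adjusted) to the left by $\alpha$ positions, where $\alpha=\mathrm{OMCS}[0]$ if $\mathrm{OMCS}$ is constant and otherwise $\alpha$ is the least $i$ with $\mathrm{OMCS}[i-1 \bmod n]\neq\mathrm{OMCS}[i]$. From now on $A$ denotes the shifted sequence. Split it into the intervals $I_0,\dots,I_{\ell-1}$ of consecutive elements with equal $\mathrm{OMCS}$; $I_i$ has first and last indices $\alpha_i,\omega_i$, and $k$ is the interval index of $p$. Interval indices are modulo $\ell$, and $A^{\setminus I_i}=I_{i+1}+\dots+I_{i+\ell-1}$.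 Tabulate, by linear sweeps (by Kadane's algorithm for $\mathrm{PFSF}$, $\mathrm{PFRMMS}$, and by the max-queue for $\mathrm{IRCS}$, $\mathrm{IOMCS}$), whenever the set concerned is nonempty: - $\mathrm{IS}[i]=\Sigma I_i$; $\mathrm{IMCS}[i]=\max_{j\in[\alpha_i,\omega_i]}\mathrm{MCS}[j]$; $\mathrm{IOMCS}[i]=\max_{j\ne i}\mathrm{IMCS}[j]$; $\mathrm{IRCS}[i]$ is the greatest sum of a nonempty prefix of $A^{\setminus I_i}$; - $\mathrm{PFMCS}[p]=\max_{\alpha_k\le i<p}\mathrm{MCS}[i]$; $\mathrm{SFMCS}[p]=\max_{p\le i\le\omega_k}\mathrm{MCS}[i]$; $\mathrm{PFSF}[p]=\min(\{0\}\cup\{\Sigma A[i..j]:\alpha_k<i\le j<p\})$; - if $A$ has type 3: $\mathrm{PFRMMCS}[p]=\max\{\mathrm{MCS}[i]: i\notin[\alpha_k,p-1]\}$, and $\mathrm{PFRMMS}[p]$, the maximal sum of a (possibly empty) noncircular contiguous subsequence of $A[p..\omega_k]+A^{\setminus I_k}$; - if $A$ has type 2: $\mathrm{PRVMS}[p]=\max(\{0\}\cup\{\mathrm{MCS}[j]:j<p\})$;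 $\mathrm{INXTMS}[i]=\max_{\omega_i<j<n}\mathrm{MCS}[j]$; $x^*_i$, the last index in $I_i$ of a positive element, or $\alpha_i$ if there is none; and, for $p<x^*_k$, indices $X_1[p],X_2[p]$ with values $B_1[p],B_2[p]$, computed for decreasing $p$. For $p=x^*_k-1$: $X_1[p]=X_2[p]=x^*_k$ and $B_1[p]=B_2[p]=\mathrm{MCS}[p]$. For smaller $p$: if $\mathrm{MCS}[p]>\mathrm{MCS}[X_1[p+1]]$, then $X_1[p]=p$, $B_1[p]=\mathrm{MCS}[p]$, and $X_2,B_2$ keep their values at $p+1$. Otherwise $X_1,X_2$ keep their values, $B_h[p]=\min\{\mathrm{MCS}[p],B_h[p+1]\}$ for $h=1,2$, and then, if $\mathrm{MCS}[X_1[p]]-B_1[p]\ge\mathrm{MCS}[X_2[p]]-B_2[p]$, $(X_2[p],B_2[p])$ is replaced by $(X_1[p],B_1[p])$. **Query $(x,p)$.** If the type is 1, return $\max\{0,\Sigma A\}+\max\{0,x\}$. Otherwise replace $p=n$ by $p=0$, then $p$ by $p-\alpha \bmod n$, let $k$ be the interval index of the new $p$, and return the maximum of the following terms. - $x\ge0$: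 $x+\max\{0,\mathrm{MCS}[p-1\bmod n]\}$; $x+\mathrm{SFMCS}[p]$; if $\ell>1$, for type 2 $\mathrm{IOMCS}[k]$ and $x+\mathrm{IS}[k]+\mathrm{IRCS}[k]$, for type 3 $x+\mathrm{IOMCS}[k]$; if $p>\alpha_k$, $\mathrm{PFMCS}[p]$ and $x+\Sigma A-\mathrm{PFSF}[p]$. - $x<0$, type 3: if $p\ne\alpha_k$, $\mathrm{PFMCS}[p]$, $x+\mathrm{PFRMMCS}[p]$, $\mathrm{PFRMMS}[p]$. If $p=\alpha_k$, with $k'=k-1\bmod\ell$: $\mathrm{IMCS}[k']$ and, if $\ell>1$, $x+\mathrm{IOMCS}[k']$ and $\mathrm{IRCS}[k']$. - $x<0$, type 2: $0$; $\mathrm{PRVMS}[p]$; $x$ if $p=0$ and $x+\max\{0,\mathrm{MCS}[p-1]\}$ if $p>0$; $\mathrm{INXTMS}[k]$ if $k<\ell-1$; and, with $d=0$ if $p=\alpha_k$ and $d=\min\{-x,\mathrm{MCS}[p-1]\}$ otherwise, the following. If $p\ge x^*_k$: $\mathrm{MCS}[p]-d$. If $p<x^*_k$: with $q=X_1[p]$,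 the term $\mathrm{MCS}[q]-d$ if $q=p$ and $\mathrm{MCS}[q]-\min\{d,B_1[p]\}$ otherwise; and, with $q=X_2[p]$, the term $\mathrm{MCS}[q]-\min\{d,B_2[p]\}$. **Theorem.** There is an absolute constant $C$ such that for every sequence $A$ of $n\ge0$ real numbers: 1. the preprocessing algorithm executed on $A$ takes at most $C(n+1)$ steps; 2. once it has been executed, for every $x\in\mathbb R$ and $p\in\{0,\dots,n\}$ the query-answering algorithm computes $\mathrm{mcs}(A_p[x])$ in at most $C$ steps (worst case); 3. for all $(x_0,p_0),\dots,(x_{m-1},p_{m-1})$ with $x_i\in\mathbb R$ and $p_i\in\{0,\dots,n\}$, preprocessing $A$ and then answering the queries one by one computes $\mathrm{mcs}(A_{p_0}[x_0]),\dots,\mathrm{mcs}(A_{p_{m-1}}[x_{m-1}])$ in at most $C(n+m+1)$ steps in total. -/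

import Mathlib

/-! ## Sequences and maximal circular sums -/

/-- `A[i..j] = ⟨A i, …, A j⟩` if `0 ≤ i ≤ j < n`, and the empty sequence otherwise. -/
def subseq (A : List ℝ) (i j : ℕ) : List ℝ :=
  if i ≤ j ∧ j < A.length then (A.drop i).take (j + 1 - i) else []

/-- The possibly circular subsequence of `A` induced by `i` and `j`: it is
`A[i..n-1] + A[0..j]` if `0 ≤ j < i < n`, and `A[i..j]` otherwise. -/
def circSubseq (A : List ℝ) (i j : ℕ) : List ℝ :=
  if j < i ∧ i < A.length then subseq A i (A.length - 1) ++ subseq A 0 j else subseq A i j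

/-- `s` is the maximal circular sum of `A`: the greatest sum of a possibly circular, possibly empty
subsequence of `A`. -/
def IsMaxCircSum (A : List ℝ) (s : ℝ) : Prop :=
  IsGreatest {t : ℝ | ∃ i j : ℕ, t = (circSubseq A i j).sum} s

/-- The sequence obtained from `A` by inserting `x` into position `p`. -/
def insertAt (A : List ℝ) (p : ℕ) (x : ℝ) : List ℝ :=
  A.take p ++ [x] ++ A.drop p

/-! ## The machine model: a unit-cost real RAM

The algorithms below are written in the monad `Timed`, which counts executed instructions.
They only use the instructions of this section (each costs one step), branching on the outcome of
a comparison instruction, the two loops `forUp` and `forDown` (each iteration costs one step on top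
of its body), recursion charged with `tick`, and the moving around of a bounded number of registers.
An array is a block of memory cells, and only its most recent version is ever used again. -/

/-- The result of a computation together with the number of steps taken. -/
structure Timed (α : Type) where
  val : α
  cost : ℕ

instance : Monad Timed where
  pure a := ⟨a, 0⟩
  bind m f := ⟨(f m.val).val, m.cost + (f m.val).cost⟩

/-- An array, as a block of memory cells. -/
abbrev Mem (α : Type) := ℕ → α

namespace Timed

def tick : Timed Unit := ⟨(), 1⟩

/-- Arithmetic on real numbers or on indices. -/
def add {α : Type} [Add α] (a b : α) : Timed α := ⟨a + b, 1⟩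

def sub {α : Type} [Sub α] (a b : α) : Timed α := ⟨a - b, 1⟩

noncomputable def maxOf {α : Type} [Max α] (a b : α) : Timed α := ⟨max a b, 1⟩

noncomputable def minOf {α : Type} [Min α] (a b : α) : Timed α := ⟨min a b, 1⟩

/-- Comparisons of real numbers or of indices. -/
noncomputable def le {α : Type} [LinearOrder α] (a b : α) : Timed Bool := ⟨decide (a ≤ b), 1⟩

noncomputable def lt {α : Type} [LinearOrder α] (a b : α) : Timed Bool := ⟨decide (a < b), 1⟩

noncomputable def eq {α : Type} [LinearOrder α] (a b : α) : Timed Bool := ⟨decide (a = b), 1⟩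

/-- Access to a memory cell. -/
def read {α : Type} (M : Mem α) (i : ℕ) : Timed α := ⟨M i, 1⟩

def write {α : Type} (M : Mem α) (i : ℕ) (v : α) : Timed (Mem α) := ⟨Function.update M i v, 1⟩

/-- `for i from 0 to m - 1`. -/
def forUp {σ : Type} : ℕ → (ℕ → σ → Timed σ) → σ → Timed σ
  | 0, _, s => do
    tick
    pure s
  | m + 1, body, s => do
    let s ← forUp m body s
    tick
    body m s

/-- `for i from m - 1 down to 0`. -/
def forDown {σ : Type} : ℕ → (ℕ → σ → Timed σ) → σ → Timed σ
  | 0, _, s => do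
    tick
    pure s
  | m + 1, body, s => do
    tick
    let s ← body m s
    forDown m body s

/-- Sum of `i` and `a` modulo `m` (for `i < m` and `a ≤ m`). -/
noncomputable def addMod (m i a : ℕ) : Timed ℕ := do
  let s ← add i a
  if ← lt s m then pure s else sub s m

/-- Difference of `i` and `a` modulo `m` (for `i < m` and `a ≤ m`). -/
noncomputable def subMod (m i a : ℕ) : Timed ℕ := do
  if ← le a i then
    sub i a
  else
    let s ← add i m
    sub s a

end Timed

/-- An array all of whose cells hold zero; memory is initially in this state. -/
def zeroMem (α : Type) [Zero α] : Mem α := fun _ => 0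

/-! ## The max-queue

Elements leave in FIFO order; the oldest element of greatest key can be peeked at; an insertion
first adds a real number `d` to all keys. -/

/-- A record of the deque of a max-queue. -/
structure MQRec where
  origValue : ℝ
  diff : ℝ
  implicitNexts : ℕ
  satData : ℕ

/-- The deque occupies the cells `lo, …, hi - 1` of `recs`. Its last (oldest) record is in cell `lo`
and its first (most recent) record in cell `hi - 1`. -/
structure MaxQueue where
  maxKey : ℝ
  recs : Mem MQRec
  lo : ℕ
  hi : ℕ

namespace MaxQueue

open Timed

/-- The initially empty max-queue. -/
noncomputable def init : MaxQueue := ⟨0, fun _ => ⟨0, 0, 0, 0⟩, 0, 0⟩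

/-- The greatest key. -/
def getKeyMax (q : MaxQueue) : Timed ℝ := do
  tick
  pure q.maxKey

/-- The satellite data of the oldest element of greatest key. -/
def getSatDataMax (q : MaxQueue) : Timed ℕ := do
  let r ← read q.recs q.lo
  pure r.satData

/-- Removal of the oldest element. -/
noncomputable def pop (q : MaxQueue) : Timed MaxQueue := do
  let last ← read q.recs q.lo
  if ← lt 0 last.implicitNexts then
    let c ← sub last.implicitNexts 1
    let recs ← write q.recs q.lo { last with implicitNexts := c }
    pure { q with recs := recs }
  else
    let accD ← sub q.maxKey last.origValue
    let lo ← add q.lo 1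
    if ← lt lo q.hi then
      let last ← read q.recs lo
      let s ← add last.origValue accD
      let m ← sub s last.diff
      pure { q with lo := lo, maxKey := m }
    else
      pure { q with lo := lo }

/-- The loop of the insertion: as long as the deque is not empty and the key of its first record
is smaller than `v`, that record is removed. The arguments after `v` are the current upper end of
the deque, the accumulated increment and the number of removed elements. -/
noncomputable def pushLoop (recs : Mem MQRec) (lo : ℕ) (v : ℝ) :
    ℕ → ℝ → ℕ → Timed (ℕ × ℝ × ℕ)
  | 0, accD, impl => do
    tick
    pure (0, accD, impl)
  | hi + 1, accD, impl => do
    if ← le (hi + 1) lo then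
      pure (hi + 1, accD, impl)
    else
      let first ← read recs hi
      let s ← add first.origValue accD
      if ← le v s then
        pure (hi + 1, accD, impl)
      else
        let accD ← add accD first.diff
        let c ← add 1 first.implicitNexts
        let impl ← add impl c
        pushLoop recs lo v hi accD impl

/-- Add `d` to all keys, then insert the key `v` with satellite data `sd`. -/
noncomputable def push (v d : ℝ) (sd : ℕ) (q : MaxQueue) : Timed MaxQueue := do
  let (hi, accD, impl) ← pushLoop q.recs q.lo v q.hi d 0
  let m ← (do if ← le hi q.lo then pure v else add q.maxKey d)
  let recs ← write q.recs hi ⟨v, accD, impl, sd⟩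
  let hi ← add hi 1
  pure { maxKey := m, recs := recs, lo := q.lo, hi := hi }

end MaxQueue

/-! ## The preprocessing algorithm -/

/-- Type 1: only nonnegative or only nonpositive elements. Type 2: positive and negative elements
and some negative maximal circular sum at an element. Type 3: all other sequences. -/
inductive SeqType where
  | type1
  | type2
  | type3

/-- A division of a sequence into `ell` intervals; interval `k` goes from index `first k` to index
`last k`, and `idx i` is the number of the interval which contains index `i`. -/
structure IntervalPartition where
  ell : ℕ
  idx : Mem ℕ
  first : Mem ℕ
  last : Mem ℕ

/-- The auxiliary data stored by the preprocessing algorithm. Everything but `n`, `total` and `shift`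
refers to the circularly shifted sequence. -/
structure AuxData where
  kind : SeqType
  /-- the size of the sequence -/
  n : ℕ
  /-- the sum of the sequence -/
  total : ℝ
  /-- the number of positions by which the sequence is circularly shifted to the left -/
  shift : ℕ
  /-- the interval partition -/
  part : IntervalPartition
  /-- maximal circular sum at each element -/
  MCS : Mem ℝ
  /-- sum of each interval -/
  IS : Mem ℝ
  /-- greatest maximal circular sum at an element of the interval of `p` which is before `p` -/
  PFMCS : Mem ℝ
  /-- greatest maximal circular sum at an element not in the interval of `p` or not before `p` -/
  PFRMMCS : Mem ℝ
  /-- maximal (noncircular) sum of the sequence that begins at `p`, goes circularly to the right,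
  and stops right before the interval of `p` -/
  PFRMMS : Mem ℝ
  /-- least sum of a possibly empty subsequence of the interval of `p`, which is before `p` and
  does not include the first element of the interval -/
  PFSF : Mem ℝ
  /-- greatest maximal circular sum at an element of the interval of `p` which is not before `p` -/
  SFMCS : Mem ℝ
  /-- greatest maximal circular sum at an element of each interval -/
  IMCS : Mem ℝ
  /-- greatest maximal circular sum at an element outside each interval -/
  IOMCS : Mem ℝ
  /-- greatest sum of a prefix of the sequence of all other intervals, which goes circularly to the
  right from the end of each interval -/
  IRCS : Mem ℝ
  /-- maximum of zero and all maximal sums at elements before `p` -/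
  PRVMS : Mem ℝ
  /-- greatest maximal sum at an element to the right of each interval -/
  INXTMS : Mem ℝ
  /-- index of the last positive element of each interval, or its first index if there is none -/
  IXs : Mem ℕ
  /-- the two indices (and the least maximal sums from `p` to before them) which determine the
  effect of inserting a negative number on the interval of `p` -/
  X1 : Mem ℕ
  X2 : Mem ℕ
  BX1 : Mem ℝ
  BX2 : Mem ℝ

namespace Preprocessing

open Timed MaxQueue

/-- The sum of the sequence, and whether it has positive and whether it has negative elements. -/
noncomputable def sumAndSigns (n : ℕ) (A : Mem ℝ) : Timed (ℝ × Bool × Bool) :=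
  forUp n (fun i (s, pos, neg) => do
    let a ← read A i
    let s ← add s a
    if ← lt 0 a then
      pure (s, true, neg)
    else if ← lt a 0 then
      pure (s, pos, true)
    else
      pure (s, pos, neg)) (0, false, false)

/-- The array `MCS` of the maximal circular sums at the elements, and the array `OMCS` of the
circularly leftmost indices at which subsequences of these sums begin (`n ≥ 1`). -/
noncomputable def maxCircSums (n : ℕ) (A : Mem ℝ) : Timed (Mem ℝ × Mem ℕ) := do
  let q ← forUp n (fun i q => do
    let a ← read A i
    push a a i q) init
  let e ← sub n 1
  let v ← getKeyMax q
  let M ← write (zeroMem ℝ) e v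
  let o ← getSatDataMax q
  let O ← write (zeroMem ℕ) e o
  let (_, M, O) ← forUp e (fun i (q, M, O) => do
    let q ← pop q
    let a ← read A i
    let q ← push a a i q
    let v ← getKeyMax q
    let M ← write M i v
    let o ← getSatDataMax q
    let O ← write O i o
    pure (q, M, O)) (q, M, O)
  pure (M, O)

/-- The number of positions of the left-shift: the least `i` such that `OMCS` differs at `i` and at
the index circularly before `i`, or `OMCS 0` if `OMCS` is constant. -/
noncomputable def findShift (n : ℕ) (O : Mem ℕ) : Timed ℕ := do
  let o ← read O 0
  forDown n (fun i s => do
    let j ← subMod n i 1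
    let a ← read O j
    let b ← read O i
    if ← eq a b then pure s else pure i) o

/-- Circular left-shift of `A`, `MCS` and `OMCS`. -/
noncomputable def shiftArrays (n c : ℕ) (A M : Mem ℝ) (O : Mem ℕ) :
    Timed (Mem ℝ × Mem ℝ × Mem ℕ) :=
  forUp n (fun i (A', M', O') => do
    let j ← addMod n i c
    let a ← read A j
    let A' ← write A' i a
    let m ← read M j
    let M' ← write M' i m
    let o ← read O j
    let o ← subMod n o c
    let O' ← write O' i o
    pure (A', M', O')) (zeroMem ℝ, zeroMem ℝ, zeroMem ℕ)

/-- Whether some maximal circular sum at an element is negative. -/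
noncomputable def hasNegative (n : ℕ) (M : Mem ℝ) : Timed Bool :=
  forUp n (fun i b => do
    let m ← read M i
    if ← lt m 0 then pure true else pure b) false

/-- The interval partition: consecutive elements belong to the same interval iff `OMCS` has the same
value at them. -/
noncomputable def partition (n : ℕ) (O : Mem ℕ) : Timed IntervalPartition :=
  forUp n (fun i P => do
    let new ← (do
      if ← eq i 0 then
        pure true
      else
        let j ← sub i 1
        let a ← read O j
        let b ← read O i
        let same ← eq a b
        pure (!same))
    if new then
      let K ← write P.idx i P.ell
      let F ← write P.first P.ell i
      let L ← write P.last P.ell i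
      let m ← add P.ell 1
      pure ⟨m, K, F, L⟩
    else
      let k ← sub P.ell 1
      let K ← write P.idx i k
      let L ← write P.last k i
      pure ⟨P.ell, K, P.first, L⟩) ⟨0, zeroMem ℕ, zeroMem ℕ, zeroMem ℕ⟩

/-- For each interval, its sum (`IS`) and the greatest sum of one of its prefixes (`IMPFS`). -/
noncomputable def intervalSums (n : ℕ) (P : IntervalPartition) (A : Mem ℝ) :
    Timed (Mem ℝ × Mem ℝ) :=
  forUp n (fun i (S, F) => do
    let k ← read P.idx i
    let f ← read P.first k
    let a ← read A i
    if ← eq i f then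
      let S ← write S k a
      let F ← write F k a
      pure (S, F)
    else
      let s ← read S k
      let s ← add s a
      let S ← write S k s
      let g ← read F k
      let g ← maxOf g s
      let F ← write F k g
      pure (S, F)) (zeroMem ℝ, zeroMem ℝ)

/-- The array `IMCS`. -/
noncomputable def intervalMax (n : ℕ) (P : IntervalPartition) (M : Mem ℝ) : Timed (Mem ℝ) :=
  forUp n (fun i R => do
    let k ← read P.idx i
    let f ← read P.first k
    let m ← read M i
    if ← eq i f then
      write R k m
    else
      let r ← read R k
      let r ← maxOf r m
      write R k r) (zeroMem ℝ)

/-- The array `SFMCS`. -/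
noncomputable def suffixMax (n : ℕ) (P : IntervalPartition) (M : Mem ℝ) : Timed (Mem ℝ) :=
  forDown n (fun p R => do
    let k ← read P.idx p
    let l ← read P.last k
    let m ← read M p
    if ← eq p l then
      write R p m
    else
      let j ← add p 1
      let r ← read R j
      let r ← maxOf m r
      write R p r) (zeroMem ℝ)

/-- The array `PFMCS` (only defined for `p` greater than the first index of its interval). -/
noncomputable def prefixMax (n : ℕ) (P : IntervalPartition) (M : Mem ℝ) : Timed (Mem ℝ) :=
  forUp n (fun p R => do
    let k ← read P.idx p
    let f ← read P.first k
    if ← eq p f then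
      pure R
    else
      let j ← sub p 1
      let m ← read M j
      if ← eq j f then
        write R p m
      else
        let r ← read R j
        let r ← maxOf r m
        write R p r) (zeroMem ℝ)

/-- The array `PFSF` (only defined for `p` greater than the first index of its interval), by runs of
Kadane's algorithm on the sequence of the opposites of the elements. -/
noncomputable def prefixMinSum (n : ℕ) (P : IntervalPartition) (A : Mem ℝ) : Timed (Mem ℝ) := do
  let (_, _, R) ← forUp n (fun p (cur, best, R) => do
    let k ← read P.idx p
    let f ← read P.first k
    if ← eq p f then
      pure (0, 0, R)
    else
      let j ← sub p 1
      if ← eq j f then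
        let R ← write R p 0
        pure (0, 0, R)
      else
        let a ← read A j
        let c ← maxOf 0 cur
        let cur ← sub c a
        let best ← maxOf best cur
        let v ← sub 0 best
        let R ← write R p v
        pure (cur, best, R)) ((0 : ℝ), (0 : ℝ), zeroMem ℝ)
  pure R

/-- Given an element with key `V i` and increment `D i` for each interval `i`, the array whose cell
`i` holds the greatest key of the max-queue in which, circularly from interval `i - 1` down to
interval `i + 1`, the elements of all intervals but `i` have been inserted (for `ell > 1`). -/
noncomputable def otherIntervals (ell : ℕ) (V D : Mem ℝ) : Timed (Mem ℝ) := do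
  if ← le ell 1 then
    pure (zeroMem ℝ)
  else
    let e ← sub ell 1
    let q ← forDown e (fun j q => do
      let i ← add j 1
      let v ← read V i
      let d ← read D i
      push v d 0 q) init
    let g ← getKeyMax q
    let R ← write (zeroMem ℝ) 0 g
    let (_, R) ← forDown e (fun j (q, R) => do
      let q ← pop q
      let i ← addMod ell j 2
      let v ← read V i
      let d ← read D i
      let q ← push v d 0 q
      let g ← getKeyMax q
      let t ← add j 1
      let R ← write R t g
      pure (q, R)) (q, R)
    pure R

/-- The array `PFRMMS`, by right-to-left runs of Kadane's algorithm on the intervals, each followed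
by its value in `IRCS` if there is more than one interval. -/
noncomputable def rotatedMaxSum (n : ℕ) (P : IntervalPartition) (A IRCS : Mem ℝ) :
    Timed (Mem ℝ) := do
  let (_, _, R) ← forDown n (fun p (cur, best, R) => do
    let k ← read P.idx p
    let l ← read P.last k
    let (cur, best) ← (do
      if ← eq p l then
        if ← le P.ell 1 then
          pure (0, 0)
        else
          let r ← read IRCS k
          let b ← maxOf 0 r
          pure (r, b)
      else
        pure (cur, best))
    let a ← read A p
    let c ← maxOf 0 cur
    let cur ← add a c
    let best ← maxOf best cur
    let R ← write R p best
    pure (cur, best, R)) ((0 : ℝ), (0 : ℝ), zeroMem ℝ)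
  pure R

/-- The array `PFRMMCS`. -/
noncomputable def rotatedMaxCircSum (n : ℕ) (P : IntervalPartition) (M IOMCS : Mem ℝ) :
    Timed (Mem ℝ) :=
  forDown n (fun p R => do
    let k ← read P.idx p
    let l ← read P.last k
    let m ← read M p
    if ← eq p l then
      if ← le P.ell 1 then
        write R p m
      else
        let r ← read IOMCS k
        let r ← maxOf m r
        write R p r
    else
      let j ← add p 1
      let r ← read R j
      let r ← maxOf m r
      write R p r) (zeroMem ℝ)

/-- The array `PRVMS`. -/
noncomputable def prevMaxSums (n : ℕ) (M : Mem ℝ) : Timed (Mem ℝ) :=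
  forUp n (fun i R => do
    let m ← read M i
    let r ← read R i
    let r ← maxOf r m
    let j ← add i 1
    write R j r) (zeroMem ℝ)

/-- The array `INXTMS` (not defined for the last interval). -/
noncomputable def nextMaxSums (n : ℕ) (P : IntervalPartition) (M : Mem ℝ) : Timed (Mem ℝ) := do
  let (_, R) ← forDown n (fun j (g, R) => do
    let m ← read M j
    let t ← add j 1
    let g ← (do if ← eq t n then pure m else maxOf m g)
    let k ← read P.idx j
    let f ← read P.first k
    if ← eq j f then
      if ← eq k 0 then
        pure (g, R)
      else
        let k ← sub k 1
        let R ← write R k g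
        pure (g, R)
    else
      pure (g, R)) ((0 : ℝ), zeroMem ℝ)
  pure R

/-- The index of the last positive element of each interval, or its first index if there is none. -/
noncomputable def lastPositive (n : ℕ) (P : IntervalPartition) (A : Mem ℝ) : Timed (Mem ℕ) :=
  forUp n (fun i R => do
    let k ← read P.idx i
    let f ← read P.first k
    let a ← read A i
    if ← eq i f then
      write R k i
    else if ← lt 0 a then
      write R k i
    else
      pure R) (zeroMem ℕ)

/-- The arrays `X1`, `X2`, `BX1` and `BX2`, which are computed from right to left inside each interval,
beginning right before the index `IXs k`. -/
noncomputable def peakArrays (n : ℕ) (P : IntervalPartition) (M : Mem ℝ) (IXs : Mem ℕ) :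
    Timed (Mem ℕ × Mem ℕ × Mem ℝ × Mem ℝ) :=
  forDown n (fun p (X1, X2, B1, B2) => do
    let k ← read P.idx p
    let xs ← read IXs k
    let j ← add p 1
    let m ← read M p
    if ← lt xs j then
      pure (X1, X2, B1, B2)
    else if ← eq j xs then
      let X1 ← write X1 p xs
      let X2 ← write X2 p xs
      let B1 ← write B1 p m
      let B2 ← write B2 p m
      pure (X1, X2, B1, B2)
    else
      let x1 ← read X1 j
      let x2 ← read X2 j
      let b1 ← read B1 j
      let b2 ← read B2 j
      let m1 ← read M x1
      if ← lt m1 m then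
        let X1 ← write X1 p p
        let B1 ← write B1 p m
        let X2 ← write X2 p x2
        let B2 ← write B2 p b2
        pure (X1, X2, B1, B2)
      else
        let X1 ← write X1 p x1
        let b1 ← minOf m b1
        let B1 ← write B1 p b1
        let b2 ← minOf m b2
        let m2 ← read M x2
        let d1 ← sub m1 b1
        let d2 ← sub m2 b2
        if ← le d2 d1 then
          let X2 ← write X2 p x1
          let B2 ← write B2 p b1
          pure (X1, X2, B1, B2)
        else
          let X2 ← write X2 p x2
          let B2 ← write B2 p b2
          pure (X1, X2, B1, B2))
    (zeroMem ℕ, zeroMem ℕ, zeroMem ℝ, zeroMem ℝ)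

end Preprocessing

open Timed Preprocessing in
/-- The preprocessing algorithm; the sequence is stored in the cells `0, …, n - 1` of `A`. -/
noncomputable def preprocess (n : ℕ) (A : Mem ℝ) : Timed AuxData := do
  let (total, pos, neg) ← sumAndSigns n A
  let base : AuxData :=
    { kind := .type1, n := n, total := total, shift := 0,
      part := ⟨0, zeroMem ℕ, zeroMem ℕ, zeroMem ℕ⟩,
      MCS := zeroMem ℝ, IS := zeroMem ℝ, PFMCS := zeroMem ℝ, PFRMMCS := zeroMem ℝ,
      PFRMMS := zeroMem ℝ, PFSF := zeroMem ℝ, SFMCS := zeroMem ℝ, IMCS := zeroMem ℝ,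
      IOMCS := zeroMem ℝ, IRCS := zeroMem ℝ, PRVMS := zeroMem ℝ, INXTMS := zeroMem ℝ,
      IXs := zeroMem ℕ, X1 := zeroMem ℕ, X2 := zeroMem ℕ, BX1 := zeroMem ℝ, BX2 := zeroMem ℝ }
  if pos && neg then
    let (M, O) ← maxCircSums n A
    let c ← findShift n O
    let (A, M, O) ← shiftArrays n c A M O
    let isType2 ← hasNegative n M
    let P ← partition n O
    let (IS, IMPFS) ← intervalSums n P A
    let IMCS ← intervalMax n P M
    let SFMCS ← suffixMax n P M
    let PFMCS ← prefixMax n P M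
    let PFSF ← prefixMinSum n P A
    let IRCS ← otherIntervals P.ell IMPFS IS
    let IOMCS ← otherIntervals P.ell IMCS (zeroMem ℝ)
    let base : AuxData :=
      { base with
        shift := c, part := P, MCS := M, IS := IS, IMCS := IMCS, SFMCS := SFMCS,
        PFMCS := PFMCS, PFSF := PFSF, IRCS := IRCS, IOMCS := IOMCS }
    if isType2 then
      let PRVMS ← prevMaxSums n M
      let INXTMS ← nextMaxSums n P M
      let IXs ← lastPositive n P A
      let (X1, X2, BX1, BX2) ← peakArrays n P M IXs
      pure { base with
        kind := .type2, PRVMS := PRVMS, INXTMS := INXTMS, IXs := IXs,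
        X1 := X1, X2 := X2, BX1 := BX1, BX2 := BX2 }
    else
      let PFRMMS ← rotatedMaxSum n P A IRCS
      let PFRMMCS ← rotatedMaxCircSum n P M IOMCS
      pure { base with kind := .type3, PFRMMS := PFRMMS, PFRMMCS := PFRMMCS }
  else
    pure base

/-! ## The query-answering algorithm -/

namespace Query

open Timed

/-- `x ≥ 0` and a sequence of type 2 or 3; `p` is already adapted to the shifted sequence. -/
noncomputable def nonneg (D : AuxData) (isType2 : Bool) (x : ℝ) (p : ℕ) : Timed ℝ := do
  let k ← read D.part.idx p
  let f ← read D.part.first k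
  -- the new element
  let j ← subMod D.n p 1
  let m ← read D.MCS j
  let m ← maxOf 0 m
  let r ← add x m
  -- the elements of the interval of p which are not before p
  let s ← read D.SFMCS p
  let s ← add x s
  let r ← maxOf r s
  -- the other intervals
  let r ← (do
    if ← lt 1 D.part.ell then
      let o ← read D.IOMCS k
      if isType2 then
        let r ← maxOf r o
        let u ← read D.IS k
        let w ← read D.IRCS k
        let u ← add u w
        let u ← add x u
        maxOf r u
      else
        let o ← add x o
        maxOf r o
    else
      pure r)
  -- the elements of the interval of p which are before p
  if ← lt f p then
    let g ← read D.PFMCS p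
    let r ← maxOf r g
    let h ← read D.PFSF p
    let t ← sub D.total h
    let t ← add x t
    maxOf r t
  else
    pure r

/-- `x < 0` and a sequence of type 2. -/
noncomputable def negType2 (D : AuxData) (x : ℝ) (p : ℕ) : Timed ℝ := do
  let k ← read D.part.idx p
  let f ← read D.part.first k
  let mp ← read D.MCS p
  -- the elements before p
  let r ← read D.PRVMS p
  let r ← maxOf 0 r
  -- the new element
  let nw ← (do
    if ← eq p 0 then
      pure x
    else
      let j ← sub p 1
      let m ← read D.MCS j
      let m ← maxOf 0 m
      add x m)
  let r ← maxOf r nw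
  -- the decrease of the maximal sum at element p
  let dec ← (do
    if ← eq p f then
      pure 0
    else
      let j ← sub p 1
      let m ← read D.MCS j
      let y ← sub 0 x
      minOf y m)
  -- the elements of the interval of p which are not before p
  let xs ← read D.IXs k
  let r ← (do
    if ← le xs p then
      let v ← sub mp dec
      maxOf r v
    else
      let x1 ← read D.X1 p
      let m1 ← read D.MCS x1
      let v1 ← (do
        if ← eq x1 p then
          sub m1 dec
        else
          let b1 ← read D.BX1 p
          let d1 ← minOf dec b1
          sub m1 d1)
      let r ← maxOf r v1
      let x2 ← read D.X2 p
      let m2 ← read D.MCS x2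
      let b2 ← read D.BX2 p
      let d2 ← minOf dec b2
      let v2 ← sub m2 d2
      maxOf r v2)
  -- the next intervals
  let t ← add k 1
  if ← lt t D.part.ell then
    let g ← read D.INXTMS k
    maxOf r g
  else
    pure r

/-- `x < 0` and a sequence of type 3. -/
noncomputable def negType3 (D : AuxData) (x : ℝ) (p : ℕ) : Timed ℝ := do
  let k ← read D.part.idx p
  let f ← read D.part.first k
  if ← eq p f then
    let k' ← subMod D.part.ell k 1
    let r ← read D.IMCS k'
    if ← lt 1 D.part.ell then
      let o ← read D.IOMCS k'
      let o ← add x o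
      let r ← maxOf r o
      let w ← read D.IRCS k'
      maxOf r w
    else
      pure r
  else
    let g ← read D.PFMCS p
    let o ← read D.PFRMMCS p
    let o ← add x o
    let r ← maxOf g o
    let w ← read D.PFRMMS p
    maxOf r w

end Query

open Timed Query in
/-- The query-answering algorithm, for the insertion of `x` into position `p ≤ n` of the
sequence to which the auxiliary data `D` belongs. -/
noncomputable def query (D : AuxData) (x : ℝ) (p : ℕ) : Timed ℝ := do
  tick
  match D.kind with
  | .type1 =>
    let a ← maxOf 0 D.total
    let b ← maxOf 0 x
    add a b
  | .type2 =>
    let p ← (do if ← eq p D.n then pure 0 else pure p)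
    let p ← subMod D.n p D.shift
    if ← le 0 x then nonneg D true x p else negType2 D x p
  | .type3 =>
    let p ← (do if ← eq p D.n then pure 0 else pure p)
    let p ← subMod D.n p D.shift
    if ← le 0 x then nonneg D false x p else negType3 D x p

/-- A list of queries is answered one after the other. -/
noncomputable def answerQueries (D : AuxData) : List (ℝ × ℕ) → Timed (List ℝ)
  | [] => do
    Timed.tick
    pure []
  | (x, p) :: qs => do
    Timed.tick
    let r ← query D x p
    let rs ← answerQueries D qs
    pure (r :: rs)

/-- The algorithm for a sequence and a list of independent insertions into it: preprocess the
sequence once, then answer the queries. -/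
noncomputable def solveInsertions (n : ℕ) (A : Mem ℝ) (qs : List (ℝ × ℕ)) : Timed (List ℝ) := do
  let D ← preprocess n A
  answerQueries D qs

/-- A sequence of size `n` as input: its elements are in the cells `0, …, n - 1`. -/
def load (A : List ℝ) : Mem ℝ := fun i => A.getD i 0

/-!
Let `P = periodicSum n A` be the prefix sums of the `n`-periodic extension of `A`. Everything is
expressed by `P`: a circular subsequence is a pair `u ≤ v ≤ u + n` with sum `P v - P u`, and the
maximal circular sum at `i` is `P (i + n + 1)` minus the least value of `P` on the window
`[i + 1, i + n]`. The sums which are possible after an insertion of `x` at `p` (`insertedSums`) are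
those of the subsequences of the period `[p, p + n]`, which avoid the gap at `p`, and `x` plus the
sums of their complements (`setOf_sum_circSubseq_insertAt`).

*Preprocessing.* The max-queue computes window minima of `P`: its deque consists of the positions of
the window which no later position undercuts (`MaxQueue.Holds`), and as each step of the loop of an
insertion removes a record, the upper end of the deque is a potential which makes the cost linear.
`OMCS` is the position of the leftmost window minimum, which moves to the right with `i`. The sum
`P n` decides the shape of the maximal runs of constant `OMCS`. If `P n < 0`, the minimum only ever
changes to the position which newly enters the window, and on an interval
`MCS i = P (i + 1) - P (first k)`, where `P (first k)` is a minimum of the values of `P` up to the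
interval's end (`HasNegativeIntervals`). If `P n ≥ 0`, it only changes when it leaves the window,
and `MCS i = P (i + n + 1) - P (last k + 1)`, where `P (last k + 1)` is a minimum over the following
period (`HasNonnegIntervals`). Some `MCS i` is negative exactly if `P n < 0` (`exists_neg_iff`), so
that the type of the sequence separates the two cases. All other arrays are maxima or minima of
differences of `P` over ranges, by loop invariants.

*Queries.* Each term that the algorithm takes into account belongs to `insertedSums`, and every
element of `insertedSums` is bounded by one of the terms. For `x ≥ 0`, and for `x < 0` and type 3,
this follows from the shape of the intervals: the window minimum from which `MCS i` is measured
tells whether the gap belongs to the subsequence of greatest sum at `i`. For `x < 0` and type 2, the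
greatest sum at an element `q ≥ p` of the interval of `p` becomes `MCS q - min d b`, where `b` is
the least value of `MCS` from `p` to before `q` and `d` is the decrease which `x` causes right after
`p`: to begin the subsequence at the least prefix sum after the gap is the only alternative to
paying for `x`. Of all these `q` two suffice (`IsPeak`): `X1`, where `MCS` is greatest, and `X2`,
for which the rise `MCS q - b` is greatest. The maximum of the two terms and `0` is that over all
`q`, as `MCS q - min d b` is the greater of `MCS q - d` and `MCS q - b`. Beyond the last positive
element of the interval, the sums do not increase.
-/

/-! ### Values and costs of timed computations -/

namespace Timed

variable {α β σ : Type}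

@[simp] theorem bind_val (m : Timed α) (f : α → Timed β) : (m >>= f).val = (f m.val).val := rfl

@[simp] theorem bind_cost (m : Timed α) (f : α → Timed β) :
    (m >>= f).cost = m.cost + (f m.val).cost := rfl

@[simp] theorem pure_val (a : α) : (pure a : Timed α).val = a := rfl

@[simp] theorem pure_cost (a : α) : (pure a : Timed α).cost = 0 := rfl

@[simp] theorem ite_val (c : Prop) [Decidable c] (a b : Timed α) :
    (if c then a else b).val = if c then a.val else b.val := apply_ite _ _ _ _

@[simp] theorem ite_cost (c : Prop) [Decidable c] (a b : Timed α) :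
    (if c then a else b).cost = if c then a.cost else b.cost := apply_ite _ _ _ _

@[simp] theorem tick_cost : tick.cost = 1 := rfl

@[simp] theorem add_val [Add α] (a b : α) : (add a b).val = a + b := rfl

@[simp] theorem add_cost [Add α] (a b : α) : (add a b).cost = 1 := rfl

@[simp] theorem sub_val [Sub α] (a b : α) : (sub a b).val = a - b := rfl

@[simp] theorem sub_cost [Sub α] (a b : α) : (sub a b).cost = 1 := rfl

@[simp] theorem maxOf_val [Max α] (a b : α) : (maxOf a b).val = max a b := rfl

@[simp] theorem maxOf_cost [Max α] (a b : α) : (maxOf a b).cost = 1 := rfl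

@[simp] theorem minOf_val [Min α] (a b : α) : (minOf a b).val = min a b := rfl

@[simp] theorem minOf_cost [Min α] (a b : α) : (minOf a b).cost = 1 := rfl

@[simp] theorem le_val [LinearOrder α] (a b : α) : (le a b).val = decide (a ≤ b) := rfl

@[simp] theorem le_cost [LinearOrder α] (a b : α) : (le a b).cost = 1 := rfl

@[simp] theorem lt_val [LinearOrder α] (a b : α) : (lt a b).val = decide (a < b) := rfl

@[simp] theorem lt_cost [LinearOrder α] (a b : α) : (lt a b).cost = 1 := rfl

@[simp] theorem eq_val [LinearOrder α] (a b : α) : (eq a b).val = decide (a = b) := rfl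

@[simp] theorem eq_cost [LinearOrder α] (a b : α) : (eq a b).cost = 1 := rfl

@[simp] theorem read_val (M : Mem α) (i : ℕ) : (read M i).val = M i := rfl

@[simp] theorem read_cost (M : Mem α) (i : ℕ) : (read M i).cost = 1 := rfl

@[simp] theorem write_val (M : Mem α) (i : ℕ) (v : α) :
    (write M i v).val = Function.update M i v := rfl

@[simp] theorem write_cost (M : Mem α) (i : ℕ) (v : α) : (write M i v).cost = 1 := rfl

theorem addMod_cost (m i a : ℕ) : (addMod m i a).cost ≤ 3 := by
  unfold addMod
  simp
  split_ifs <;> simp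

theorem subMod_cost (m i a : ℕ) : (subMod m i a).cost ≤ 3 := by
  unfold subMod
  simp
  split_ifs <;> simp

theorem addMod_val {m i a : ℕ} (hi : i < m) (ha : a ≤ m) : (addMod m i a).val = (i + a) % m := by
  unfold addMod
  simp
  split_ifs with h
  · rw [Nat.mod_eq_of_lt h]
  · rw [Nat.mod_eq_sub_mod (by omega), Nat.mod_eq_of_lt (by omega)]

theorem subMod_val {m i a : ℕ} (hi : i < m) (ha : a ≤ m) :
    (subMod m i a).val = (i + m - a) % m := by
  unfold subMod
  simp
  split_ifs with h
  · rw [show i + m - a = (i - a) + m by omega, Nat.add_mod_right, Nat.mod_eq_of_lt (by omega)]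
  · rw [Nat.mod_eq_of_lt (by omega)]

theorem forUp_induct {body : ℕ → σ → Timed σ} {s : σ} (Inv : ℕ → σ → Prop) (m : ℕ) (h0 : Inv 0 s)
    (hs : ∀ i < m, ∀ s, Inv i s → Inv (i + 1) (body i s).val) :
    Inv m (forUp m body s).val := by
  induction m with
  | zero => exact h0
  | succ m ih => exact hs m (by omega) _ (ih fun i hi => hs i (by omega))

theorem forDown_induct {body : ℕ → σ → Timed σ} {s : σ} (Inv : ℕ → σ → Prop) (m : ℕ) (h0 : Inv m s)
    (hs : ∀ i < m, ∀ s, Inv (i + 1) s → Inv i (body i s).val) :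
    Inv 0 (forDown m body s).val := by
  induction m generalizing s with
  | zero => exact h0
  | succ m ih => exact ih (hs m (by omega) _ h0) fun i hi => hs i (by omega)

/-- Amortized analysis of an ascending loop: `φ` is the potential, `c` the amortized cost of the
body. -/
theorem forUp_cost_potential {body : ℕ → σ → Timed σ} (φ : σ → ℕ) (c : ℕ)
    (h : ∀ i s, (body i s).cost + φ (body i s).val ≤ φ s + c) (m : ℕ) (s : σ) :
    (forUp m body s).cost + φ (forUp m body s).val ≤ φ s + (c + 1) * m + 1 := by
  induction m with
  | zero => simp [forUp]; omega
  | succ m ih =>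
    have := h m (forUp m body s).val
    simp only [forUp, bind_val, bind_cost, tick_cost]
    linarith

/-- Amortized analysis of a descending loop: `φ` is the potential, `c` the amortized cost of the
body. -/
theorem forDown_cost_potential {body : ℕ → σ → Timed σ} (φ : σ → ℕ) (c : ℕ)
    (h : ∀ i s, (body i s).cost + φ (body i s).val ≤ φ s + c) (m : ℕ) (s : σ) :
    (forDown m body s).cost + φ (forDown m body s).val ≤ φ s + (c + 1) * m + 1 := by
  induction m generalizing s with
  | zero => simp [forDown]; omega
  | succ m ih =>
    have := h m s
    have := ih (body m s).val
    simp only [forDown, bind_val, bind_cost, tick_cost]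
    linarith

theorem forUp_cost {body : ℕ → σ → Timed σ} (c : ℕ) (h : ∀ i s, (body i s).cost ≤ c) (m : ℕ)
    (s : σ) : (forUp m body s).cost ≤ (c + 1) * m + 1 := by
  have := forUp_cost_potential (fun _ => 0) c (by simpa using h) m s
  omega

theorem forDown_cost {body : ℕ → σ → Timed σ} (c : ℕ) (h : ∀ i s, (body i s).cost ≤ c) (m : ℕ)
    (s : σ) : (forDown m body s).cost ≤ (c + 1) * m + 1 := by
  have := forDown_cost_potential (fun _ => 0) c (by simpa using h) m s
  omega

end Timed

/-! ### Running times -/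

namespace MaxQueue

open Timed

@[simp] theorem getKeyMax_val (q : MaxQueue) : (getKeyMax q).val = q.maxKey := rfl

@[simp] theorem getKeyMax_cost (q : MaxQueue) : (getKeyMax q).cost = 1 := rfl

@[simp] theorem getSatDataMax_val (q : MaxQueue) : (getSatDataMax q).val = (q.recs q.lo).satData :=
  rfl

@[simp] theorem getSatDataMax_cost (q : MaxQueue) : (getSatDataMax q).cost = 1 := rfl

theorem pop_cost (q : MaxQueue) : (pop q).cost ≤ 8 := by
  unfold pop
  simp
  split_ifs <;> simp

theorem pop_hi (q : MaxQueue) : (pop q).val.hi = q.hi := by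
  unfold pop
  simp
  split_ifs <;> simp

theorem pushLoop_cost (recs : Mem MQRec) (lo : ℕ) (v : ℝ) (hi : ℕ) (accD : ℝ) (impl : ℕ) :
    (pushLoop recs lo v hi accD impl).cost + 8 * (pushLoop recs lo v hi accD impl).val.1
      ≤ 8 * hi + 8 := by
  induction hi generalizing accD impl with
  | zero => simp [pushLoop]
  | succ hi ih =>
    have := ih (accD + (recs hi).diff) (impl + (1 + (recs hi).implicitNexts))
    simp [pushLoop]
    split_ifs <;> (try simp) <;> omega

/-- The amortized cost of an insertion is constant: each iteration of its loop lowers the upper end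
of the deque, which serves as the potential. -/
theorem push_cost (v d : ℝ) (sd : ℕ) (q : MaxQueue) :
    (push v d sd q).cost + 8 * (push v d sd q).val.hi ≤ 8 * q.hi + 20 := by
  have h := pushLoop_cost q.recs q.lo v q.hi d 0
  have e1 : (push v d sd q).val.hi = (pushLoop q.recs q.lo v q.hi d 0).val.1 + 1 := rfl
  have e2 : (push v d sd q).cost ≤ (pushLoop q.recs q.lo v q.hi d 0).cost + 4 := by
    unfold push
    simp
    split_ifs <;> simp
  omega

end MaxQueue

namespace Preprocessing

open Timed MaxQueue

theorem sumAndSigns_cost (n : ℕ) (A : Mem ℝ) : (sumAndSigns n A).cost ≤ 5 * n + 1 := by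
  refine forUp_cost 4 ?_ n _
  rintro i ⟨s, pos, neg⟩
  simp
  split_ifs <;> simp

theorem maxCircSums_cost (n : ℕ) (A : Mem ℝ) : (maxCircSums n A).cost ≤ 80 * n + 10 := by
  have h1 := forUp_cost_potential (fun q : MaxQueue => 8 * q.hi) 21
    (body := fun i q => do
      let a ← read A i
      push a a i q) (by
      intro i q
      have := push_cost (A i) (A i) i q
      simp only [bind_cost, bind_val, read_cost, read_val]
      omega) n init
  have h2 := fun s => forUp_cost_potential (fun s : MaxQueue × Mem ℝ × Mem ℕ => 8 * s.1.hi) 40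
    (body := fun i (q, M, O) => do
      let q ← pop q
      let a ← read A i
      let q ← push a a i q
      let v ← getKeyMax q
      let M ← write M i v
      let o ← getSatDataMax q
      let O ← write O i o
      pure (q, M, O)) (by
      rintro i ⟨q, M, O⟩
      have h1 := pop_cost q
      have h2 := pop_hi q
      have := push_cost (A i) (A i) i (pop q).val
      simp only [bind_cost, bind_val, read_cost, read_val, getKeyMax_cost, write_cost,
        getSatDataMax_cost, pure_cost, pure_val]
      omega) (n - 1) s
  unfold maxCircSums
  simp only [bind_cost, sub_cost, sub_val, getKeyMax_cost, write_cost,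
    getSatDataMax_cost, pure_cost]
  set q := (forUp n _ init).val
  set qc := (forUp n _ init).cost
  have := h2 (q, (write (zeroMem ℝ) (n - 1) (getKeyMax q).val).val,
    (write (zeroMem ℕ) (n - 1) (getSatDataMax q).val).val)
  have h0 : (init : MaxQueue).hi = 0 := rfl
  simp only [h0] at h1
  dsimp only at this
  omega

theorem findShift_cost (n : ℕ) (O : Mem ℕ) : (findShift n O).cost ≤ 7 * n + 2 := by
  have := forDown_cost (body := fun i s => do
    let j ← subMod n i 1
    let a ← read O j
    let b ← read O i
    if ← eq a b then pure s else pure i) 6 (by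
      intro i s
      have := subMod_cost n i 1
      simp
      omega) n (O 0)
  unfold findShift
  simp only [bind_cost, read_cost, read_val] at *
  omega

theorem shiftArrays_cost (n c : ℕ) (A M : Mem ℝ) (O : Mem ℕ) :
    (shiftArrays n c A M O).cost ≤ 13 * n + 1 := by
  refine forUp_cost 12 ?_ n _
  rintro i ⟨A', M', O'⟩
  have := addMod_cost n i c
  have := subMod_cost n (O (addMod n i c).val) c
  simp only [bind_cost, read_cost, read_val, write_cost, pure_cost]
  omega

theorem hasNegative_cost (n : ℕ) (M : Mem ℝ) : (hasNegative n M).cost ≤ 3 * n + 1 := by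
  refine forUp_cost 2 ?_ n _
  intro i s
  simp

theorem partition_cost (n : ℕ) (O : Mem ℕ) : (partition n O).cost ≤ 10 * n + 1 := by
  refine forUp_cost 9 ?_ n _
  intro i s
  simp
  split_ifs <;> simp

theorem partition_ell_le (n : ℕ) (O : Mem ℕ) : (partition n O).val.ell ≤ n := by
  unfold partition
  refine forUp_induct (fun i (P : IntervalPartition) => P.ell ≤ i) n le_rfl ?_
  intro i _ P h
  simp only [bind_val, ite_val, pure_val, add_val]
  split_ifs <;> simp <;> omega

theorem intervalSums_cost (n : ℕ) (P : IntervalPartition) (A : Mem ℝ) :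
    (intervalSums n P A).cost ≤ 12 * n + 1 := by
  refine forUp_cost 11 ?_ n _
  rintro i ⟨S, F⟩
  simp
  split_ifs <;> simp

theorem intervalMax_cost (n : ℕ) (P : IntervalPartition) (M : Mem ℝ) :
    (intervalMax n P M).cost ≤ 8 * n + 1 := by
  refine forUp_cost 7 ?_ n _
  intro i s
  simp
  split_ifs <;> simp

theorem suffixMax_cost (n : ℕ) (P : IntervalPartition) (M : Mem ℝ) :
    (suffixMax n P M).cost ≤ 9 * n + 1 := by
  refine forDown_cost 8 ?_ n _
  intro i s
  simp
  split_ifs <;> simp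

theorem prefixMax_cost (n : ℕ) (P : IntervalPartition) (M : Mem ℝ) :
    (prefixMax n P M).cost ≤ 11 * n + 1 := by
  refine forUp_cost 10 ?_ n _
  intro i s
  simp
  split_ifs <;> simp

theorem prefixMinSum_cost (n : ℕ) (P : IntervalPartition) (A : Mem ℝ) :
    (prefixMinSum n P A).cost ≤ 13 * n + 1 := by
  unfold prefixMinSum
  rw [bind_cost, pure_cost, add_zero]
  refine forUp_cost 12 ?_ n _
  rintro i ⟨cur, best, R⟩
  simp
  split_ifs <;> simp

theorem otherIntervals_cost (ell : ℕ) (V D : Mem ℝ) :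
    (otherIntervals ell V D).cost ≤ 80 * ell + 10 := by
  have h1 := forDown_cost_potential (fun q : MaxQueue => 8 * q.hi) 25
    (body := fun j q => do
      let i ← add j 1
      let v ← read V i
      let d ← read D i
      push v d 0 q) (by
      intro i q
      have := push_cost (V (i + 1)) (D (i + 1)) 0 q
      simp only [bind_cost, bind_val, read_cost, read_val, add_cost, add_val]
      omega) (ell - 1) init
  have h2 := fun s => forDown_cost_potential (fun s : MaxQueue × Mem ℝ => 8 * s.1.hi) 40
    (body := fun j (q, R) => do
      let q ← pop q
      let i ← addMod ell j 2
      let v ← read V i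
      let d ← read D i
      let q ← push v d 0 q
      let g ← getKeyMax q
      let t ← add j 1
      let R ← write R t g
      pure (q, R)) (by
      rintro j ⟨q, R⟩
      have h1 := pop_cost q
      have h2 := pop_hi q
      have h3 := addMod_cost ell j 2
      have := push_cost (V (addMod ell j 2).val) (D (addMod ell j 2).val) 0 (pop q).val
      simp only [bind_cost, bind_val, read_cost, read_val, getKeyMax_cost, write_cost, add_cost,
        pure_cost, pure_val]
      omega) (ell - 1) s
  unfold otherIntervals
  simp only [bind_cost, sub_cost, sub_val, getKeyMax_cost, write_cost,
    pure_cost, ite_cost, le_cost]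
  split_ifs
  · omega
  set q := (forDown (ell - 1) _ init).val
  set qc := (forDown (ell - 1) _ init).cost
  have := h2 (q, (write (zeroMem ℝ) 0 (getKeyMax q).val).val)
  have h0 : (init : MaxQueue).hi = 0 := rfl
  simp only [h0] at h1
  dsimp only at this
  omega

theorem rotatedMaxSum_cost (n : ℕ) (P : IntervalPartition) (A IRCS : Mem ℝ) :
    (rotatedMaxSum n P A IRCS).cost ≤ 13 * n + 1 := by
  unfold rotatedMaxSum
  rw [bind_cost, pure_cost, add_zero]
  refine forDown_cost 12 ?_ n _
  rintro i ⟨cur, best, R⟩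
  simp
  split_ifs <;> simp

theorem rotatedMaxCircSum_cost (n : ℕ) (P : IntervalPartition) (M IOMCS : Mem ℝ) :
    (rotatedMaxCircSum n P M IOMCS).cost ≤ 11 * n + 1 := by
  refine forDown_cost 10 ?_ n _
  intro i s
  simp
  split_ifs <;> simp

theorem prevMaxSums_cost (n : ℕ) (M : Mem ℝ) : (prevMaxSums n M).cost ≤ 6 * n + 1 := by
  refine forUp_cost 5 ?_ n _
  intro i s
  simp

theorem nextMaxSums_cost (n : ℕ) (P : IntervalPartition) (M : Mem ℝ) :
    (nextMaxSums n P M).cost ≤ 13 * n + 1 := by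
  unfold nextMaxSums
  rw [bind_cost, pure_cost, add_zero]
  refine forDown_cost 12 ?_ n _
  rintro i ⟨g, R⟩
  simp
  split_ifs <;> simp

theorem lastPositive_cost (n : ℕ) (P : IntervalPartition) (A : Mem ℝ) :
    (lastPositive n P A).cost ≤ 8 * n + 1 := by
  refine forUp_cost 7 ?_ n _
  intro i s
  simp
  split_ifs <;> simp

theorem peakArrays_cost (n : ℕ) (P : IntervalPartition) (M : Mem ℝ) (IXs : Mem ℕ) :
    (peakArrays n P M IXs).cost ≤ 26 * n + 1 := by
  refine forDown_cost 25 ?_ n _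
  rintro i ⟨X1, X2, B1, B2⟩
  simp
  split_ifs <;> simp

end Preprocessing

open Preprocessing Timed in
theorem preprocess_cost (n : ℕ) (A : Mem ℝ) : (preprocess n A).cost ≤ 1000 * (n + 1) := by
  unfold preprocess
  simp only [bind_cost, pure_cost, ite_cost]
  have h1 := sumAndSigns_cost n A
  have h2 := maxCircSums_cost n A
  by_cases h0 : ((sumAndSigns n A).val.2.1 && (sumAndSigns n A).val.2.2) = true <;> simp only [h0]
  · simp only [if_true]
    generalize (maxCircSums n A).val = MO
    have h3 := findShift_cost n MO.2
    generalize (findShift n MO.2).val = c at *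
    have h4 := shiftArrays_cost n c A MO.1 MO.2
    generalize (shiftArrays n c A MO.1 MO.2).val = S at *
    have h5 := hasNegative_cost n S.2.1
    have h6 := partition_cost n S.2.2
    have h7 := partition_ell_le n S.2.2
    generalize (partition n S.2.2).val = P at *
    have h8 := intervalSums_cost n P S.1
    generalize (intervalSums n P S.1).val = Q at *
    have h9 := intervalMax_cost n P S.2.1
    have h10 := suffixMax_cost n P S.2.1
    have h11 := prefixMax_cost n P S.2.1
    have h12 := prefixMinSum_cost n P S.1
    have h13 := otherIntervals_cost P.ell Q.2 Q.1
    generalize (otherIntervals P.ell Q.2 Q.1).val = IRCS at *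
    generalize (intervalMax n P S.2.1).val = IMCS at *
    have h14 := otherIntervals_cost P.ell IMCS (zeroMem ℝ)
    generalize (otherIntervals P.ell IMCS (zeroMem ℝ)).val = IOMCS at *
    have h15 := prevMaxSums_cost n S.2.1
    have h16 := nextMaxSums_cost n P S.2.1
    have h17 := lastPositive_cost n P S.1
    generalize (lastPositive n P S.1).val = X at *
    have h18 := peakArrays_cost n P S.2.1 X
    have h19 := rotatedMaxSum_cost n P S.1 IRCS
    have h20 := rotatedMaxCircSum_cost n P S.2.1 IOMCS
    generalize (hasNegative n S.2.1).val = b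
    generalize (sumAndSigns n A).cost = c0 at *
    generalize (maxCircSums n A).cost = c1 at *
    generalize (findShift n MO.2).cost = c2 at *
    generalize (shiftArrays n c A MO.1 MO.2).cost = c3 at *
    generalize (hasNegative n S.2.1).cost = c4 at *
    generalize (partition n S.2.2).cost = c5 at *
    generalize (intervalSums n P S.1).cost = c6 at *
    generalize (intervalMax n P S.2.1).cost = c7 at *
    generalize (suffixMax n P S.2.1).cost = c8 at *
    generalize (prefixMax n P S.2.1).cost = c9 at *
    generalize (prefixMinSum n P S.1).cost = c10 at *
    generalize (otherIntervals P.ell Q.2 Q.1).cost = c11 at *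
    generalize (otherIntervals P.ell IMCS (zeroMem ℝ)).cost = c12 at *
    generalize (prevMaxSums n S.2.1).cost = c13 at *
    generalize (nextMaxSums n P S.2.1).cost = c14 at *
    generalize (lastPositive n P S.1).cost = c15 at *
    generalize (peakArrays n P S.2.1 X).cost = c16 at *
    generalize (rotatedMaxSum n P S.1 IRCS).cost = c17 at *
    generalize (rotatedMaxCircSum n P S.2.1 IOMCS).cost = c18 at *
    cases b
    · simp only [Bool.false_eq_true, if_false]
      linarith
    · simp only [if_true]
      linarith
  · simp; omega

namespace Query

open Timed

theorem nonneg_cost (D : AuxData) (b : Bool) (x : ℝ) (p : ℕ) : (nonneg D b x p).cost ≤ 40 := by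
  have := subMod_cost D.n p 1
  unfold nonneg
  simp
  split_ifs <;> simp <;> omega

theorem negType2_cost (D : AuxData) (x : ℝ) (p : ℕ) : (negType2 D x p).cost ≤ 60 := by
  unfold negType2
  simp
  split_ifs <;> simp

theorem negType3_cost (D : AuxData) (x : ℝ) (p : ℕ) : (negType3 D x p).cost ≤ 30 := by
  have := subMod_cost D.part.ell (D.part.idx p) 1
  unfold negType3
  simp
  split_ifs <;> simp <;> omega

end Query

open Timed Query in
theorem query_cost (D : AuxData) (x : ℝ) (p : ℕ) : (query D x p).cost ≤ 80 := by
  unfold query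
  have h1 := fun b p => nonneg_cost D b x p
  have h2 := fun p => negType2_cost D x p
  have h3 := fun p => negType3_cost D x p
  have h4 := fun p => subMod_cost D.n p D.shift
  cases D.kind
  · simp
  all_goals
    simp only [bind_cost, bind_val, tick_cost, ite_cost, ite_val, pure_cost, le_cost, eq_cost,
      pure_val]
    generalize (if (eq p D.n).val = true then 0 else p) = p'
    have := h4 p'
    generalize (subMod D.n p' D.shift).val = p'' at *
    have := h1 true p''
    have := h1 false p''
    have := h2 p''
    have := h3 p''
    split_ifs <;> omega

theorem answerQueries_cost (D : AuxData) (qs : List (ℝ × ℕ)) :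
    (answerQueries D qs).cost ≤ 81 * qs.length + 1 := by
  induction qs with
  | nil => simp [answerQueries]
  | cons q qs ih =>
    have := query_cost D q.1 q.2
    simp [answerQueries]
    omega

/-! ### Correctness of the max-queue -/

namespace MaxQueue

open Timed

/-- The queue `q` holds the elements number `b, …, T - 1`, where element number `s` was inserted
with key `v s` and satellite data `sd s`, and `D s` is the total of the increments up to the `s`-th
insertion, so that its present key is `v s - D (s + 1) + D T`. The number of the element which is
stored in cell `c` of the deque is `t c`. -/
structure Holds (v D : ℕ → ℝ) (sd : ℕ → ℕ) (b T : ℕ) (q : MaxQueue) (t : ℕ → ℕ) : Prop where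
  lo_le : q.lo ≤ q.hi
  data : ∀ c, q.lo ≤ c → c < q.hi → (q.recs c).origValue = v (t c) ∧ (q.recs c).satData = sd (t c)
  step : ∀ c, q.lo ≤ c → c + 1 < q.hi → t c < t (c + 1) ∧
    (q.recs (c + 1)).diff = D (t (c + 1) + 1) - D (t c + 1) ∧
    (q.recs (c + 1)).implicitNexts + t c + 1 = t (c + 1) ∧
    v (t (c + 1)) - D (t (c + 1) + 1) ≤ v (t c) - D (t c + 1) ∧
    ∀ s, t c < s → s < t (c + 1) → v s - D (s + 1) < v (t (c + 1)) - D (t (c + 1) + 1)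
  oldest : q.lo < q.hi → (q.recs q.lo).implicitNexts + b = t q.lo ∧
    q.maxKey = v (t q.lo) - D (t q.lo + 1) + D T ∧
    ∀ s, b ≤ s → s < t q.lo → v s - D (s + 1) < v (t q.lo) - D (t q.lo + 1)
  newest : q.lo < q.hi → t (q.hi - 1) + 1 = T
  empty : q.lo = q.hi → b = T

variable {v D : ℕ → ℝ} {sd : ℕ → ℕ} {b T : ℕ} {q : MaxQueue} {t : ℕ → ℕ}

theorem holds_init : Holds v D sd 0 0 init t := by
  constructor <;> simp [init]

/-- The peeked element is the leftmost one of greatest key. -/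
theorem Holds.peek (h : Holds v D sd b T q t) (hT : b < T) :
    ∃ s, b ≤ s ∧ s < T ∧ q.maxKey = v s - D (s + 1) + D T ∧ (q.recs q.lo).satData = sd s ∧
      (∀ r, b ≤ r → r < T → v r - D (r + 1) ≤ v s - D (s + 1)) ∧
      ∀ r, b ≤ r → r < s → v r - D (r + 1) < v s - D (s + 1) := by
  have hne : q.lo < q.hi := by
    rcases h.lo_le.lt_or_eq with h' | h'
    · exact h'
    · have := h.empty h'
      omega
  obtain ⟨o1, o2, o3⟩ := h.oldest hne
  have key : ∀ j, q.lo + j < q.hi →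
      t q.lo ≤ t (q.lo + j) ∧
      v (t (q.lo + j)) - D (t (q.lo + j) + 1) ≤ v (t q.lo) - D (t q.lo + 1) ∧
      ∀ r, b ≤ r → r ≤ t (q.lo + j) → v r - D (r + 1) ≤ v (t q.lo) - D (t q.lo + 1) := by
    intro j
    induction j with
    | zero =>
      intro _
      refine ⟨le_rfl, le_rfl, fun r hr hr' => ?_⟩
      rcases hr'.lt_or_eq with h' | h'
      · exact (o3 r hr h').le
      · rw [h']; rfl
    | succ j ih =>
      intro hj
      obtain ⟨i1, i2, i3⟩ := ih (by omega)
      obtain ⟨s1, -, -, s4, s5⟩ := h.step (q.lo + j) (by omega) (by omega)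
      rw [← add_assoc]
      refine ⟨by omega, by linarith, fun r hr hr' => ?_⟩
      rcases le_or_gt r (t (q.lo + j)) with h1 | h1
      · exact i3 r hr h1
      · rcases hr'.lt_or_eq with h2 | h2
        · linarith [s5 r h1 h2]
        · rw [h2]; linarith
  have hn := h.newest hne
  obtain ⟨k1, k2, k3⟩ := key (q.hi - 1 - q.lo) (by omega)
  rw [show q.lo + (q.hi - 1 - q.lo) = q.hi - 1 by omega] at k1 k3
  exact ⟨t q.lo, by omega, by omega, o2, (h.data _ le_rfl hne).2, fun r hr hr' =>
    k3 r hr (by omega), o3⟩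

theorem Holds.pop (h : Holds v D sd b T q t) (hT : b < T) :
    Holds v D sd (b + 1) T (pop q).val t := by
  have hne : q.lo < q.hi := by
    rcases h.lo_le.lt_or_eq with h' | h'
    · exact h'
    · have := h.empty h'
      omega
  obtain ⟨o1, o2, o3⟩ := h.oldest hne
  have hd := (h.data _ le_rfl hne).1
  unfold MaxQueue.pop
  simp only [bind_val, read_val, lt_val, decide_eq_true_eq, ite_val, write_val, sub_val, add_val,
    pure_val]
  split_ifs with h1 h2
  · constructor
    · exact h.lo_le
    · intro c hc hc'
      have := h.data c hc hc'
      dsimp only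
      rcases eq_or_ne c q.lo with rfl | hcc
      · simpa using this
      · simpa [hcc] using this
    · intro c hc hc'
      have := h.step c hc hc'
      dsimp only at hc ⊢
      rw [Function.update_of_ne (by omega)]
      exact this
    · intro _
      simp only [Function.update_self]
      exact ⟨by omega, o2, fun s hs => o3 s (by omega)⟩
    · exact h.newest
    · intro h'
      simp only at h'
      omega
  · obtain ⟨s1, s2, s3, s4, s5⟩ := h.step q.lo le_rfl h2
    have hd' := (h.data (q.lo + 1) (by omega) h2).1
    constructor
    · exact h2.le
    · intro c hc hc'
      simp only at hc hc'
      exact h.data c (by omega) hc'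
    · intro c hc hc'
      simp only at hc hc'
      exact h.step c (by omega) hc'
    · intro _
      dsimp only
      refine ⟨by omega, ?_, fun s hs hs' => s5 s (by omega) hs'⟩
      rw [hd', s2, o2, hd]
      ring
    · intro _
      exact h.newest hne
    · intro h'
      simp only at h'
      omega
  · have := h.newest hne
    have e : q.hi - 1 = q.lo := by omega
    rw [e] at this
    constructor
    · simp only; omega
    · intro c hc hc'
      simp only at hc hc'
      omega
    · intro c hc hc'
      simp only at hc hc'
      omega
    · intro h'
      simp only at h'
      omega
    · intro h'
      simp only at h'
      omega
    · intro h'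
      omega

/-- The state of the insertion of element number `T` into the queue after the removal of the records
in the cells from `hi` on. -/
structure Pushing (v D : ℕ → ℝ) (b T : ℕ) (q : MaxQueue) (t : ℕ → ℕ) (s : ℕ × ℝ × ℕ) : Prop where
  lo_le : q.lo ≤ s.1
  le_hi : s.1 ≤ q.hi
  nonempty : q.lo < s.1 → s.2.1 = D (T + 1) - D (t (s.1 - 1) + 1) ∧ s.2.2 + t (s.1 - 1) + 1 = T ∧
    ∀ r, t (s.1 - 1) < r → r < T → v r - D (r + 1) < v T - D (T + 1)
  empty : s.1 = q.lo → s.2.2 + b = T ∧ ∀ r, b ≤ r → r < T → v r - D (r + 1) < v T - D (T + 1)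

theorem Holds.pushLoop (h : Holds v D sd b T q t) (hi : ℕ) (accD : ℝ) (impl : ℕ)
    (hp : Pushing v D b T q t (hi, accD, impl)) :
    Pushing v D b T q t (pushLoop q.recs q.lo (v T) hi accD impl).val ∧
    (q.lo < (MaxQueue.pushLoop q.recs q.lo (v T) hi accD impl).val.1 →
      v T - D (T + 1) ≤
        v (t ((MaxQueue.pushLoop q.recs q.lo (v T) hi accD impl).val.1 - 1)) -
        D (t ((MaxQueue.pushLoop q.recs q.lo (v T) hi accD impl).val.1 - 1) + 1)) := by
  induction hi generalizing accD impl with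
  | zero =>
    have := hp.lo_le
    have e : (MaxQueue.pushLoop q.recs q.lo (v T) 0 accD impl).val = (0, accD, impl) := rfl
    rw [e]
    refine ⟨hp, fun h' => ?_⟩
    simp at h'
  | succ hi ih =>
    have hlo := hp.lo_le
    have hhi := hp.le_hi
    simp only at hlo hhi
    have e : (MaxQueue.pushLoop q.recs q.lo (v T) (hi + 1) accD impl).val =
        if hi + 1 ≤ q.lo then (hi + 1, accD, impl) else
        if v T ≤ (q.recs hi).origValue + accD then (hi + 1, accD, impl) else
        (MaxQueue.pushLoop q.recs q.lo (v T) hi (accD + (q.recs hi).diff)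
          (impl + (1 + (q.recs hi).implicitNexts))).val := by
      simp [MaxQueue.pushLoop]
    rw [e]
    split_ifs with h1 h2
    · refine ⟨hp, fun h' => ?_⟩
      simp only at h'
      omega
    · refine ⟨hp, fun h' => ?_⟩
      obtain ⟨n1, n2, n3⟩ := hp.nonempty h'
      have hd := (h.data hi (by omega) (by omega)).1
      simp only [Nat.add_sub_cancel] at n1 ⊢
      rw [hd, n1] at h2
      linarith
    · have hlt : q.lo < hi + 1 := by omega
      obtain ⟨n1, n2, n3⟩ := hp.nonempty hlt
      have hd := (h.data hi (by omega) (by omega)).1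
      simp only [Nat.add_sub_cancel] at n1 n2 n3
      rw [hd, n1] at h2
      apply ih
      constructor
      · simp only; omega
      · simp only; omega
      · intro h'
        simp only at h'
        obtain ⟨s1, s2, s3, s4, s5⟩ := h.step (hi - 1) (by omega) (by omega)
        rw [Nat.sub_add_cancel (by omega)] at s1 s2 s3 s4 s5
        dsimp only
        refine ⟨?_, by omega, fun r hr hr' => ?_⟩
        · rw [n1, s2]
          ring
        · rcases lt_trichotomy r (t hi) with h3 | h3 | h3
          · linarith [s5 r hr h3]
          · rw [h3]; linarith
          · exact n3 r h3 hr'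
      · intro h'
        simp only at h'
        obtain ⟨o1, o2, o3⟩ := h.oldest (by omega)
        rw [← h'] at o1 o3
        refine ⟨by dsimp only; omega, fun r hr hr' => ?_⟩
        rcases lt_trichotomy r (t hi) with h3 | h3 | h3
        · linarith [o3 r hr h3]
        · rw [h3]; linarith
        · exact n3 r h3 hr'

theorem Holds.push (h : Holds v D sd b T q t) :
    ∃ t', Holds v D sd b (T + 1) (push (v T) (D (T + 1) - D T) (sd T) q).val t' := by
  have hp : Pushing v D b T q t (q.hi, D (T + 1) - D T, 0) := by
    constructor
    · exact h.lo_le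
    · exact le_rfl
    · intro h'
      have := h.newest h'
      dsimp only
      refine ⟨by rw [this], by omega, fun r hr hr' => by omega⟩
    · intro h'
      have := h.empty h'.symm
      refine ⟨by simpa using this, fun r hr hr' => by omega⟩
  obtain ⟨hs, hle⟩ := h.pushLoop _ _ _ hp
  unfold MaxQueue.push
  simp only [bind_val]
  generalize (MaxQueue.pushLoop q.recs q.lo (v T) q.hi (D (T + 1) - D T) 0).val = s at hs hle
  obtain ⟨hi, accD, impl⟩ := s
  have h1 := hs.lo_le
  have h2 := hs.le_hi
  have h3 := hs.nonempty
  have h4 := hs.empty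
  simp only [le_val, decide_eq_true_eq, ite_val, pure_val, add_val, write_val]
    at h1 h2 h3 h4 hle ⊢
  refine ⟨Function.update t hi T, ?_⟩
  constructor
  · dsimp only; omega
  · intro c hc hc'
    dsimp only at hc hc' ⊢
    rcases eq_or_ne c hi with rfl | hcc
    · simp
    · simpa [hcc] using h.data c hc (by omega)
  · intro c hc hc'
    dsimp only at hc hc' ⊢
    rw [Function.update_of_ne (show c ≠ hi by omega)]
    rcases eq_or_ne (c + 1) hi with hcc | hcc
    · obtain ⟨n1, n2, n3⟩ := h3 (by omega)
      rw [← hcc] at n1 n2 n3 hle ⊢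
      simp only [Nat.add_sub_cancel] at n1 n2 n3 hle
      simp only [Function.update_self]
      exact ⟨by omega, n1, n2, hle (by omega), n3⟩
    · rw [Function.update_of_ne hcc, Function.update_of_ne hcc]
      exact h.step c hc (by omega)
  · intro _
    dsimp only
    rcases eq_or_ne q.lo hi with hcc | hcc
    · rw [← hcc]
      obtain ⟨n1, n2⟩ := h4 hcc.symm
      simp only [Function.update_self, le_refl, if_true]
      exact ⟨n1, by ring, n2⟩
    · rw [Function.update_of_ne hcc, Function.update_of_ne hcc, if_neg (by omega)]
      obtain ⟨o1, o2, o3⟩ := h.oldest (by omega)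
      refine ⟨o1, ?_, o3⟩
      rw [o2]
      ring
  · intro _
    simp
  · intro h'
    simp only at h'
    omega

end MaxQueue

/-! ### Periodic prefix sums and greatest values over ranges -/

/-- The sum of the first `t` terms of the `n`-periodic extension of `A 0, …, A (n - 1)`. A circular
subsequence of `A` that begins at `i` and has length `m` has sum
`periodicSum n A (i + m) - periodicSum n A i`. -/
noncomputable def periodicSum (n : ℕ) (A : Mem ℝ) (t : ℕ) : ℝ := ∑ s ∈ Finset.range t, A (s % n)

section

variable (n : ℕ) (A : Mem ℝ)

@[simp] theorem periodicSum_zero : periodicSum n A 0 = 0 := by simp [periodicSum]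

theorem periodicSum_succ (t : ℕ) : periodicSum n A (t + 1) = periodicSum n A t + A (t % n) := by
  simp [periodicSum, Finset.sum_range_succ]

theorem periodicSum_add_period (t : ℕ) :
    periodicSum n A (t + n) = periodicSum n A t + periodicSum n A n := by
  induction t with
  | zero => simp
  | succ t ih =>
    rw [show t + 1 + n = (t + n) + 1 by ring, periodicSum_succ, periodicSum_succ, ih,
      Nat.add_mod_right]
    ring

theorem periodicSum_add_mul_period (t k : ℕ) :
    periodicSum n A (t + n * k) = periodicSum n A t + k * periodicSum n A n := by
  induction k with
  | zero => simp
  | succ k ih =>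
    rw [show t + n * (k + 1) = (t + n * k) + n by ring, periodicSum_add_period, ih]
    push_cast
    ring

theorem periodicSum_sub_period {t u : ℕ} (k : ℕ) :
    periodicSum n A (t + n * k) - periodicSum n A (u + n * k) =
      periodicSum n A t - periodicSum n A u := by
  rw [periodicSum_add_mul_period, periodicSum_add_mul_period]
  ring

end

/-- `m` is the greatest value of `f` on `[a, b)`. -/
def GreatestOver (f : ℕ → ℝ) (a b : ℕ) (m : ℝ) : Prop :=
  (∃ i, a ≤ i ∧ i < b ∧ f i = m) ∧ ∀ i, a ≤ i → i < b → f i ≤ m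

namespace GreatestOver

variable {f g : ℕ → ℝ} {a b c : ℕ} {m m' : ℝ}

theorem singleton (f : ℕ → ℝ) (a : ℕ) : GreatestOver f a (a + 1) (f a) :=
  ⟨⟨a, le_rfl, by omega, rfl⟩, fun i h h' => by rw [show i = a by omega]⟩

theorem union (h : GreatestOver f a b m) (h' : GreatestOver f b c m') :
    GreatestOver f a c (max m m') := by
  obtain ⟨⟨i, hi1, hi2, hi3⟩, h2⟩ := h
  obtain ⟨⟨j, hj1, hj2, hj3⟩, h3⟩ := h'
  refine ⟨?_, fun s hs hs' => ?_⟩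
  · rcases le_total m m' with h | h
    · exact ⟨j, by omega, hj2, by rw [max_eq_right h, hj3]⟩
    · exact ⟨i, hi1, by omega, by rw [max_eq_left h, hi3]⟩
  · rcases lt_or_ge s b with h | h
    · exact (h2 s hs h).trans (le_max_left _ _)
    · exact (h3 s h hs').trans (le_max_right _ _)

theorem congr (h : GreatestOver f a b m) (hfg : ∀ i, a ≤ i → i < b → f i = g i) :
    GreatestOver g a b m := by
  obtain ⟨⟨i, hi1, hi2, hi3⟩, h2⟩ := h
  exact ⟨⟨i, hi1, hi2, by rw [← hfg i hi1 hi2, hi3]⟩, fun s hs hs' => by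
    rw [← hfg s hs hs']; exact h2 s hs hs'⟩

theorem shift (k : ℕ) (h : GreatestOver f a b m) (hfg : ∀ i, f i = g (i + k)) :
    GreatestOver g (a + k) (b + k) m := by
  obtain ⟨⟨i, hi1, hi2, hi3⟩, h2⟩ := h
  refine ⟨⟨i + k, by omega, by omega, by rw [← hfg, hi3]⟩, fun s hs hs' => ?_⟩
  have := h2 (s - k) (by omega) (by omega)
  rwa [hfg, Nat.sub_add_cancel (by omega)] at this

theorem add_const (h : GreatestOver f a b m) (r : ℝ) :
    GreatestOver (fun i => f i + r) a b (m + r) := by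
  obtain ⟨⟨i, hi1, hi2, hi3⟩, h2⟩ := h
  exact ⟨⟨i, hi1, hi2, by simp [hi3]⟩, fun s hs hs' => by simpa using h2 s hs hs'⟩

/-- The greatest value on a concatenation of ranges is the greatest of those on the ranges. -/
theorem concat {F : ℕ → ℕ} {v : ℕ → ℝ} (hF : Monotone F)
    (h : ∀ i, a ≤ i → i < b → GreatestOver f (F i) (F (i + 1)) (v i))
    (hm : GreatestOver v a b m) : GreatestOver f (F a) (F b) m := by
  obtain ⟨⟨i, hi1, hi2, rfl⟩, h2⟩ := hm
  obtain ⟨⟨j, hj1, hj2, hj3⟩, -⟩ := h i hi1 hi2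
  refine ⟨⟨j, (hF hi1).trans hj1, hj2.trans_le (hF hi2), hj3⟩, fun s hs hs' => ?_⟩
  have : ∃ k, a ≤ k ∧ k < b ∧ F k ≤ s ∧ s < F (k + 1) := by
    clear h h2 hi2
    induction b with
    | zero =>
      have := hF (Nat.zero_le a)
      omega
    | succ b ih =>
      rcases lt_or_ge s (F b) with h | h
      · obtain ⟨k, h1, h2, h3⟩ := ih h
        exact ⟨k, h1, by omega, h3⟩
      · refine ⟨b, ?_, by omega, h, hs'⟩
        by_contra hab
        have := hF (show b + 1 ≤ a by omega)
        omega
  obtain ⟨k, k1, k2, k3, k4⟩ := this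
  exact ((h k k1 k2).2 s k3 k4).trans (h2 k k1 k2)

end GreatestOver

/-! ### Maximal circular sums at the elements, and the circular shift -/

/-- `M` and `O` are the arrays `MCS` and `OMCS` of `A`: a subsequence of greatest sum among the
circular subsequences which end at `i`, shifted by one period, begins at the leftmost position `f`
in `[i + 1, i + n]` with the least prefix sum. -/
def IsMaxCircSums (n : ℕ) (A M : Mem ℝ) (O : Mem ℕ) : Prop :=
  ∀ i, ∃ f, i + 1 ≤ f ∧ f ≤ i + n ∧
    (∀ u, i + 1 ≤ u → u ≤ i + n → periodicSum n A f ≤ periodicSum n A u) ∧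
    (∀ u, i + 1 ≤ u → u < f → periodicSum n A f < periodicSum n A u) ∧
    M (i % n) = periodicSum n A (i + n + 1) - periodicSum n A f ∧ O (i % n) = f % n

theorem isMaxCircSums_of_lt {n : ℕ} (hn : 0 < n) {A M : Mem ℝ} {O : Mem ℕ}
    (h : ∀ i < n, ∃ f, i + 1 ≤ f ∧ f ≤ i + n ∧
      (∀ u, i + 1 ≤ u → u ≤ i + n → periodicSum n A f ≤ periodicSum n A u) ∧
      (∀ u, i + 1 ≤ u → u < f → periodicSum n A f < periodicSum n A u) ∧
      M i = periodicSum n A (i + n + 1) - periodicSum n A f ∧ O i = f % n) :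
    IsMaxCircSums n A M O := by
  intro i
  obtain ⟨f, h1, h2, h3, h4, h5, h6⟩ := h (i % n) (Nat.mod_lt i hn)
  have hi := Nat.mod_add_div i n
  set k := i / n
  have hu : ∀ u, i + 1 ≤ u → ∃ u', u = u' + n * k ∧ i % n + 1 ≤ u' := fun u hu =>
    ⟨u - n * k, by omega, by omega⟩
  refine ⟨f + n * k, by omega, by omega, ?_, ?_, ?_, ?_⟩
  · intro u hu1 hu2
    obtain ⟨u, rfl, hu3⟩ := hu u hu1
    have := h3 u hu3 (by omega)
    rw [periodicSum_add_mul_period, periodicSum_add_mul_period]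
    linarith
  · intro u hu1 hu2
    obtain ⟨u, rfl, hu3⟩ := hu u hu1
    have := h4 u hu3 (by omega)
    rw [periodicSum_add_mul_period, periodicSum_add_mul_period]
    linarith
  · rw [h5, show i + n + 1 = (i % n + n + 1) + n * k by omega, periodicSum_sub_period]
  · rw [h6, Nat.add_mul_mod_self_left]

namespace Preprocessing

open Timed MaxQueue

theorem sumAndSigns_val (n : ℕ) (A : Mem ℝ) :
    (sumAndSigns n A).val.1 = ∑ i ∈ Finset.range n, A i ∧
    ((sumAndSigns n A).val.2.1 = true ↔ ∃ i < n, 0 < A i) ∧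
    ((sumAndSigns n A).val.2.2 = true ↔ ∃ i < n, A i < 0) := by
  refine forUp_induct (fun m (r : ℝ × Bool × Bool) => r.1 = ∑ i ∈ Finset.range m, A i ∧
    (r.2.1 = true ↔ ∃ i < m, 0 < A i) ∧ (r.2.2 = true ↔ ∃ i < m, A i < 0)) n (by simp) ?_
  rintro m - ⟨s, pos, neg⟩ ⟨h1, h2, h3⟩
  simp only at h1 h2 h3
  simp only [bind_val, read_val, add_val, lt_val, decide_eq_true_eq, ite_val, pure_val]
  split_ifs with h4 h5
  · refine ⟨by rw [Finset.sum_range_succ, h1], by simpa using ⟨m, by omega, h4⟩, ?_⟩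
    rw [h3]
    refine ⟨fun ⟨i, hi, h⟩ => ⟨i, by omega, h⟩, fun ⟨i, hi, h⟩ => ⟨i, ?_, h⟩⟩
    rcases (Nat.lt_succ_iff.1 hi).lt_or_eq with h' | rfl
    · exact h'
    · linarith
  · refine ⟨by rw [Finset.sum_range_succ, h1], ?_, by simpa using ⟨m, by omega, h5⟩⟩
    rw [h2]
    refine ⟨fun ⟨i, hi, h⟩ => ⟨i, by omega, h⟩, fun ⟨i, hi, h⟩ => ⟨i, ?_, h⟩⟩
    rcases (Nat.lt_succ_iff.1 hi).lt_or_eq with h' | rfl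
    · exact h'
    · linarith
  · refine ⟨by rw [Finset.sum_range_succ, h1], ?_, ?_⟩
    · rw [h2]
      refine ⟨fun ⟨i, hi, h⟩ => ⟨i, by omega, h⟩, fun ⟨i, hi, h⟩ => ⟨i, ?_, h⟩⟩
      rcases (Nat.lt_succ_iff.1 hi).lt_or_eq with h' | rfl
      · exact h'
      · linarith
    · rw [h3]
      refine ⟨fun ⟨i, hi, h⟩ => ⟨i, by omega, h⟩, fun ⟨i, hi, h⟩ => ⟨i, ?_, h⟩⟩
      rcases (Nat.lt_succ_iff.1 hi).lt_or_eq with h' | rfl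
      · exact h'
      · linarith

/-- The leftmost greatest key of the queue determines the maximal circular sum at an element, as the
key of element number `s` is the difference of the prefix sums at `T` and at `s`. -/
theorem peek_maxCircSum {n : ℕ} {A : Mem ℝ} {T i : ℕ} {q : MaxQueue} {t : ℕ → ℕ} (hn : 0 < n)
    (h : Holds (fun s => A (s % n)) (periodicSum n A) (fun s => s % n) i T q t) (hT : T = i + n) :
    ∃ f, i ≤ f ∧ f < i + n ∧
      (∀ u, i ≤ u → u < i + n → periodicSum n A f ≤ periodicSum n A u) ∧
      (∀ u, i ≤ u → u < f → periodicSum n A f < periodicSum n A u) ∧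
      q.maxKey = periodicSum n A (i + n) - periodicSum n A f ∧
      (q.recs q.lo).satData = f % n := by
  subst hT
  obtain ⟨f, h1, h2, h3, h4, h5, h6⟩ := h.peek (by omega)
  simp only [periodicSum_succ] at h3 h5 h6
  refine ⟨f, h1, h2, fun u hu hu' => ?_, fun u hu hu' => ?_, ?_, h4⟩
  · linarith [h5 u hu hu']
  · linarith [h6 u hu hu']
  · linarith

theorem maxCircSums_val {n : ℕ} (hn : 0 < n) (A : Mem ℝ) :
    IsMaxCircSums n A (maxCircSums n A).val.1 (maxCircSums n A).val.2 := by
  have hpush : ∀ {b T : ℕ} {q : MaxQueue} {t : ℕ → ℕ} (i : ℕ), T % n = i →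
      Holds (fun s => A (s % n)) (periodicSum n A) (fun s => s % n) b T q t →
      ∃ t', Holds (fun s => A (s % n)) (periodicSum n A) (fun s => s % n) b (T + 1)
        (push (A i) (A i) i q).val t' := by
    rintro b T q t i rfl h
    have := h.push
    rwa [periodicSum_succ, add_sub_cancel_left] at this
  have h1 : ∃ t, Holds (fun s => A (s % n)) (periodicSum n A) (fun s => s % n) 0 n
      (forUp n (fun i q => do
        let a ← read A i
        push a a i q) init).val t := by
    refine forUp_induct (fun i q => ∃ t,
      Holds (fun s => A (s % n)) (periodicSum n A) (fun s => s % n) 0 i q t) n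
      ⟨fun _ => 0, holds_init⟩ ?_
    rintro i hi q ⟨t, h⟩
    exact hpush i (Nat.mod_eq_of_lt hi) h
  apply isMaxCircSums_of_lt hn
  unfold maxCircSums
  simp only [bind_val, sub_val, getKeyMax_val, write_val, getSatDataMax_val, pure_val]
  set q := (forUp n _ init).val
  obtain ⟨t, h1⟩ := h1
  have h2 := forUp_induct (s := (q, Function.update (zeroMem ℝ) (n - 1) q.maxKey,
      Function.update (zeroMem ℕ) (n - 1) (q.recs q.lo).satData))
    (body := fun i (q, M, O) => do
      let q ← pop q
      let a ← read A i
      let q ← push a a i q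
      let v ← getKeyMax q
      let M ← write M i v
      let o ← getSatDataMax q
      let O ← write O i o
      pure (q, M, O))
    (fun m (s : MaxQueue × Mem ℝ × Mem ℕ) =>
      (∃ t, Holds (fun s => A (s % n)) (periodicSum n A) (fun s => s % n) m (m + n) s.1 t) ∧
      ∀ i, (i < m ∨ i = n - 1) → ∃ f, i + 1 ≤ f ∧ f ≤ i + n ∧
        (∀ u, i + 1 ≤ u → u ≤ i + n → periodicSum n A f ≤ periodicSum n A u) ∧
        (∀ u, i + 1 ≤ u → u < f → periodicSum n A f < periodicSum n A u) ∧
        s.2.1 i = periodicSum n A (i + n + 1) - periodicSum n A f ∧ s.2.2 i = f % n)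
    (n - 1) ?_ ?_
  · intro i hi
    exact h2.2 i (by omega)
  · refine ⟨⟨t, by simpa using h1⟩, ?_⟩
    intro i hi
    obtain rfl : i = n - 1 := by omega
    obtain ⟨f, g1, g2, g3, g4, g5, g6⟩ := peek_maxCircSum hn h1 (by simp)
    have hu : ∀ u, n - 1 + 1 ≤ u → ∃ u', u = u' + n := fun u hu => ⟨u - n, by omega⟩
    refine ⟨f + n, by omega, by omega, ?_, ?_, ?_, ?_⟩
    · intro u hu1 hu2
      obtain ⟨u, rfl⟩ := hu u hu1
      have := g3 u (by omega) (by omega)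
      rw [periodicSum_add_period, periodicSum_add_period]
      linarith
    · intro u hu1 hu2
      obtain ⟨u, rfl⟩ := hu u hu1
      have := g4 u (by omega) (by omega)
      rw [periodicSum_add_period, periodicSum_add_period]
      linarith
    · rw [show n - 1 + n + 1 = n + n by omega]
      simp only [Function.update_self]
      rw [g5, periodicSum_add_period n A n, periodicSum_add_period n A f]
      simp
    · simp only [Function.update_self]
      rw [g6, Nat.add_mod_right]
  · rintro i hi ⟨q, M, O⟩ ⟨⟨t, h⟩, hM⟩
    obtain ⟨t', h'⟩ := hpush i (by rw [Nat.add_mod_right, Nat.mod_eq_of_lt (by omega)])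
      (h.pop (by omega))
    simp only [bind_val, read_val, getKeyMax_val, write_val, getSatDataMax_val, pure_val]
    refine ⟨⟨t', by rwa [show i + 1 + n = i + n + 1 by ring]⟩, fun j hj => ?_⟩
    rcases eq_or_ne j i with rfl | hji
    · obtain ⟨f, g1, g2, g3, g4, g5, g6⟩ := peek_maxCircSum hn h' (by ring)
      refine ⟨f, g1, by omega, fun u hu hu' => g3 u hu (by omega), g4, ?_, ?_⟩
      · rw [Function.update_self, g5, show j + 1 + n = j + n + 1 by ring]
      · rw [Function.update_self, g6]
    · obtain ⟨f, g⟩ := hM j (by omega)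
      refine ⟨f, ?_⟩
      rwa [Function.update_of_ne hji, Function.update_of_ne hji]

theorem findShift_val {n : ℕ} (O : Mem ℕ) :
    ((findShift n O).val < n ∧
      O (((findShift n O).val + n - 1) % n) ≠ O (findShift n O).val) ∨
    ((findShift n O).val = O 0 ∧ ∀ i < n, O ((i + n - 1) % n) = O i) := by
  unfold findShift
  simp only [bind_val, read_val]
  have := forDown_induct (body := fun i s => do
      let j ← subMod n i 1
      let a ← read O j
      let b ← read O i
      if ← eq a b then pure s else pure i) (s := O 0)
    (fun m s => (s < n ∧ O ((s + n - 1) % n) ≠ O s) ∨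
      (s = O 0 ∧ ∀ i, m ≤ i → i < n → O ((i + n - 1) % n) = O i)) n
    (Or.inr ⟨rfl, fun i h h' => by omega⟩) (by
      intro i hi s h
      simp only [bind_val, read_val, eq_val, ite_val, pure_val, decide_eq_true_eq]
      rw [subMod_val hi (by omega)]
      split_ifs with h1
      · rcases h with h | ⟨h2, h3⟩
        · exact Or.inl h
        · refine Or.inr ⟨h2, fun j hj hj' => ?_⟩
          rcases eq_or_ne j i with rfl | hji
          · exact h1
          · exact h3 j (by omega) hj'
      · exact Or.inl ⟨hi, h1⟩)
  simpa using this

theorem shiftArrays_val {n c : ℕ} (hc : c < n) (A M : Mem ℝ) {O : Mem ℕ} (hO : ∀ i < n, O i < n)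
    {i : ℕ} (hi : i < n) :
    (shiftArrays n c A M O).val.1 i = A ((i + c) % n) ∧
    (shiftArrays n c A M O).val.2.1 i = M ((i + c) % n) ∧
    (shiftArrays n c A M O).val.2.2 i = (O ((i + c) % n) + n - c) % n := by
  unfold shiftArrays
  refine forUp_induct (fun m (s : Mem ℝ × Mem ℝ × Mem ℕ) => ∀ i < m, s.1 i = A ((i + c) % n) ∧
    s.2.1 i = M ((i + c) % n) ∧ s.2.2 i = (O ((i + c) % n) + n - c) % n) n (by simp) ?_ i hi
  rintro m hm ⟨A', M', O'⟩ h i hi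
  have hlt := hO ((m + c) % n) (Nat.mod_lt _ (by omega))
  simp only [bind_val, read_val, write_val, pure_val]
  rw [addMod_val hm hc.le, subMod_val hlt hc.le]
  rcases eq_or_ne i m with rfl | him
  · simp
  · simpa [him] using h i (by omega)

theorem hasNegative_val (n : ℕ) (M : Mem ℝ) :
    (hasNegative n M).val = true ↔ ∃ i < n, M i < 0 := by
  unfold hasNegative
  refine forUp_induct (fun m (b : Bool) => b = true ↔ ∃ i < m, M i < 0) n (by simp) ?_
  intro m hm b h
  simp only [bind_val, read_val, lt_val, decide_eq_true_eq, ite_val, pure_val]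
  split_ifs with h1
  · simpa using ⟨m, by omega, h1⟩
  · rw [h]
    refine ⟨fun ⟨i, hi, h⟩ => ⟨i, by omega, h⟩, fun ⟨i, hi, h⟩ => ⟨i, ?_, h⟩⟩
    rcases (Nat.lt_succ_iff.1 hi).lt_or_eq with h' | h'
    · exact h'
    · exact absurd (h' ▸ h) h1

end Preprocessing

/-! ### The interval partition and the arrays of the preprocessing -/

/-- `P` is the division of the indices below `n` into the maximal intervals on which `O` is
constant. -/
structure IsPartition (n : ℕ) (O : Mem ℕ) (P : IntervalPartition) : Prop where
  idx_lt : ∀ i < n, P.idx i < P.ell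
  first_le : ∀ i < n, P.first (P.idx i) ≤ i
  le_last : ∀ i < n, i ≤ P.last (P.idx i)
  first_le_last : ∀ k < P.ell, P.first k ≤ P.last k
  last_lt : ∀ k < P.ell, P.last k < n
  idx_eq : ∀ k < P.ell, ∀ i, P.first k ≤ i → i ≤ P.last k → P.idx i = k
  first_zero : 0 < n → P.first 0 = 0
  ell_pos : 0 < n → 0 < P.ell
  last_ell : ∀ k, k + 1 = P.ell → P.last k + 1 = n
  first_succ : ∀ k, k + 1 < P.ell → P.first (k + 1) = P.last k + 1
  ne : ∀ k, k + 1 < P.ell → O (P.last k) ≠ O (P.last k + 1)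
  eq : ∀ k < P.ell, ∀ i, P.first k ≤ i → i < P.last k → O i = O (i + 1)

namespace IsPartition

variable {n : ℕ} {O : Mem ℕ} {P : IntervalPartition}

theorem snoc_new (h : IsPartition n O P) (hO : n = 0 ∨ O (n - 1) ≠ O n) :
    IsPartition (n + 1) O ⟨P.ell + 1, Function.update P.idx n P.ell,
      Function.update P.first P.ell n, Function.update P.last P.ell n⟩ := by
  have hell : ∀ k < P.ell, k ≠ P.ell := fun k hk => hk.ne
  constructor <;> dsimp only
  · intro i hi
    rcases eq_or_ne i n with rfl | hin
    · simp
    · rw [Function.update_of_ne hin]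
      have := h.idx_lt i (by omega)
      omega
  · intro i hi
    rcases eq_or_ne i n with rfl | hin
    · simp
    · have := h.idx_lt i (by omega)
      rw [Function.update_of_ne hin, Function.update_of_ne this.ne]
      exact h.first_le i (by omega)
  · intro i hi
    rcases eq_or_ne i n with rfl | hin
    · simp
    · have := h.idx_lt i (by omega)
      rw [Function.update_of_ne hin, Function.update_of_ne this.ne]
      exact h.le_last i (by omega)
  · intro k hk
    rcases eq_or_ne k P.ell with rfl | hkl
    · simp
    · rw [Function.update_of_ne hkl, Function.update_of_ne hkl]
      exact h.first_le_last k (by omega)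
  · intro k hk
    rcases eq_or_ne k P.ell with rfl | hkl
    · simp
    · rw [Function.update_of_ne hkl]
      have := h.last_lt k (by omega)
      omega
  · intro k hk i h1 h2
    rcases eq_or_ne k P.ell with rfl | hkl
    · simp only [Function.update_self] at h1 h2
      obtain rfl : i = n := by omega
      simp
    · rw [Function.update_of_ne hkl] at h1 h2
      have := h.last_lt k (by omega)
      rw [Function.update_of_ne (by omega)]
      exact h.idx_eq k (by omega) i h1 h2
  · intro _
    rcases Nat.eq_zero_or_pos n with rfl | hn
    · rcases Nat.eq_zero_or_pos P.ell with h0 | h0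
      · simp [h0]
      · have := h.last_lt 0 h0
        omega
    · have := h.ell_pos hn
      rw [Function.update_of_ne (by omega)]
      exact h.first_zero hn
  · omega
  · intro k hk
    obtain rfl : k = P.ell := by omega
    simp
  · intro k hk
    rw [Function.update_of_ne (show k ≠ P.ell by omega)]
    rcases eq_or_ne (k + 1) P.ell with hkl | hkl
    · rw [hkl, Function.update_self, h.last_ell k hkl]
    · rw [Function.update_of_ne hkl]
      exact h.first_succ k (by omega)
  · intro k hk
    rw [Function.update_of_ne (show k ≠ P.ell by omega)]
    rcases eq_or_ne (k + 1) P.ell with hkl | hkl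
    · have := h.last_ell k hkl
      rw [this, show P.last k = n - 1 by omega]
      exact hO.resolve_left (by omega)
    · exact h.ne k (by omega)
  · intro k hk i h1 h2
    rcases eq_or_ne k P.ell with rfl | hkl
    · simp only [Function.update_self] at h1 h2
      omega
    · rw [Function.update_of_ne hkl] at h1 h2
      exact h.eq k (by omega) i h1 h2

theorem snoc_old (h : IsPartition n O P) (hn : 0 < n) (hO : O (n - 1) = O n) :
    IsPartition (n + 1) O ⟨P.ell, Function.update P.idx n (P.ell - 1),
      P.first, Function.update P.last (P.ell - 1) n⟩ := by
  have hell := h.ell_pos hn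
  have hl := h.last_ell (P.ell - 1) (by omega)
  have hf := h.first_le_last (P.ell - 1) (by omega)
  constructor <;> dsimp only
  · intro i hi
    rcases eq_or_ne i n with rfl | hin
    · simp
      omega
    · rw [Function.update_of_ne hin]
      exact h.idx_lt i (by omega)
  · intro i hi
    rcases eq_or_ne i n with rfl | hin
    · simp only [Function.update_self]
      omega
    · rw [Function.update_of_ne hin]
      exact h.first_le i (by omega)
  · intro i hi
    rcases eq_or_ne i n with rfl | hin
    · simp
    · rw [Function.update_of_ne hin]
      rcases eq_or_ne (P.idx i) (P.ell - 1) with hk | hk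
      · rw [hk, Function.update_self]
        omega
      · rw [Function.update_of_ne hk]
        exact h.le_last i (by omega)
  · intro k hk
    rcases eq_or_ne k (P.ell - 1) with rfl | hkl
    · rw [Function.update_self]
      omega
    · rw [Function.update_of_ne hkl]
      exact h.first_le_last k (by omega)
  · intro k hk
    rcases eq_or_ne k (P.ell - 1) with rfl | hkl
    · simp
    · rw [Function.update_of_ne hkl]
      have := h.last_lt k (by omega)
      omega
  · intro k hk i h1 h2
    rcases eq_or_ne k (P.ell - 1) with rfl | hkl
    · simp only [Function.update_self] at h2
      rcases eq_or_ne i n with rfl | hin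
      · simp
      · rw [Function.update_of_ne hin]
        exact h.idx_eq _ (by omega) i h1 (by omega)
    · rw [Function.update_of_ne hkl] at h2
      have := h.last_lt k (by omega)
      rw [Function.update_of_ne (by omega)]
      exact h.idx_eq k (by omega) i h1 h2
  · intro _
    exact h.first_zero hn
  · intro _
    exact hell
  · intro k hk
    obtain rfl : k = P.ell - 1 := by omega
    simp
  · intro k hk
    rw [Function.update_of_ne (show k ≠ P.ell - 1 by omega)]
    exact h.first_succ k (by omega)
  · intro k hk
    rw [Function.update_of_ne (show k ≠ P.ell - 1 by omega)]
    exact h.ne k (by omega)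
  · intro k hk i h1 h2
    rcases eq_or_ne k (P.ell - 1) with rfl | hkl
    · simp only [Function.update_self] at h2
      rcases eq_or_ne (i + 1) n with hin | hin
      · rw [hin, ← hO, ← hin, Nat.add_sub_cancel]
      · exact h.eq _ (by omega) i h1 (by omega)
    · rw [Function.update_of_ne hkl] at h2
      exact h.eq k (by omega) i h1 h2

/-- An index lies in an interval iff the interval has its number. -/
theorem idx_eq_iff (h : IsPartition n O P) {i k : ℕ} (hi : i < n) (hk : k < P.ell) :
    P.idx i = k ↔ P.first k ≤ i ∧ i ≤ P.last k := by
  constructor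
  · rintro rfl
    exact ⟨h.first_le i hi, h.le_last i hi⟩
  · rintro ⟨h1, h2⟩
    exact h.idx_eq k hk i h1 h2

end IsPartition

namespace Preprocessing

open Timed MaxQueue

theorem partition_val (n : ℕ) (O : Mem ℕ) : IsPartition n O (partition n O).val := by
  unfold partition
  refine forUp_induct (fun m P => IsPartition m O P) n ?_ ?_
  · constructor <;> simp
  · intro i _ P h
    simp only [bind_val, eq_val, ite_val, pure_val, read_val, write_val, sub_val, add_val,
      decide_eq_true_eq]
    by_cases h0 : i = 0
    · simpa [h0] using h.snoc_new (Or.inl h0)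
    · by_cases h1 : O (i - 1) = O i
      · simpa [h0, h1] using h.snoc_old (by omega) h1
      · simpa [h0, h1] using h.snoc_new (Or.inr h1)

variable {n : ℕ} {O : Mem ℕ} {P : IntervalPartition}

theorem intervalSums_val (hP : IsPartition n O P) (A : Mem ℝ) {k : ℕ} (hk : k < P.ell) :
    (intervalSums n P A).val.1 k =
      periodicSum n A (P.last k + 1) - periodicSum n A (P.first k) ∧
    GreatestOver (fun v => periodicSum n A (v + 1) - periodicSum n A (P.first k))
      (P.first k) (P.last k + 1) ((intervalSums n P A).val.2 k) := by
  have := forUp_induct (fun m (s : Mem ℝ × Mem ℝ) => ∀ k < P.ell, P.first k < m →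
    s.1 k = periodicSum n A (min m (P.last k + 1)) - periodicSum n A (P.first k) ∧
    GreatestOver (fun v => periodicSum n A (v + 1) - periodicSum n A (P.first k))
      (P.first k) (min m (P.last k + 1)) (s.2 k)) (s := (zeroMem ℝ, zeroMem ℝ)) n
      (body := fun i (S, F) => do
        let k ← read P.idx i
        let f ← read P.first k
        let a ← read A i
        if ← eq i f then
          let S ← write S k a
          let F ← write F k a
          pure (S, F)
        else
          let s ← read S k
          let s ← add s a
          let S ← write S k s
          let g ← read F k
          let g ← maxOf g s
          let F ← write F k g
          pure (S, F)) (by intro k _ h; omega) (by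
    rintro i hi ⟨S, F⟩ h k hk hki
    have hidx := hP.idx_eq_iff hi hk
    have hA : periodicSum n A (i + 1) = periodicSum n A i + A i := by
      rw [periodicSum_succ, Nat.mod_eq_of_lt hi]
    simp only [bind_val, eq_val, ite_val, pure_val, read_val, write_val, add_val,
      decide_eq_true_eq, maxOf_val]
    rcases eq_or_ne k (P.idx i) with hki' | hki'
    · rw [← hki']
      obtain ⟨h1, h2⟩ := hidx.1 hki'.symm
      rw [min_eq_left (by omega)]
      split_ifs with h3
      · rw [← h3]
        simp only [Function.update_self]
        refine ⟨by rw [hA]; ring, ?_⟩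
        have := GreatestOver.singleton (fun v => periodicSum n A (v + 1) - periodicSum n A i) i
        rwa [hA, add_sub_cancel_left] at this
      · obtain ⟨g1, g2⟩ := h k hk (by omega)
        rw [min_eq_left (by omega)] at g1 g2
        dsimp only at g1 g2
        simp only [Function.update_self]
        rw [g1]
        refine ⟨by rw [hA]; ring, ?_⟩
        have := g2.union (GreatestOver.singleton _ i)
        rw [hA] at this
        convert this using 2
        ring
    · have : ¬ (P.first k ≤ i ∧ i ≤ P.last k) := fun h => hki' (hidx.2 h).symm
      have hfl := hP.first_le_last k hk
      have e : min (i + 1) (P.last k + 1) = min i (P.last k + 1) := by omega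
      rw [e]
      have := h k hk (by omega)
      split_ifs <;> simpa [hki'] using this)
  have h := this k hk ((hP.first_le_last k hk).trans_lt (hP.last_lt k hk))
  rw [min_eq_right (hP.last_lt k hk)] at h
  exact h

theorem intervalMax_val (hP : IsPartition n O P) (M : Mem ℝ) {k : ℕ} (hk : k < P.ell) :
    GreatestOver M (P.first k) (P.last k + 1) ((intervalMax n P M).val k) := by
  have := forUp_induct (fun m (s : Mem ℝ) => ∀ k < P.ell, P.first k < m →
    GreatestOver M (P.first k) (min m (P.last k + 1)) (s k)) (s := zeroMem ℝ) n
      (body := fun i R => do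
        let k ← read P.idx i
        let f ← read P.first k
        let m ← read M i
        if ← eq i f then
          write R k m
        else
          let r ← read R k
          let r ← maxOf r m
          write R k r) (by intro k _ h; omega) (by
    intro i hi R h k hk hki
    have hidx := hP.idx_eq_iff hi hk
    simp only [bind_val, eq_val, ite_val, read_val, write_val, decide_eq_true_eq, maxOf_val]
    rcases eq_or_ne k (P.idx i) with hki' | hki'
    · rw [← hki']
      obtain ⟨h1, h2⟩ := hidx.1 hki'.symm
      rw [min_eq_left (by omega)]
      split_ifs with h3
      · rw [← h3]
        simp only [Function.update_self]
        exact GreatestOver.singleton M i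
      · have g := h k hk (by omega)
        rw [min_eq_left (by omega)] at g
        simp only [Function.update_self]
        exact g.union (GreatestOver.singleton M i)
    · have : ¬ (P.first k ≤ i ∧ i ≤ P.last k) := fun h => hki' (hidx.2 h).symm
      have hfl := hP.first_le_last k hk
      have e : min (i + 1) (P.last k + 1) = min i (P.last k + 1) := by omega
      rw [e]
      have := h k hk (by omega)
      split_ifs <;> simpa [hki'] using this)
  have h := this k hk ((hP.first_le_last k hk).trans_lt (hP.last_lt k hk))
  rw [min_eq_right (hP.last_lt k hk)] at h
  exact h

theorem suffixMax_val (hP : IsPartition n O P) (M : Mem ℝ) {p : ℕ} (hp : p < n) :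
    GreatestOver M p (P.last (P.idx p) + 1) ((suffixMax n P M).val p) := by
  unfold suffixMax
  refine forDown_induct (fun m (R : Mem ℝ) => ∀ p, m ≤ p → p < n →
    GreatestOver M p (P.last (P.idx p) + 1) (R p)) n (by intro p h h'; omega) ?_ p
    (Nat.zero_le _) hp
  intro i hi R h p hp hpn
  simp only [bind_val, eq_val, ite_val, read_val, write_val, add_val, decide_eq_true_eq, maxOf_val]
  rcases eq_or_ne p i with rfl | hpi
  · split_ifs with h1
    · rw [← h1, Function.update_self]
      exact GreatestOver.singleton M p
    · rw [Function.update_self]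
      have h2 := hP.le_last p hi
      have h3 := hP.idx_lt p hi
      have h4 := hP.last_lt _ h3
      have h5 := hP.idx_eq _ h3 (p + 1) (by have := hP.first_le p hi; omega) (by omega)
      have h6 := h (p + 1) le_rfl (by omega)
      rw [h5] at h6
      exact (GreatestOver.singleton M p).union h6
  · have := h p (by omega) hpn
    split_ifs <;> simpa [hpi] using this

theorem prefixMax_val (hP : IsPartition n O P) (M : Mem ℝ) {p : ℕ} (hp : p < n)
    (hfp : P.first (P.idx p) < p) :
    GreatestOver M (P.first (P.idx p)) p ((prefixMax n P M).val p) := by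
  unfold prefixMax
  refine forUp_induct (fun m (R : Mem ℝ) => ∀ p < m, P.first (P.idx p) < p →
    GreatestOver M (P.first (P.idx p)) p (R p)) n (by simp) ?_ p hp hfp
  intro i hi R h p hp hfp
  simp only [bind_val, eq_val, ite_val, read_val, write_val, sub_val, decide_eq_true_eq, maxOf_val,
    pure_val]
  rcases eq_or_ne p i with rfl | hpi
  · rw [if_neg (by omega)]
    have hs := GreatestOver.singleton M (p - 1)
    rw [Nat.sub_add_cancel (by omega)] at hs
    split_ifs with h1
    · rw [Function.update_self, ← h1]
      exact hs
    · rw [Function.update_self]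
      have h2 := hP.le_last p hi
      have h5 := hP.idx_eq _ (hP.idx_lt p hi) (p - 1) (by omega) (by omega)
      have h6 := h (p - 1) (by omega) (by rw [h5]; omega)
      rw [h5] at h6
      exact h6.union hs
  · have := h p (by omega) hfp
    split_ifs <;> simpa [hpi] using this

/-- The array `PFSF`, in terms of prefix sums. -/
theorem prefixMinSum_val (hP : IsPartition n O P) (A : Mem ℝ) {p : ℕ} (hp : p < n)
    (hfp : P.first (P.idx p) < p) :
    (∃ u v, P.first (P.idx p) < u ∧ u ≤ v ∧ v ≤ p ∧
      (prefixMinSum n P A).val p = periodicSum n A v - periodicSum n A u) ∧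
    ∀ u v, P.first (P.idx p) < u → u ≤ v → v ≤ p →
      (prefixMinSum n P A).val p ≤ periodicSum n A v - periodicSum n A u := by
  unfold prefixMinSum
  simp only [bind_val, pure_val]
  -- After iteration `p`, `cur` is the greatest opposite of the sum of a nonempty subsequence which
  -- ends at `p - 1`, or `0` if there is none, and `best` is that of a possibly empty subsequence.
  refine (forUp_induct (fun m (s : ℝ × ℝ × Mem ℝ) =>
    (∀ p < m, P.first (P.idx p) < p →
      (∃ u v, P.first (P.idx p) < u ∧ u ≤ v ∧ v ≤ p ∧
        s.2.2 p = periodicSum n A v - periodicSum n A u) ∧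
      ∀ u v, P.first (P.idx p) < u → u ≤ v → v ≤ p →
        s.2.2 p ≤ periodicSum n A v - periodicSum n A u) ∧
    (0 < m → P.first (P.idx (m - 1)) < m - 1 →
      (∃ u, P.first (P.idx (m - 1)) < u ∧ u ≤ m - 1 ∧
        s.1 = periodicSum n A u - periodicSum n A (m - 1)) ∧
      (∀ u, P.first (P.idx (m - 1)) < u → u ≤ m - 1 →
        periodicSum n A u - periodicSum n A (m - 1) ≤ max 0 s.1) ∧
      s.2.1 = - s.2.2 (m - 1))) n (by simp) ?_).1 p hp hfp
  rintro i hi ⟨cur, best, R⟩ ⟨h1, h2⟩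
  have hf := hP.first_le i hi
  simp only [bind_val, eq_val, ite_val, read_val, write_val, sub_val, decide_eq_true_eq, maxOf_val,
    pure_val, add_tsub_cancel_right]
  by_cases hif : i = P.first (P.idx i)
  · rw [if_pos hif]
    refine ⟨fun p hp hfp => ?_, fun _ h => by omega⟩
    rcases eq_or_ne p i with rfl | hpi
    · omega
    · exact h1 p (by omega) hfp
  · rw [if_neg hif]
    by_cases hif' : i - 1 = P.first (P.idx i)
    · rw [if_pos hif']
      refine ⟨fun p hp hfp => ?_, fun _ h => ?_⟩
      · rcases eq_or_ne p i with rfl | hpi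
        · simp only [Function.update_self]
          refine ⟨⟨p, p, hfp, le_rfl, le_rfl, by simp⟩, fun u v hu huv hv => ?_⟩
          obtain rfl : u = p := by omega
          obtain rfl : v = u := by omega
          simp
        · simpa [hpi] using h1 p (by omega) hfp
      · simp only [Function.update_self]
        refine ⟨⟨i, h, le_rfl, by simp⟩, fun u hu hu' => ?_, by simp⟩
        obtain rfl : u = i := by omega
        simp
    · rw [if_neg hif']
      have hlast := hP.le_last i hi
      have hidx := hP.idx_eq _ (hP.idx_lt i hi) (i - 1) (by omega) (by omega)
      have hA : periodicSum n A i = periodicSum n A (i - 1) + A (i - 1) := by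
        have := periodicSum_succ n A (i - 1)
        rwa [Nat.sub_add_cancel (by omega), Nat.mod_eq_of_lt (by omega)] at this
      have h2 := h2 (by omega) (by rw [hidx]; omega)
      have h3 := h1 (i - 1) (by omega) (by rw [hidx]; omega)
      rw [hidx] at h2 h3
      obtain ⟨⟨u0, hu0, hu0', hcur⟩, hmax, hbest⟩ := h2
      obtain ⟨⟨u1, v1, hu1, huv1, hv1, hR⟩, hmin⟩ := h3
      simp only at hcur hmax hbest hR hmin
      have hnew : ∃ u, P.first (P.idx i) < u ∧ u ≤ i - 1 ∧
          max 0 cur - A (i - 1) = periodicSum n A u - periodicSum n A i := by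
        rcases le_total 0 cur with h | h
        · exact ⟨u0, hu0, hu0', by rw [max_eq_right h, hcur, hA]; ring⟩
        · exact ⟨i - 1, by omega, le_rfl, by rw [max_eq_left h, hA]; ring⟩
      have hnew' : ∀ u, P.first (P.idx i) < u → u ≤ i - 1 →
          periodicSum n A u - periodicSum n A i ≤ max 0 cur - A (i - 1) := by
        intro u hu hu'
        have := hmax u hu hu'
        rw [hA]
        linarith
      have hb : 0 ≤ best := by
        have := hmin (i - 1) (i - 1) (by omega) le_rfl le_rfl
        rw [sub_self] at this
        linarith
      refine ⟨fun p hp hfp => ?_, fun _ h => ?_⟩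
      · rcases eq_or_ne p i with rfl | hpi
        · simp only [Function.update_self, zero_sub]
          refine ⟨?_, fun u v hu huv hv => ?_⟩
          · rcases le_total best (max 0 cur - A (p - 1)) with h | h
            · obtain ⟨u, hu, hu', e⟩ := hnew
              exact ⟨u, p, hu, by omega, le_rfl, by rw [max_eq_right h, e]; ring⟩
            · exact ⟨u1, v1, hu1, huv1, by omega, by rw [max_eq_left h, hbest, hR]; ring⟩
          · have l1 := le_max_left best (max 0 cur - A (p - 1))
            have l2 := le_max_right best (max 0 cur - A (p - 1))
            rcases eq_or_ne v p with rfl | hvp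
            · rcases eq_or_ne u v with rfl | huv'
              · rw [sub_self]; linarith
              · have := hnew' u hu (by omega)
                linarith
            · have := hmin u v hu huv (by omega)
              linarith
        · simpa [hpi] using h1 p (by omega) hfp
      · simp only [Function.update_self, zero_sub, neg_neg]
        refine ⟨?_, fun u hu hu' => ?_, trivial⟩
        · obtain ⟨u, g1, g2, g3⟩ := hnew
          exact ⟨u, g1, by omega, g3⟩
        · rcases eq_or_ne u i with rfl | hui
          · simp
          · exact (hnew' u hu (by omega)).trans (le_max_right _ _)

end Preprocessing

namespace Preprocessing

open Timed MaxQueue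

/-- The elements of the max-queue are numbered such that element `s` belongs to the interval
`2 * ell - 1 - s` modulo `ell`. -/
theorem otherIntervals_val {ell : ℕ} (hell : 1 < ell) (V D : Mem ℝ) {k : ℕ} (hk : k < ell) :
    GreatestOver (fun i => V (i % ell) + (periodicSum ell D i - periodicSum ell D (k + 1)))
      (k + 1) (k + ell) ((otherIntervals ell V D).val k) := by
  set v : ℕ → ℝ := fun s => V ((2 * ell - 1 - s) % ell) with hv
  set E : ℕ → ℝ := fun s => periodicSum ell D (2 * ell) - periodicSum ell D (2 * ell - s) with hE
  have hpush : ∀ {b T : ℕ} {q : MaxQueue} {t : ℕ → ℕ} (i : ℕ), T < 2 * ell →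
      (2 * ell - 1 - T) % ell = i → Holds v E (fun _ => 0) b T q t →
      ∃ t', Holds v E (fun _ => 0) b (T + 1) (push (V i) (D i) 0 q).val t' := by
    rintro b T q t i hT rfl h
    have h' := h.push
    have e : E (T + 1) - E T = D ((2 * ell - 1 - T) % ell) := by
      have := periodicSum_succ ell D (2 * ell - 1 - T)
      simp only [hE]
      rw [show 2 * ell - 1 - T + 1 = 2 * ell - T by omega] at this
      rw [this, show 2 * ell - (T + 1) = 2 * ell - 1 - T by omega]
      ring
    rwa [e] at h'
  have hpeek : ∀ {b K : ℕ} {q : MaxQueue} {t : ℕ → ℕ}, b + K = ell →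
      Holds v E (fun _ => 0) b (b + (ell - 1)) q t →
      GreatestOver (fun i => V (i % ell) + (periodicSum ell D i - periodicSum ell D (K + 1)))
        (K + 1) (K + ell) q.maxKey := by
    rintro b K q t hK h
    obtain ⟨s, h1, h2, h3, -, h5, -⟩ := h.peek (by omega)
    have e : ∀ i, K + 1 ≤ i → i < K + ell →
        v (2 * ell - 1 - i) - E (2 * ell - 1 - i + 1) + E (b + (ell - 1)) =
        V (i % ell) + (periodicSum ell D i - periodicSum ell D (K + 1)) := by
      intro i hi hi'
      simp only [hv, hE]
      rw [show 2 * ell - 1 - (2 * ell - 1 - i) = i by omega,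
        show 2 * ell - (2 * ell - 1 - i + 1) = i by omega,
        show 2 * ell - (b + (ell - 1)) = K + 1 by omega]
      ring
    refine ⟨⟨2 * ell - 1 - s, by omega, by omega, ?_⟩, fun i hi hi' => ?_⟩
    · simp only
      rw [← e (2 * ell - 1 - s) (by omega) (by omega),
        show 2 * ell - 1 - (2 * ell - 1 - s) = s by omega, h3]
    · simp only
      rw [← e i hi hi', h3]
      have := h5 (2 * ell - 1 - i) (by omega) (by omega)
      linarith
  have h1 : ∃ t, Holds v E (fun _ => 0) 0 (ell - 1 - 0) (forDown (ell - 1) (fun j q => do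
      let i ← add j 1
      let v ← read V i
      let d ← read D i
      push v d 0 q) init).val t := by
    refine forDown_induct (fun m q => ∃ t, Holds v E (fun _ => 0) 0 (ell - 1 - m) q t) (ell - 1)
      ⟨fun _ => 0, by rw [Nat.sub_self]; exact holds_init⟩ ?_
    rintro j hj q ⟨t, h⟩
    have := hpush (j + 1) (by omega) (by
      rw [show 2 * ell - 1 - (ell - 1 - (j + 1)) = j + 1 + ell by omega, Nat.add_mod_right,
        Nat.mod_eq_of_lt (by omega)]) h
    rwa [show ell - 1 - (j + 1) + 1 = ell - 1 - j by omega] at this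
  unfold otherIntervals
  simp only [bind_val, sub_val, le_val, decide_eq_true_eq, ite_val, getKeyMax_val, write_val,
    pure_val]
  rw [if_neg (by omega)]
  set q := (forDown (ell - 1) _ init).val
  obtain ⟨t, h1⟩ := h1
  refine (forDown_induct (s := (q, Function.update (zeroMem ℝ) 0 q.maxKey))
    (fun m (s : MaxQueue × Mem ℝ) =>
      (∃ t, Holds v E (fun _ => 0) (ell - 1 - m) (ell - 1 - m + (ell - 1)) s.1 t) ∧
      ∀ k < ell, (k = 0 ∨ m < k) →
        GreatestOver (fun i => V (i % ell) + (periodicSum ell D i - periodicSum ell D (k + 1)))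
          (k + 1) (k + ell) (s.2 k)) (ell - 1) ?_ ?_).2 k hk (by omega)
  · refine ⟨⟨t, by simpa using h1⟩, fun k hk h => ?_⟩
    obtain rfl : k = 0 := by omega
    have h2 := hpeek (b := 0) (K := ell) (by omega) (by simpa using h1)
    -- the numbering of the elements yields the intervals `ell + 1, …, 2 * ell - 1` here
    obtain ⟨⟨i, i1, i2, i3⟩, hi⟩ := h2
    have hper := fun i => periodicSum_add_period ell D i
    simp only [Function.update_self]
    refine ⟨⟨i - ell, by omega, by omega, ?_⟩, fun s hs hs' => ?_⟩
    · have := hper (i - ell)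
      have h3 := Nat.add_mod_right (i - ell) ell
      rw [Nat.sub_add_cancel (by omega)] at this h3
      simp only at i3 ⊢
      rw [← h3, ← i3, this, zero_add, add_comm ell 1, hper 1]
      ring
    · have := hi (s + ell) (by omega) (by omega)
      simp only [Nat.add_mod_right] at this
      rw [hper s, add_comm ell 1, hper 1] at this
      simp only [zero_add]
      linarith
  · rintro j hj ⟨q, R⟩ ⟨⟨t, h⟩, hR⟩
    simp only [bind_val, read_val, add_val, getKeyMax_val, write_val, pure_val]
    rw [addMod_val (by omega) (by omega)]
    have h := hpush ((j + 2) % ell) (by omega) (by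
      rw [show 2 * ell - 1 - (ell - 1 - (j + 1) + (ell - 1)) = j + 2 by omega])
      (h.pop (by omega))
    rw [show ell - 1 - (j + 1) + (ell - 1) + 1 = ell - 1 - j + (ell - 1) by omega,
      show ell - 1 - (j + 1) + 1 = ell - 1 - j by omega] at h
    refine ⟨h, fun k hk h' => ?_⟩
    rcases eq_or_ne k (j + 1) with rfl | hkj
    · obtain ⟨t, h⟩ := h
      rw [Function.update_self]
      exact hpeek (by omega) h
    · simpa [hkj] using hR k hk (by omega)

variable {n : ℕ} {O : Mem ℕ} {P : IntervalPartition}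

/-- The first index of interval `i`, when the intervals of the periodic extension are numbered
consecutively. -/
def liftedFirst (n : ℕ) (P : IntervalPartition) (i : ℕ) : ℕ :=
  P.first (i % P.ell) + n * (i / P.ell)

theorem liftedFirst_succ (hP : IsPartition n O P) (hell : 0 < P.ell) (i : ℕ) :
    liftedFirst n P (i + 1) = P.last (i % P.ell) + 1 + n * (i / P.ell) := by
  unfold liftedFirst
  have hn := hP.last_lt 0 hell
  have hi := Nat.mod_lt i hell
  have hm := Nat.mod_add_div i P.ell
  rcases eq_or_ne (i % P.ell + 1) P.ell with h | h
  · have h1 : i + 1 = P.ell * (i / P.ell + 1) := by rw [mul_add]; omega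
    have h2 : (i + 1) / P.ell = i / P.ell + 1 := by
      rw [h1, Nat.mul_div_cancel_left _ hell]
    have h3 : (i + 1) % P.ell = 0 := by rw [h1, Nat.mul_mod_right]
    rw [h2, h3, hP.first_zero (by omega), hP.last_ell _ h]
    ring
  · have h1 : i + 1 = (i % P.ell + 1) + P.ell * (i / P.ell) := by omega
    have h2 : (i + 1) / P.ell = i / P.ell := by
      conv_lhs => rw [h1]
      rw [Nat.add_mul_div_left _ _ hell, Nat.div_eq_of_lt (by omega), zero_add]
    have h3 : (i + 1) % P.ell = i % P.ell + 1 := by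
      conv_lhs => rw [h1]
      rw [Nat.add_mul_mod_self_left, Nat.mod_eq_of_lt (by omega)]
    rw [h2, h3, hP.first_succ _ (by omega)]

theorem liftedFirst_mono (hP : IsPartition n O P) (hell : 0 < P.ell) :
    Monotone (liftedFirst n P) := by
  refine monotone_nat_of_le_succ fun i => ?_
  rw [liftedFirst_succ hP hell, liftedFirst]
  have := hP.first_le_last _ (Nat.mod_lt i hell)
  omega

theorem liftedFirst_add_ell {k : ℕ} (hk : k < P.ell) :
    liftedFirst n P (k + P.ell) = P.first k + n := by
  rw [liftedFirst, Nat.add_mod_right, Nat.mod_eq_of_lt hk, Nat.add_div_right _ (by omega),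
    Nat.div_eq_of_lt hk]
  simp

/-- The array `IOMCS`. -/
theorem otherIntervals_max (hP : IsPartition n O P) (hell : 1 < P.ell) (M : Mem ℝ) {IMCS : Mem ℝ}
    (hI : ∀ k < P.ell, GreatestOver M (P.first k) (P.last k + 1) (IMCS k)) {k : ℕ}
    (hk : k < P.ell) :
    GreatestOver (fun i => M (i % n)) (P.last k + 1) (P.first k + n)
      ((otherIntervals P.ell IMCS (zeroMem ℝ)).val k) := by
  have h0 : ∀ t, periodicSum P.ell (zeroMem ℝ) t = 0 := fun t => by simp [periodicSum, zeroMem]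
  have h := otherIntervals_val hell IMCS (zeroMem ℝ) hk
  simp only [h0, sub_zero, add_zero] at h
  have := GreatestOver.concat (f := fun i => M (i % n)) (liftedFirst_mono hP (by omega))
    (fun i _ _ => ?_) h
  · rwa [liftedFirst_succ hP (by omega), Nat.mod_eq_of_lt hk, Nat.div_eq_of_lt hk, mul_zero,
      add_zero, liftedFirst_add_ell hk] at this
  · rw [liftedFirst_succ hP (by omega), liftedFirst]
    have hi := Nat.mod_lt i (show P.ell > 0 by omega)
    have hl := hP.last_lt _ hi
    refine GreatestOver.shift (f := fun i => M (i % n)) _ ((hI _ hi).congr fun s _ hs => ?_)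
      fun s => ?_
    · rw [Nat.mod_eq_of_lt (by omega)]
    · rw [Nat.add_mul_mod_self_left]

/-- The array `IRCS`. -/
theorem otherIntervals_prefix (hP : IsPartition n O P) (hell : 1 < P.ell) {A S F : Mem ℝ}
    (hS : ∀ k < P.ell, S k = periodicSum n A (P.last k + 1) - periodicSum n A (P.first k))
    (hF : ∀ k < P.ell,
      GreatestOver (fun v => periodicSum n A (v + 1) - periodicSum n A (P.first k))
        (P.first k) (P.last k + 1) (F k)) {k : ℕ} (hk : k < P.ell) :
    GreatestOver (fun v => periodicSum n A (v + 1) - periodicSum n A (P.last k + 1))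
      (P.last k + 1) (P.first k + n) ((otherIntervals P.ell F S).val k) := by
  have h0 : ∀ t, periodicSum P.ell S t = periodicSum n A (liftedFirst n P t) := by
    intro t
    induction t with
    | zero =>
      have hn := hP.last_lt k hk
      simp [liftedFirst, hP.first_zero (by omega)]
    | succ t ih =>
      rw [periodicSum_succ, ih, liftedFirst_succ hP (by omega),
        hS _ (Nat.mod_lt t (by omega)), liftedFirst, periodicSum_add_mul_period,
        periodicSum_add_mul_period]
      ring
  have h := otherIntervals_val hell F S hk
  have e : liftedFirst n P (k + 1) = P.last k + 1 := by
    rw [liftedFirst_succ hP (by omega), Nat.mod_eq_of_lt hk, Nat.div_eq_of_lt hk, mul_zero,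
      add_zero]
  simp only [h0, e] at h
  have := GreatestOver.concat
    (f := fun v => periodicSum n A (v + 1) - periodicSum n A (P.last k + 1))
    (liftedFirst_mono hP (by omega)) (fun i _ _ => ?_) h
  · rwa [e, liftedFirst_add_ell hk] at this
  · rw [liftedFirst_succ hP (by omega), liftedFirst]
    have hi := Nat.mod_lt i (show P.ell > 0 by omega)
    refine ((hF _ hi).add_const _).shift _ fun s => ?_
    rw [show s + n * (i / P.ell) + 1 = (s + 1) + n * (i / P.ell) by ring,
      periodicSum_add_mul_period, periodicSum_add_mul_period]
    ring

/-- The array `PFRMMS`, in terms of prefix sums. For sequences of type 3, the prefix sums are least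
at the end of an interval, so that the greatest sum of a subsequence of the other intervals is that
of a prefix. -/
theorem rotatedMaxSum_val (hP : IsPartition n O P) {A IRCS : Mem ℝ}
    (hmin : ∀ k < P.ell, ∀ u, P.last k + 1 ≤ u → u ≤ P.first k + n →
      periodicSum n A (P.last k + 1) ≤ periodicSum n A u)
    (hI : 1 < P.ell → ∀ k < P.ell,
      GreatestOver (fun v => periodicSum n A (v + 1) - periodicSum n A (P.last k + 1))
        (P.last k + 1) (P.first k + n) (IRCS k)) {p : ℕ} (hp : p < n) :
    (∃ u v, p ≤ u ∧ u ≤ v ∧ v ≤ P.first (P.idx p) + n ∧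
      (rotatedMaxSum n P A IRCS).val p = periodicSum n A v - periodicSum n A u) ∧
    ∀ u v, p ≤ u → u ≤ v → v ≤ P.first (P.idx p) + n →
      periodicSum n A v - periodicSum n A u ≤ (rotatedMaxSum n P A IRCS).val p := by
  unfold rotatedMaxSum
  simp only [bind_val, pure_val]
  refine (forDown_induct (fun m (s : ℝ × ℝ × Mem ℝ) =>
    (∀ p, m ≤ p → p < n →
      (∃ u v, p ≤ u ∧ u ≤ v ∧ v ≤ P.first (P.idx p) + n ∧
        s.2.2 p = periodicSum n A v - periodicSum n A u) ∧
      ∀ u v, p ≤ u → u ≤ v → v ≤ P.first (P.idx p) + n →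
        periodicSum n A v - periodicSum n A u ≤ s.2.2 p) ∧
    (m < n →
      (∃ v, m < v ∧ v ≤ P.first (P.idx m) + n ∧ s.1 = periodicSum n A v - periodicSum n A m) ∧
      (∀ v, m < v → v ≤ P.first (P.idx m) + n →
        periodicSum n A v - periodicSum n A m ≤ s.1) ∧
      s.2.1 = s.2.2 m)) n ⟨fun p h h' => by omega, fun h => by omega⟩ ?_).1 p (Nat.zero_le p) hp
  rintro p hp ⟨cur, best, R⟩ ⟨h1, h2⟩
  simp only [bind_val, eq_val, le_val, ite_val, read_val, write_val, add_val, decide_eq_true_eq,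
    maxOf_val, pure_val]
  set s : ℝ × ℝ := if p = P.last (P.idx p) then
    if P.ell ≤ 1 then (0, 0) else (IRCS (P.idx p), max 0 (IRCS (P.idx p))) else (cur, best) with hs
  have hA : periodicSum n A (p + 1) = periodicSum n A p + A p := by
    rw [periodicSum_succ, Nat.mod_eq_of_lt hp]
  have hk := hP.idx_lt p hp
  have hf := hP.first_le p hp
  have hl := hP.le_last p hp
  have hln := hP.last_lt _ hk
  -- what is known after the elements to the right of `p`
  have key : (∃ v, p + 1 ≤ v ∧ v ≤ P.first (P.idx p) + n ∧
        max 0 s.1 = periodicSum n A v - periodicSum n A (p + 1)) ∧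
      (∀ v, p + 1 ≤ v → v ≤ P.first (P.idx p) + n →
        periodicSum n A v - periodicSum n A (p + 1) ≤ max 0 s.1) ∧
      (∃ u v, p + 1 ≤ u ∧ u ≤ v ∧ v ≤ P.first (P.idx p) + n ∧
        s.2 = periodicSum n A v - periodicSum n A u) ∧
      ∀ u v, p + 1 ≤ u → u ≤ v → v ≤ P.first (P.idx p) + n →
        periodicSum n A v - periodicSum n A u ≤ s.2 := by
    by_cases hpl : p = P.last (P.idx p)
    · rw [if_pos hpl] at hs
      by_cases hell : P.ell ≤ 1
      · rw [if_pos hell] at hs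
        have h0 : P.idx p = 0 := by omega
        have h3 := hP.last_ell (P.idx p) (by omega)
        have h4 := hP.first_zero (by omega)
        rw [h0] at h3 hpl ⊢
        rw [h4, hs]
        simp only [max_self]
        refine ⟨⟨p + 1, le_rfl, by omega, by simp⟩, fun v hv hv' => ?_,
          ⟨p + 1, p + 1, le_rfl, le_rfl, by omega, by simp⟩, fun u v hu huv hv => ?_⟩
        · rw [show v = p + 1 by omega, sub_self]
        · rw [show v = u by omega, sub_self]
      · rw [if_neg hell] at hs
        obtain ⟨⟨i, i1, i2, i3⟩, h4⟩ := hI (by omega) _ hk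
        have h5 := hmin _ hk
        rw [← hpl] at i1 i3 h4 h5
        rw [hs]
        simp only
        have hle : ∀ v, p + 1 ≤ v → v ≤ P.first (P.idx p) + n →
            periodicSum n A v - periodicSum n A (p + 1) ≤ max 0 (IRCS (P.idx p)) := by
          intro v hv hv'
          rcases eq_or_ne v (p + 1) with rfl | hvp
          · simp
          · have := h4 (v - 1) (by omega) (by omega)
            simp only [Nat.sub_add_cancel (show 1 ≤ v by omega)] at this
            exact this.trans (le_max_right _ _)
        have hex : ∃ v, p + 1 ≤ v ∧ v ≤ P.first (P.idx p) + n ∧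
            max 0 (IRCS (P.idx p)) = periodicSum n A v - periodicSum n A (p + 1) := by
          rcases le_total 0 (IRCS (P.idx p)) with h | h
          · exact ⟨i + 1, by omega, by omega, by rw [max_eq_right h, ← i3]⟩
          · exact ⟨p + 1, le_rfl, by omega, by rw [max_eq_left h]; simp⟩
        refine ⟨hex, hle, ?_, fun u v hu huv hv => ?_⟩
        · obtain ⟨v, v1, v2, v3⟩ := hex
          exact ⟨p + 1, v, le_rfl, v1, v2, v3⟩
        · have := hle v (by omega) hv
          have := h5 u hu (by omega)
          linarith
    · rw [if_neg hpl] at hs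
      have hidx := hP.idx_eq _ hk (p + 1) (by omega) (by omega)
      obtain ⟨⟨v, v1, v2, v3⟩, h4, h5⟩ := h2 (by omega)
      obtain ⟨h6, h7⟩ := h1 (p + 1) le_rfl (by omega)
      rw [hidx] at v2 h4 h6 h7
      simp only at v3 h4 h5 h6 h7
      rw [hs]
      simp only
      rw [h5]
      refine ⟨?_, fun v hv hv' => ?_, h6, h7⟩
      · rcases le_total 0 cur with h | h
        · exact ⟨v, by omega, v2, by rw [max_eq_right h, v3]⟩
        · exact ⟨p + 1, le_rfl, by omega, by rw [max_eq_left h]; simp⟩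
      · rcases eq_or_ne v (p + 1) with rfl | hvp
        · simp
        · exact (h4 v (by omega) hv').trans (le_max_right _ _)
  obtain ⟨⟨v0, v1, v2, v3⟩, h4, ⟨u1, w1, w2, w3, w4, w5⟩, h7⟩ := key
  have h8 := h7 (p + 1) (p + 1) le_rfl le_rfl (by omega)
  rw [sub_self] at h8
  refine ⟨fun p' hp' hpn' => ?_, fun _ => ⟨⟨v0, by omega, v2, ?_⟩, fun v hv hv' => ?_, ?_⟩⟩
  · rcases eq_or_ne p' p with rfl | hpp
    · simp only [Function.update_self]
      refine ⟨?_, fun u v hu huv hv => ?_⟩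
      · rcases le_total s.2 (A p' + max 0 s.1) with h | h
        · exact ⟨p', v0, le_rfl, by omega, v2, by rw [max_eq_right h, v3, hA]; ring⟩
        · exact ⟨u1, w1, by omega, w3, w4, by rw [max_eq_left h, w5]⟩
      · have l1 := le_max_left s.2 (A p' + max 0 s.1)
        have l2 := le_max_right s.2 (A p' + max 0 s.1)
        rcases eq_or_ne u p' with rfl | hup
        · rcases eq_or_ne v u with rfl | hvu
          · rw [sub_self]; linarith
          · have := h4 v (by omega) hv
            linarith
        · have := h7 u v (by omega) huv hv
          linarith
    · simpa [hpp] using h1 p' (by omega) hpn'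
  · rw [v3, hA]; ring
  · have := h4 v (by omega) hv'
    linarith
  · simp

theorem rotatedMaxCircSum_val (hP : IsPartition n O P) {M IOMCS : Mem ℝ}
    (hI : 1 < P.ell → ∀ k < P.ell,
      GreatestOver (fun i => M (i % n)) (P.last k + 1) (P.first k + n) (IOMCS k))
    {p : ℕ} (hp : p < n) :
    GreatestOver (fun i => M (i % n)) p (P.first (P.idx p) + n)
      ((rotatedMaxCircSum n P M IOMCS).val p) := by
  unfold rotatedMaxCircSum
  refine forDown_induct (fun m (R : Mem ℝ) => ∀ p, m ≤ p → p < n →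
    GreatestOver (fun i => M (i % n)) p (P.first (P.idx p) + n) (R p)) n
    (by intro p h h'; omega) ?_ p (Nat.zero_le _) hp
  intro i hi R h p hp hpn
  simp only [bind_val, eq_val, le_val, ite_val, read_val, write_val, add_val, decide_eq_true_eq,
    maxOf_val]
  rcases eq_or_ne p i with rfl | hpi
  · have hk := hP.idx_lt p hi
    have hf := hP.first_le p hi
    have hl := hP.le_last p hi
    have hln := hP.last_lt _ hk
    have hsing := GreatestOver.singleton (fun i => M (i % n)) p
    simp only [Nat.mod_eq_of_lt hi] at hsing
    split_ifs with h1 h2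
    · rw [Function.update_self]
      have h0 : P.idx p = 0 := by omega
      have h3 := hP.last_ell (P.idx p) (by omega)
      have h4 := hP.first_zero (by omega)
      rw [h0] at h1 h3 ⊢
      rwa [h4, show 0 + n = p + 1 by omega]
    · rw [Function.update_self]
      have := hI (by omega) _ hk
      rw [← h1] at this
      exact hsing.union this
    · rw [Function.update_self]
      have h5 := hP.idx_eq _ hk (p + 1) (by omega) (by omega)
      have h6 := h (p + 1) le_rfl (by omega)
      rw [h5] at h6
      exact hsing.union h6
  · have := h p (by omega) hpn
    split_ifs <;> simpa [hpi] using this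

theorem prevMaxSums_val (n : ℕ) (M : Mem ℝ) {p : ℕ} (hp : p ≤ n) :
    0 ≤ (prevMaxSums n M).val p ∧ (∀ i < p, M i ≤ (prevMaxSums n M).val p) ∧
    ((prevMaxSums n M).val p = 0 ∨ ∃ i < p, (prevMaxSums n M).val p = M i) := by
  unfold prevMaxSums
  refine forUp_induct (fun m (R : Mem ℝ) => ∀ p ≤ m, 0 ≤ R p ∧ (∀ i < p, M i ≤ R p) ∧
    (R p = 0 ∨ ∃ i < p, R p = M i)) n ?_ ?_ p hp
  · intro p hp
    obtain rfl : p = 0 := by omega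
    simp [zeroMem]
  · intro m hm R h p hp
    simp only [bind_val, read_val, maxOf_val, add_val, write_val]
    rcases eq_or_ne p (m + 1) with rfl | hpm
    · obtain ⟨h1, h2, h3⟩ := h m le_rfl
      rw [Function.update_self]
      refine ⟨le_max_of_le_left h1, fun i hi => ?_, ?_⟩
      · rcases (Nat.lt_succ_iff.1 hi).lt_or_eq with h' | rfl
        · exact le_max_of_le_left (h2 i h')
        · exact le_max_right _ _
      · rcases le_total (R m) (M m) with h' | h'
        · exact Or.inr ⟨m, by omega, max_eq_right h'⟩
        · rw [max_eq_left h']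
          rcases h3 with h3 | ⟨i, hi, h3⟩
          · exact Or.inl h3
          · exact Or.inr ⟨i, by omega, h3⟩
    · rw [Function.update_of_ne hpm]
      exact h p (by omega)

theorem nextMaxSums_val (hP : IsPartition n O P) (M : Mem ℝ) {k : ℕ} (hk : k + 1 < P.ell) :
    GreatestOver M (P.last k + 1) n ((nextMaxSums n P M).val k) := by
  unfold nextMaxSums
  simp only [bind_val, pure_val]
  refine (forDown_induct (fun m (s : ℝ × Mem ℝ) => (m < n → GreatestOver M m n s.1) ∧
    ∀ k, k + 1 < P.ell → m ≤ P.last k + 1 → GreatestOver M (P.last k + 1) n (s.2 k)) n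
    ⟨fun h => by omega, fun k hk h => ?_⟩ ?_).2 k hk (by omega)
  · have := hP.first_succ k hk
    have := hP.first_le_last _ hk
    have := hP.last_lt _ hk
    omega
  · rintro j hj ⟨g, R⟩ ⟨h1, h2⟩
    simp only [bind_val, read_val, maxOf_val, add_val, sub_val, write_val, eq_val, ite_val,
      pure_val, decide_eq_true_eq]
    have hg : GreatestOver M j n (if j + 1 = n then M j else max (M j) g) := by
      have := GreatestOver.singleton M j
      split_ifs with h
      · rwa [h] at this
      · exact this.union (h1 (by omega))
    have hidx := hP.idx_lt j hj
    generalize (if j + 1 = n then M j else max (M j) g) = g' at hg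
    split_ifs with h3 h4
    · refine ⟨fun _ => hg, fun k hk hjk => h2 k hk ?_⟩
      rcases hjk.lt_or_eq with h | h
      · exact h
      · have h5 := hP.first_succ k hk
        have h6 := hP.idx_eq (k + 1) hk j (by omega) (by have := hP.first_le_last _ hk; omega)
        omega
    · refine ⟨fun _ => hg, fun k hk hjk => ?_⟩
      dsimp only
      have h5 := hP.first_succ k hk
      rcases eq_or_ne k (P.idx j - 1) with rfl | hkj
      · rw [Nat.sub_add_cancel (by omega)] at h5
        rw [Function.update_self, ← h5, ← h3]
        exact hg
      · rw [Function.update_of_ne hkj]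
        apply h2 k hk
        rcases hjk.lt_or_eq with h | h
        · exact h
        · have h6 := hP.idx_eq (k + 1) hk j (by omega) (by have := hP.first_le_last _ hk; omega)
          omega
    · refine ⟨fun _ => hg, fun k hk hjk => h2 k hk ?_⟩
      rcases hjk.lt_or_eq with h | h
      · exact h
      · have h5 := hP.first_succ k hk
        have h6 := hP.idx_eq (k + 1) hk j (by omega) (by have := hP.first_le_last _ hk; omega)
        rw [h6] at h3
        omega

theorem lastPositive_val (hP : IsPartition n O P) (A : Mem ℝ) {k : ℕ} (hk : k < P.ell) :
    P.first k ≤ (lastPositive n P A).val k ∧ (lastPositive n P A).val k ≤ P.last k ∧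
    (∀ i, (lastPositive n P A).val k < i → i ≤ P.last k → A i ≤ 0) ∧
    ((lastPositive n P A).val k = P.first k ∨ 0 < A ((lastPositive n P A).val k)) := by
  have := forUp_induct (fun m (R : Mem ℕ) => ∀ k < P.ell, P.first k < m →
    P.first k ≤ R k ∧ R k ≤ P.last k ∧ (∀ i, R k < i → i ≤ P.last k → i < m → A i ≤ 0) ∧
    (R k = P.first k ∨ 0 < A (R k))) (s := zeroMem ℕ) n
    (body := fun i R => do
      let k ← read P.idx i
      let f ← read P.first k
      let a ← read A i
      if ← eq i f then
        write R k i
      else if ← lt 0 a then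
        write R k i
      else
        pure R) (by intro k _ h; omega) (by
    intro i hi R h k hk hki
    have hidx := hP.idx_eq_iff hi hk
    simp only [bind_val, eq_val, lt_val, ite_val, read_val, write_val, decide_eq_true_eq, pure_val]
    have hfl := hP.first_le_last k hk
    rcases eq_or_ne k (P.idx i) with hki' | hki'
    · rw [← hki']
      obtain ⟨h1, h2⟩ := hidx.1 hki'.symm
      split_ifs with h3 h4
      · simp only [Function.update_self]
        exact ⟨h1, h2, fun j hj hj' hj'' => by omega, Or.inl h3⟩
      · simp only [Function.update_self]
        exact ⟨h1, h2, fun j hj hj' hj'' => by omega, Or.inr h4⟩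
      · obtain ⟨g1, g2, g3, g4⟩ := h k hk (by omega)
        refine ⟨g1, g2, fun j hj hj' hj'' => ?_, g4⟩
        rcases eq_or_ne j i with rfl | hji
        · exact not_lt.1 h4
        · exact g3 j hj hj' (by omega)
    · have : ¬ (P.first k ≤ i ∧ i ≤ P.last k) := fun h => hki' (hidx.2 h).symm
      obtain ⟨g1, g2, g3, g4⟩ := h k hk (by omega)
      have : P.first k ≤ R k ∧ R k ≤ P.last k ∧
          (∀ j, R k < j → j ≤ P.last k → j < i + 1 → A j ≤ 0) ∧
          (R k = P.first k ∨ 0 < A (R k)) :=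
        ⟨g1, g2, fun j hj hj' hj'' => g3 j hj hj' (by omega), g4⟩
      split_ifs <;> simpa [hki'] using this)
  obtain ⟨g1, g2, g3, g4⟩ := this k hk ((hP.first_le_last k hk).trans_lt (hP.last_lt k hk))
  exact ⟨g1, g2, fun i hi hi' => g3 i hi hi' (hi'.trans_lt (hP.last_lt k hk)), g4⟩

end Preprocessing

/-- `b` is the least value of `M` on `[p, q)`. -/
def LeastOver (M : Mem ℝ) (p q : ℕ) (b : ℝ) : Prop :=
  (∃ t, p ≤ t ∧ t < q ∧ b = M t) ∧ ∀ t, p ≤ t → t < q → b ≤ M t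

theorem LeastOver.cons {M : Mem ℝ} {p q : ℕ} {b : ℝ} (h : LeastOver M (p + 1) q b) :
    LeastOver M p q (min (M p) b) := by
  obtain ⟨⟨t, h1, h2, h3⟩, h4⟩ := h
  refine ⟨?_, fun s hs hs' => ?_⟩
  · rcases le_total (M p) b with h | h
    · exact ⟨p, le_rfl, by omega, min_eq_left h⟩
    · exact ⟨t, by omega, h2, by rw [min_eq_right h, h3]⟩
  · rcases eq_or_ne s p with rfl | hsp
    · exact min_le_left _ _
    · exact (min_le_right _ _).trans (h4 s (by omega) hs')

/-- What the values at `p` of the arrays `X1`, `X2`, `BX1`, `BX2` stand for, if `p` is less than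
`xs`, the value of `IXs` for its interval: `x1` maximizes `M` on `[p, xs]`; `x2` maximizes, up to
negative values, the greatest increase of `M` from an index in `[p, x2)` to `x2`; and `b1`, `b2` are
the least values of `M` at the indices from `p` to before `x1` and `x2`. -/
structure IsPeak (M : Mem ℝ) (p xs x1 x2 : ℕ) (b1 b2 : ℝ) : Prop where
  le_x1 : p ≤ x1
  x1_le : x1 ≤ xs
  lt_x2 : p < x2
  x2_le : x2 ≤ xs
  max_x1 : ∀ i, p ≤ i → i ≤ xs → M i ≤ M x1
  least_b1 : (x1 = p ∧ b1 = M p) ∨ (p < x1 ∧ LeastOver M p x1 b1)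
  least_b2 : LeastOver M p x2 b2
  max_x2 : ∀ t i, p ≤ t → t < i → i ≤ xs → M i - M t ≤ max 0 (M x2 - b2)

namespace IsPeak

variable {M : Mem ℝ} {p xs x1 x2 : ℕ} {b1 b2 : ℝ}

theorem base (h : M p ≤ M (p + 1)) : IsPeak M p (p + 1) (p + 1) (p + 1) (M p) (M p) := by
  have hl : LeastOver M p (p + 1) (M p) :=
    ⟨⟨p, le_rfl, by omega, rfl⟩, fun t ht ht' => by rw [show t = p by omega]⟩
  refine ⟨by omega, le_rfl, by omega, le_rfl, fun i hi hi' => ?_, Or.inr ⟨by omega, hl⟩, hl,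
    fun t i ht hti hi => ?_⟩
  · rcases eq_or_ne i p with rfl | hip
    · exact h
    · rw [show i = p + 1 by omega]
  · rw [show t = p by omega, show i = p + 1 by omega]
    exact le_max_right _ _

/-- The values at `p` exceed all later ones: `x2` need not be changed, as increases from `p` are
negative. -/
theorem step_lt (h : IsPeak M (p + 1) xs x1 x2 b1 b2) (hlt : M x1 < M p) :
    IsPeak M p xs p x2 (M p) b2 := by
  have h1 := h.le_x1
  have h2 := h.x1_le
  have h3 := h.lt_x2
  refine ⟨le_rfl, by omega, by omega, h.x2_le, fun i hi hi' => ?_, Or.inl ⟨rfl, rfl⟩, ?_,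
    fun t i ht hti hi => ?_⟩
  · rcases eq_or_ne i p with rfl | hip
    · exact le_rfl
    · exact (h.max_x1 i (by omega) hi').trans hlt.le
  · have := h.least_b2.cons
    obtain ⟨⟨t, t1, t2, t3⟩, -⟩ := h.least_b2
    have := h.max_x1 t t1 (by have := h.x2_le; omega)
    rwa [min_eq_right (by linarith)] at ‹LeastOver M p x2 _›
  · rcases eq_or_ne t p with rfl | htp
    · have := h.max_x1 i (by omega) hi
      exact le_max_of_le_left (by linarith)
    · exact h.max_x2 t i (by omega) hti hi

theorem least_b1_cons (h : IsPeak M (p + 1) xs x1 x2 b1 b2) (hle : M p ≤ M x1) :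
    LeastOver M p x1 (min (M p) b1) := by
  rcases h.least_b1 with ⟨rfl, rfl⟩ | ⟨h1, h2⟩
  · rw [min_eq_left hle]
    exact ⟨⟨p, le_rfl, by omega, rfl⟩, fun t ht ht' => by rw [show t = p by omega]⟩
  · exact h2.cons

theorem step_x1 (h : IsPeak M (p + 1) xs x1 x2 b1 b2) (hle : M p ≤ M x1)
    (hd : M x2 - min (M p) b2 ≤ M x1 - min (M p) b1) :
    IsPeak M p xs x1 x1 (min (M p) b1) (min (M p) b1) := by
  have h1 := h.le_x1
  refine ⟨by omega, h.x1_le, by omega, h.x1_le, fun i hi hi' => ?_,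
    Or.inr ⟨by omega, h.least_b1_cons hle⟩, h.least_b1_cons hle, fun t i ht hti hi => ?_⟩
  · rcases eq_or_ne i p with rfl | hip
    · exact hle
    · exact h.max_x1 i (by omega) hi'
  · rcases eq_or_ne t p with rfl | htp
    · have := h.max_x1 i (by omega) hi
      have := min_le_left (M t) b1
      exact le_max_of_le_right (by linarith)
    · refine (h.max_x2 t i (by omega) hti hi).trans (max_le_max le_rfl ?_)
      have := min_le_right (M p) b2
      linarith

theorem step_x2 (h : IsPeak M (p + 1) xs x1 x2 b1 b2) (hle : M p ≤ M x1)
    (hd : M x1 - min (M p) b1 ≤ M x2 - min (M p) b2) :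
    IsPeak M p xs x1 x2 (min (M p) b1) (min (M p) b2) := by
  have h1 := h.le_x1
  have h2 := h.lt_x2
  refine ⟨by omega, h.x1_le, by omega, h.x2_le, fun i hi hi' => ?_,
    Or.inr ⟨by omega, h.least_b1_cons hle⟩, h.least_b2.cons, fun t i ht hti hi => ?_⟩
  · rcases eq_or_ne i p with rfl | hip
    · exact hle
    · exact h.max_x1 i (by omega) hi'
  · rcases eq_or_ne t p with rfl | htp
    · have := h.max_x1 i (by omega) hi
      have := min_le_left (M t) b1
      exact le_max_of_le_right (by linarith)
    · refine (h.max_x2 t i (by omega) hti hi).trans (max_le_max le_rfl ?_)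
      have := min_le_right (M p) b2
      linarith

end IsPeak

open Timed Preprocessing in
theorem Preprocessing.peakArrays_val {n : ℕ} {O : Mem ℕ} {P : IntervalPartition}
    (hP : IsPartition n O P) {M : Mem ℝ} {X : Mem ℕ}
    (hX : ∀ k < P.ell, P.first k ≤ X k ∧ X k ≤ P.last k)
    (hM : ∀ k < P.ell, ∀ p, P.first k ≤ p → p + 1 = X k → M p ≤ M (p + 1)) {p : ℕ} (hp : p < n)
    (hpX : p < X (P.idx p)) :
    IsPeak M p (X (P.idx p)) ((peakArrays n P M X).val.1 p) ((peakArrays n P M X).val.2.1 p)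
      ((peakArrays n P M X).val.2.2.1 p) ((peakArrays n P M X).val.2.2.2 p) := by
  unfold peakArrays
  refine forDown_induct (fun m (s : Mem ℕ × Mem ℕ × Mem ℝ × Mem ℝ) => ∀ p, m ≤ p → p < n →
    p < X (P.idx p) → IsPeak M p (X (P.idx p)) (s.1 p) (s.2.1 p) (s.2.2.1 p) (s.2.2.2 p)) n
    (by intro p h h'; omega) ?_ p (Nat.zero_le _) hp hpX
  rintro i hi ⟨X1, X2, B1, B2⟩ h p hp hpn hpX
  simp only [bind_val, eq_val, lt_val, le_val, ite_val, read_val, write_val, add_val, sub_val,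
    decide_eq_true_eq, minOf_val, pure_val]
  rcases eq_or_ne p i with rfl | hpi
  · have hk := hP.idx_lt p hi
    have hf := hP.first_le p hi
    have hXk := hX _ hk
    rw [if_neg (by omega)]
    split_ifs with h1 h2 h3
    · simp only [Function.update_self]
      rw [← h1]
      exact IsPeak.base (hM _ hk p hf h1)
    all_goals
      have hln := hP.last_lt _ hk
      have hidx := hP.idx_eq _ hk (p + 1) (by omega) (by omega)
      have hpk := h (p + 1) le_rfl (by omega) (by rw [hidx]; omega)
      rw [hidx] at hpk
      simp only [Function.update_self]
    · exact hpk.step_lt h2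
    · exact hpk.step_x1 (not_lt.1 h2) h3
    · exact hpk.step_x2 (not_lt.1 h2) (not_le.1 h3).le
  · have := h p (by omega) hpn hpX
    split_ifs <;> simpa [hpi] using this

/-! ### The structure of the intervals -/

/-- `f i` is the leftmost position in `[i + 1, i + n]` with the least prefix sum. -/
def IsLeftmostMin (n : ℕ) (A : Mem ℝ) (f : ℕ → ℕ) : Prop :=
  ∀ i, i + 1 ≤ f i ∧ f i ≤ i + n ∧
    (∀ u, i + 1 ≤ u → u ≤ i + n → periodicSum n A (f i) ≤ periodicSum n A u) ∧
    ∀ u, i + 1 ≤ u → u < f i → periodicSum n A (f i) < periodicSum n A u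

namespace IsLeftmostMin

variable {n : ℕ} {A : Mem ℝ} {f : ℕ → ℕ}

theorem le_succ (h : IsLeftmostMin n A f) (i : ℕ) : f i ≤ f (i + 1) := by
  by_contra hlt
  obtain ⟨h1, h2, h3, h4⟩ := h i
  obtain ⟨g1, g2, g3, g4⟩ := h (i + 1)
  have := g3 (f i) (by omega) (by omega)
  have := h4 (f (i + 1)) (by omega) (by omega)
  linarith

theorem mono (h : IsLeftmostMin n A f) : Monotone f := monotone_nat_of_le_succ h.le_succ

theorem add_period (h : IsLeftmostMin n A f) (i : ℕ) : f (i + n) = f i + n := by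
  obtain ⟨h1, h2, h3, h4⟩ := h i
  obtain ⟨g1, g2, g3, g4⟩ := h (i + n)
  obtain ⟨g, hg⟩ : ∃ g, f (i + n) = g + n := ⟨f (i + n) - n, by omega⟩
  rw [hg] at g1 g2 g3 g4 ⊢
  rcases lt_trichotomy g (f i) with h5 | h5 | h5
  · have := h4 g (by omega) h5
    have := g3 (f i + n) (by omega) (by omega)
    rw [periodicSum_add_period, periodicSum_add_period] at this
    linarith
  · rw [h5]
  · have := h3 g (by omega) (by omega)
    have := g4 (f i + n) (by omega) (by omega)
    rw [periodicSum_add_period, periodicSum_add_period] at this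
    linarith

/-- If the sum is negative, then the minimum changes only in favour of the position which enters the
window. -/
theorem eq_of_ne_of_neg (h : IsLeftmostMin n A f) (hneg : periodicSum n A n < 0) {i : ℕ}
    (hne : f i ≠ f (i + 1)) : f (i + 1) = i + n + 1 := by
  obtain ⟨h1, h2, h3, h4⟩ := h i
  obtain ⟨g1, g2, g3, g4⟩ := h (i + 1)
  have hle := h.le_succ i
  by_contra hne'
  have h5 := h3 (f (i + 1)) (by omega) (by omega)
  rcases eq_or_ne (f i) (i + 1) with h6 | h6
  · have h7 := g3 (i + 1 + n) (by omega) (by omega)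
    rw [periodicSum_add_period] at h7
    rw [h6] at h5
    linarith
  · have := g4 (f i) (by omega) (by omega)
    linarith

/-- If the sum is not negative, then the minimum changes only when its position leaves the window.
-/
theorem eq_of_ne_of_nonneg (h : IsLeftmostMin n A f) (hpos : 0 ≤ periodicSum n A n) {i : ℕ}
    (hne : f i ≠ f (i + 1)) : f i = i + 1 := by
  obtain ⟨h1, h2, h3, h4⟩ := h i
  obtain ⟨g1, g2, g3, g4⟩ := h (i + 1)
  have hle := h.le_succ i
  by_contra hne'
  have h5 := g4 (f i) (by omega) (by omega)
  rcases lt_or_ge (f (i + 1)) (i + 1 + n) with h6 | h6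
  · have := h3 (f (i + 1)) (by omega) (by omega)
    linarith
  · have h7 : f (i + 1) = i + 1 + n := by omega
    have h8 := h3 (i + 1) (by omega) (by omega)
    rw [h7, periodicSum_add_period] at h5
    linarith

end IsLeftmostMin

/-- The shape of the intervals of a sequence of type 2: the prefix sums at the beginnings of the
intervals are the strict records, and the maximal sum at an element is the sum of the elements of
its interval up to it. -/
structure HasNegativeIntervals (n : ℕ) (A M : Mem ℝ) (P : IntervalPartition) : Prop where
  MCS_eq : ∀ k < P.ell, ∀ i, P.first k ≤ i → i ≤ P.last k →
    M i = periodicSum n A (i + 1) - periodicSum n A (P.first k)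
  first_le : ∀ k < P.ell, ∀ u ≤ P.last k, periodicSum n A (P.first k) ≤ periodicSum n A u
  last_lt : ∀ k < P.ell, ∀ u ≤ P.last k, periodicSum n A (P.last k + 1) < periodicSum n A u

/-- The shape of the intervals of a sequence of type 3: the prefix sum at the end of an interval is
the least of the following period, and a subsequence of greatest sum which ends at an element of an
interval begins right after the interval. -/
structure HasNonnegIntervals (n : ℕ) (A M : Mem ℝ) (P : IntervalPartition) : Prop where
  MCS_eq : ∀ k < P.ell, ∀ i, P.first k ≤ i → i ≤ P.last k →
    M i = periodicSum n A (i + n + 1) - periodicSum n A (P.last k + 1)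
  last_le : ∀ k < P.ell, ∀ u, P.last k + 1 ≤ u → u ≤ P.last k + n →
    periodicSum n A (P.last k + 1) ≤ periodicSum n A u

/-- The condition on `OMCS` which the circular shift establishes: the first interval does not extend
circularly to the left of index `0`. -/
def IsAligned (n : ℕ) (O : Mem ℕ) : Prop :=
  O (n - 1) ≠ O 0 ∨ ∀ i < n, O i = 0

section

variable {n : ℕ} {A M : Mem ℝ} {O : Mem ℕ} {P : IntervalPartition}

/-- For an aligned sequence, the interval partition is that into maximal runs on which the position
of the minimum is the same, not only modulo `n`. -/
theorem IsAligned.leftmostMin {f : ℕ → ℕ} (hf : IsLeftmostMin n A f) (hn : 0 < n)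
    (hfO : ∀ i, O (i % n) = f i % n) (ha : IsAligned n O) :
    f (n - 1) ≠ f n ∧ ∀ i, i + 1 < n → O i = O (i + 1) → f i = f (i + 1) := by
  rcases ha with ha | ha
  · have hne : f (n - 1) ≠ f n := by
      intro h
      have h1 := hfO (n - 1)
      have h2 := hfO n
      rw [Nat.mod_eq_of_lt (by omega), h, ← h2, Nat.mod_self] at h1
      exact ha h1
    refine ⟨hne, fun i hi h => ?_⟩
    have h1 := hfO i
    have h2 := hfO (i + 1)
    rw [Nat.mod_eq_of_lt (by omega)] at h1 h2
    rw [h1, h2] at h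
    obtain ⟨h3, h4, -⟩ := hf i
    obtain ⟨h5, h6, -⟩ := hf (i + 1)
    have hle := hf.le_succ i
    by_contra hne'
    have hdvd : n ∣ f (i + 1) - f i := (Nat.modEq_iff_dvd' hle).1 h
    obtain ⟨c, hc⟩ := hdvd
    have hc1 : 1 ≤ c := by
      rcases Nat.eq_zero_or_pos c with rfl | h
      · omega
      · exact h
    have hnc : n ≤ n * c := Nat.le_mul_of_pos_right n hc1
    -- a jump by a whole period makes `f` constant on `[i + 1, i + n]`
    have h7 : f (i + 1) = f i + n := by omega
    rw [← hf.add_period] at h7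
    have h8 := hf.mono (show i + 1 ≤ n - 1 by omega)
    have h9 := hf.mono (show n - 1 ≤ n by omega)
    have h10 := hf.mono (show n ≤ i + n by omega)
    omega
  · have hi : ∀ i < n, f i = n := by
      intro i hi
      have h1 := hfO i
      rw [Nat.mod_eq_of_lt hi, ha i hi] at h1
      obtain ⟨h3, h4, -⟩ := hf i
      obtain ⟨c, hc⟩ := Nat.dvd_of_mod_eq_zero h1.symm
      have hc1 : c = 1 := by
        rcases Nat.lt_or_ge c 1 with h | h
        · obtain rfl : c = 0 := by omega
          omega
        · rcases Nat.lt_or_ge 1 c with h' | h'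
          · have := Nat.mul_le_mul_left n h'
            omega
          · omega
      rw [hc, hc1, mul_one]
    refine ⟨?_, fun i h _ => by rw [hi i (by omega), hi (i + 1) h]⟩
    have := hf.add_period 0
    rw [zero_add] at this
    rw [hi (n - 1) (by omega), this]
    have := hi 0 hn
    omega

/-- The position of the minimum is constant on each interval and changes at its ends. -/
theorem IsPartition.leftmostMin {f : ℕ → ℕ} (hP : IsPartition n O P) (hf : IsLeftmostMin n A f)
    (hfO : ∀ i, O (i % n) = f i % n) (ha : IsAligned n O) {k : ℕ} (hk : k < P.ell) :
    (∀ i, P.first k ≤ i → i ≤ P.last k → f i = f (P.first k)) ∧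
    f (P.last k) ≠ f (P.last k + 1) ∧ f (P.first k + n - 1) ≠ f (P.first k + n) := by
  have hlt := hP.last_lt k hk
  obtain ⟨h1, h2⟩ := ha.leftmostMin hf (by omega) hfO
  have hO : ∀ i, i < n → O i = f i % n := fun i hi => by rw [← hfO, Nat.mod_eq_of_lt hi]
  have hlast : ∀ k < P.ell, f (P.last k) ≠ f (P.last k + 1) := by
    intro k hk h
    have hlt := hP.last_lt k hk
    rcases eq_or_ne (k + 1) P.ell with hkl | hkl
    · have := hP.last_ell k hkl
      rw [this, show P.last k = n - 1 by omega] at h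
      exact h1 h
    · have h3 := hP.first_succ k (by omega)
      have h4 := hP.first_le_last (k + 1) (by omega)
      have h5 := hP.last_lt (k + 1) (by omega)
      apply hP.ne k (by omega)
      rw [hO _ hlt, hO _ (by omega), h]
  refine ⟨fun i hi hi' => ?_, hlast k hk, ?_⟩
  · induction i, hi using Nat.le_induction with
    | base => rfl
    | succ i hi ih =>
      rw [← ih (by omega)]
      exact (h2 i (by omega) (hP.eq k hk i hi (by omega))).symm
  · rcases Nat.eq_zero_or_pos k with rfl | hk0
    · rw [hP.first_zero (by omega), zero_add]
      exact h1
    · have h3 := hP.first_succ (k - 1) (by omega)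
      have h4 := hlast (k - 1) (by omega)
      rw [Nat.sub_add_cancel (by omega)] at h3
      intro h
      apply h4
      rw [← h3]
      rw [hf.add_period, show P.first k + n - 1 = P.last (k - 1) + n by omega, hf.add_period] at h
      omega

/-- A sequence whose sum is negative is of type 2. -/
theorem hasNegativeIntervals (hP : IsPartition n O P) (hM : IsMaxCircSums n A M O)
    (ha : IsAligned n O) (hneg : periodicSum n A n < 0) : HasNegativeIntervals n A M P := by
  choose f h1 h2 h3 h4 h5 h6 using hM
  have hf : IsLeftmostMin n A f := fun i => ⟨h1 i, h2 i, h3 i, h4 i⟩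
  have hfirst : ∀ k < P.ell, ∀ i, P.first k ≤ i → i ≤ P.last k → f i = P.first k + n := by
    intro k hk i hi hi'
    obtain ⟨g1, g2, g3⟩ := hP.leftmostMin hf h6 ha hk
    have hlt := hP.last_lt k hk
    have e : P.first k + n - 1 + 1 = P.first k + n := by omega
    have := hf.eq_of_ne_of_neg hneg (i := P.first k + n - 1) (by rwa [e])
    rw [e, hf.add_period] at this
    rw [g1 i hi hi']
    omega
  have hlast : ∀ k < P.ell, f (P.last k + 1) = P.last k + n + 1 := fun k hk =>
    hf.eq_of_ne_of_neg hneg (hP.leftmostMin hf h6 ha hk).2.1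
  refine ⟨fun k hk i hi hi' => ?_, fun k hk u hu => ?_, fun k hk u hu => ?_⟩
  · have := h5 i
    have hlt := hP.last_lt k hk
    rw [Nat.mod_eq_of_lt (by omega), hfirst k hk i hi hi'] at this
    rw [this, show i + n + 1 = i + 1 + n by ring, periodicSum_add_period, periodicSum_add_period]
    ring
  · have hlt := hP.last_lt k hk
    have := h3 (P.last k) (u + n) (by omega) (by omega)
    rw [hfirst k hk _ (hP.first_le_last k hk) le_rfl, periodicSum_add_period,
      periodicSum_add_period] at this
    linarith
  · have hlt := hP.last_lt k hk
    have e := hlast k hk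
    rcases eq_or_ne (u + n) (P.last k + 1) with h | h
    · rw [← h, periodicSum_add_period]
      linarith
    · have := h4 (P.last k + 1) (u + n) (by omega) (by omega)
      rw [e, show P.last k + n + 1 = P.last k + 1 + n by ring, periodicSum_add_period,
        periodicSum_add_period] at this
      linarith

/-- A sequence whose sum is not negative is of type 3. -/
theorem hasNonnegIntervals (hP : IsPartition n O P) (hM : IsMaxCircSums n A M O)
    (ha : IsAligned n O) (hpos : 0 ≤ periodicSum n A n) : HasNonnegIntervals n A M P := by
  choose f h1 h2 h3 h4 h5 h6 using hM
  have hf : IsLeftmostMin n A f := fun i => ⟨h1 i, h2 i, h3 i, h4 i⟩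
  have hlast : ∀ k < P.ell, ∀ i, P.first k ≤ i → i ≤ P.last k → f i = P.last k + 1 := by
    intro k hk i hi hi'
    obtain ⟨g1, g2, g3⟩ := hP.leftmostMin hf h6 ha hk
    rw [g1 i hi hi', ← g1 _ (hP.first_le_last k hk) le_rfl]
    exact hf.eq_of_ne_of_nonneg hpos g2
  refine ⟨fun k hk i hi hi' => ?_, fun k hk u hu hu' => ?_⟩
  · have := h5 i
    have hlt := hP.last_lt k hk
    rw [Nat.mod_eq_of_lt (by omega), hlast k hk i hi hi'] at this
    exact this
  · have := h3 (P.last k) u hu hu'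
    rwa [hlast k hk _ (hP.first_le_last k hk) le_rfl] at this

/-- Sums of circular subsequences are bounded by `MCS` at their last elements. -/
theorem IsMaxCircSums.le (hM : IsMaxCircSums n A M O) {u v : ℕ} (huv : u < v) (hv : v ≤ u + n) :
    periodicSum n A v - periodicSum n A u ≤ M ((v - 1) % n) := by
  obtain ⟨f, h1, h2, h3, h4, h5, h6⟩ := hM (v - 1)
  rw [h5, show v - 1 + n + 1 = v + n by omega, periodicSum_add_period]
  have := h3 (u + n) (by omega) (by omega)
  rw [periodicSum_add_period] at this
  linarith

theorem IsMaxCircSums.exists_eq (hM : IsMaxCircSums n A M O) {v : ℕ} (hn : 0 < n) (hv : n ≤ v) :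
    ∃ u, u < v ∧ v ≤ u + n ∧ M ((v - 1) % n) = periodicSum n A v - periodicSum n A u := by
  obtain ⟨f, h1, h2, h3, h4, h5, h6⟩ := hM (v - 1)
  refine ⟨f - n, by omega, by omega, ?_⟩
  have := periodicSum_add_period n A (f - n)
  rw [Nat.sub_add_cancel (by omega)] at this
  rw [h5, show v - 1 + n + 1 = v + n by omega, periodicSum_add_period, this]
  ring

/-- The algorithm's test for type 2 amounts to that for a negative sum. -/
theorem exists_neg_iff (hP : IsPartition n O P) (hn : 0 < n) (hM : IsMaxCircSums n A M O)
    (ha : IsAligned n O) : (∃ i < n, M i < 0) ↔ periodicSum n A n < 0 := by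
  constructor
  · rintro ⟨i, hi, h⟩
    have := hM.le (u := i + 1) (v := i + 1 + n) (by omega) le_rfl
    rw [periodicSum_add_period, show i + 1 + n - 1 = i + n by omega, Nat.add_mod_right,
      Nat.mod_eq_of_lt hi] at this
    linarith
  · intro h
    have hell := hP.ell_pos hn
    have hI := hasNegativeIntervals hP hM ha h
    have h0 := hP.first_le_last 0 hell
    refine ⟨P.last 0, hP.last_lt 0 hell, ?_⟩
    rw [hI.MCS_eq 0 hell _ h0 le_rfl]
    have := hI.last_lt 0 hell (P.first 0) h0
    linarith

/-! ### Rotations -/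

theorem periodicSum_rotate (hn : 0 < n) {A' : Mem ℝ} {c : ℕ} (hA : ∀ i < n, A' i = A ((i + c) % n))
    (t : ℕ) : periodicSum n A' t = periodicSum n A (t + c) - periodicSum n A c := by
  induction t with
  | zero => simp
  | succ t ih =>
    rw [periodicSum_succ, ih, hA _ (Nat.mod_lt t hn), Nat.mod_add_mod,
      show t + 1 + c = t + c + 1 by ring, periodicSum_succ]
    ring

theorem IsMaxCircSums.rotate (hn : 0 < n) (hM : IsMaxCircSums n A M O) {A' M' : Mem ℝ}
    {O' : Mem ℕ} {c : ℕ} (hc : c < n) (hA' : ∀ i < n, A' i = A ((i + c) % n))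
    (hM' : ∀ i < n, M' i = M ((i + c) % n)) (hO' : ∀ i < n, O' i = (O ((i + c) % n) + n - c) % n) :
    IsMaxCircSums n A' M' O' := by
  intro i
  obtain ⟨f, h1, h2, h3, h4, h5, h6⟩ := hM (i + c)
  obtain ⟨g, rfl⟩ : ∃ g, f = g + c := ⟨f - c, by omega⟩
  have hr := periodicSum_rotate hn hA'
  refine ⟨g, by omega, by omega, fun u hu hu' => ?_, fun u hu hu' => ?_, ?_, ?_⟩
  · rw [hr, hr]
    linarith [h3 (u + c) (by omega) (by omega)]
  · rw [hr, hr]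
    linarith [h4 (u + c) (by omega) (by omega)]
  · rw [hM' _ (Nat.mod_lt i hn), Nat.mod_add_mod, h5, hr, hr,
      show i + n + 1 + c = i + c + n + 1 by ring]
    ring
  · rw [hO' _ (Nat.mod_lt i hn), Nat.mod_add_mod, h6, ← Nat.mod_add_mod g]
    have hg := Nat.mod_lt g hn
    rcases lt_or_ge (g % n + c) n with h | h
    · rw [Nat.mod_eq_of_lt h, show g % n + c + n - c = g % n + n by omega, Nat.add_mod_right,
        Nat.mod_mod]
    · rw [Nat.mod_eq_sub_mod h, Nat.mod_eq_of_lt (show g % n + c - n < n by omega),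
        show g % n + c - n + n - c = g % n by omega, Nat.mod_mod]

theorem IsMaxCircSums.OMCS_lt (hM : IsMaxCircSums n A M O) {i : ℕ} (hi : i < n) : O i < n := by
  obtain ⟨f, -, -, -, -, -, h⟩ := hM i
  rw [Nat.mod_eq_of_lt hi] at h
  rw [h]
  exact Nat.mod_lt _ (by omega)

open Preprocessing Timed in
theorem findShift_lt (hn : 0 < n) (hM : IsMaxCircSums n A M O) : (findShift n O).val < n := by
  rcases findShift_val (n := n) O with h | h
  · exact h.1
  · rw [h.1]
    exact hM.OMCS_lt hn

open Preprocessing Timed in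
/-- The circular shift aligns the sequence. -/
theorem isAligned_rotate (hn : 0 < n) (hM : IsMaxCircSums n A M O) {O' : Mem ℕ}
    (hO' : ∀ i < n, O' i = (O ((i + (findShift n O).val) % n) + n - (findShift n O).val) % n) :
    IsAligned n O' := by
  have hlt := findShift_lt hn hM
  rcases findShift_val (n := n) O with ⟨-, h⟩ | ⟨h1, h2⟩
  · left
    generalize (findShift n O).val = c at *
    rw [hO' _ (by omega), hO' 0 hn, zero_add, Nat.mod_eq_of_lt hlt,
      show n - 1 + c = c + n - 1 by omega]
    intro h'
    apply h
    have hO1 := hM.OMCS_lt (Nat.mod_lt (c + n - 1) hn)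
    have hO2 := hM.OMCS_lt hlt
    -- subtraction of `c` modulo `n` is injective
    have hinj : ∀ a < n, (a + n - c) % n = if c ≤ a then a - c else a + n - c := by
      intro a ha
      split_ifs with hca
      · rw [show a + n - c = a - c + n by omega, Nat.add_mod_right, Nat.mod_eq_of_lt (by omega)]
      · rw [Nat.mod_eq_of_lt (by omega)]
    rw [hinj _ hO1, hinj _ hO2] at h'
    split_ifs at h' <;> omega
  · right
    have h3 : ∀ i < n, O i = O 0 := by
      intro i hi
      induction i with
      | zero => rfl
      | succ i ih =>
        rw [← h2 (i + 1) hi, ← ih (by omega), show i + 1 + n - 1 = i + n by omega,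
          Nat.add_mod_right, Nat.mod_eq_of_lt (by omega)]
    intro i hi
    rw [hO' i hi, h3 _ (Nat.mod_lt _ hn), h1, Nat.add_sub_cancel_left, Nat.mod_self]

end

/-! ### The sums of circular subsequences after an insertion -/

/-- The sums of the circular subsequences of `A 0, …, A (n - 1)` with `x` inserted at position `p`,
in terms of prefix sums: such a subsequence either lies in the period from `p` to `p + n`, or else
it is the complement of such a subsequence. -/
def insertedSums (n : ℕ) (A : Mem ℝ) (x : ℝ) (p : ℕ) : Set ℝ :=
  {t | ∃ u v, p ≤ u ∧ u ≤ v ∧ v ≤ p + n ∧ (t = periodicSum n A v - periodicSum n A u ∨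
    t = x + periodicSum n A n - (periodicSum n A v - periodicSum n A u))}

section

variable {n : ℕ} {A : Mem ℝ} {x : ℝ} {p : ℕ}

theorem mem_without {u v : ℕ} (h1 : p ≤ u) (h2 : u ≤ v) (h3 : v ≤ p + n) :
    periodicSum n A v - periodicSum n A u ∈ insertedSums n A x p :=
  ⟨u, v, h1, h2, h3, Or.inl rfl⟩

theorem mem_without_shift {u v : ℕ} (h1 : p ≤ u + n) (h2 : u ≤ v) (h3 : v ≤ p) :
    periodicSum n A v - periodicSum n A u ∈ insertedSums n A x p := by
  have h := mem_without (n := n) (A := A) (x := x) (u := u + n) (v := v + n) h1 (by omega)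
    (by omega)
  rw [periodicSum_add_period, periodicSum_add_period] at h
  convert h using 1
  ring

theorem mem_with {u v : ℕ} (h1 : u ≤ p) (h2 : p ≤ v) (h3 : v ≤ u + n) :
    x + (periodicSum n A v - periodicSum n A u) ∈ insertedSums n A x p := by
  refine ⟨v, u + n, h2, h3, by omega, Or.inr ?_⟩
  rw [periodicSum_add_period]
  ring

theorem mem_with_shift {u v : ℕ} (h2 : u ≤ p + n) (h3 : p + n ≤ v) (h4 : v ≤ u + n) :
    x + (periodicSum n A v - periodicSum n A u) ∈ insertedSums n A x p := by
  refine ⟨v - n, u, by omega, by omega, by omega, Or.inr ?_⟩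
  have := periodicSum_add_period n A (v - n)
  rw [Nat.sub_add_cancel (by omega)] at this
  rw [this]
  ring

theorem zero_mem_insertedSums : (0 : ℝ) ∈ insertedSums n A x p :=
  ⟨p, p, le_rfl, le_rfl, by omega, Or.inl (by simp)⟩

theorem x_mem_insertedSums : x ∈ insertedSums n A x p :=
  ⟨p, p + n, le_rfl, by omega, le_rfl, Or.inr (by rw [periodicSum_add_period]; ring)⟩

theorem max_mem {S : Set ℝ} {a b : ℝ} (ha : a ∈ S) (hb : b ∈ S) : max a b ∈ S := by
  rcases max_choice a b with h | h <;> rw [h] <;> assumption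

theorem add_max_zero_mem {S : Set ℝ} {y a : ℝ} (ha : y ∈ S) (hb : y + a ∈ S) :
    y + max 0 a ∈ S := by
  rcases max_choice 0 a with h | h <;> rw [h]
  · rwa [add_zero]
  · exact hb

end

namespace IsPartition

variable {n : ℕ} {O : Mem ℕ} {P : IntervalPartition}

theorem last_lt_first_idx (hP : IsPartition n O P) {k j : ℕ} (hk : k < P.ell) (hj : j < n)
    (h : P.last k < j) : P.last k < P.first (P.idx j) := by
  by_contra hlt
  have h1 := hP.idx_eq _ (hP.idx_lt j hj) (P.last k) (by omega) (by have := hP.le_last j hj; omega)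
  rw [hP.idx_eq k hk _ (hP.first_le_last k hk) le_rfl] at h1
  have := hP.le_last j hj
  rw [← h1] at this
  omega

theorem last_idx_lt_first (hP : IsPartition n O P) {k j : ℕ} (hk : k < P.ell) (hj : j < n)
    (h : j < P.first k) : P.last (P.idx j) < P.first k := by
  by_contra hlt
  have h1 := hP.idx_eq _ (hP.idx_lt j hj) (P.first k) (by have := hP.first_le j hj; omega)
    (by omega)
  rw [hP.idx_eq k hk _ le_rfl (hP.first_le_last k hk)] at h1
  have := hP.first_le j hj
  rw [← h1] at this
  omega

theorem first_le_of_ell_le_one (hP : IsPartition n O P) {k : ℕ} (hk : k < P.ell)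
    (h : P.ell ≤ 1) : P.first k = 0 ∧ P.last k + 1 = n := by
  obtain rfl : k = 0 := by omega
  have := hP.last_lt 0 hk
  exact ⟨hP.first_zero (by omega), hP.last_ell 0 (by omega)⟩

end IsPartition

/-! ### Correctness of the query-answering algorithm -/

/-- The auxiliary data which is common to types 2 and 3 is that of the sequence `A`, for which `O`
is `OMCS`. -/
structure IsAuxData (n : ℕ) (A : Mem ℝ) (O : Mem ℕ) (D : AuxData) : Prop where
  n_pos : 0 < n
  n_eq : D.n = n
  total : D.total = periodicSum n A n
  partition : IsPartition n O D.part
  MCS : IsMaxCircSums n A D.MCS O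
  IS : ∀ k < D.part.ell,
    D.IS k = periodicSum n A (D.part.last k + 1) - periodicSum n A (D.part.first k)
  IMCS : ∀ k < D.part.ell, GreatestOver D.MCS (D.part.first k) (D.part.last k + 1) (D.IMCS k)
  IOMCS : 1 < D.part.ell → ∀ k < D.part.ell,
    GreatestOver (fun i => D.MCS (i % n)) (D.part.last k + 1) (D.part.first k + n) (D.IOMCS k)
  IRCS : 1 < D.part.ell → ∀ k < D.part.ell,
    GreatestOver (fun v => periodicSum n A (v + 1) - periodicSum n A (D.part.last k + 1))
      (D.part.last k + 1) (D.part.first k + n) (D.IRCS k)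
  SFMCS : ∀ p < n, GreatestOver D.MCS p (D.part.last (D.part.idx p) + 1) (D.SFMCS p)
  PFMCS : ∀ p < n, D.part.first (D.part.idx p) < p →
    GreatestOver D.MCS (D.part.first (D.part.idx p)) p (D.PFMCS p)
  PFSF : ∀ p < n, D.part.first (D.part.idx p) < p →
    (∃ u v, D.part.first (D.part.idx p) < u ∧ u ≤ v ∧ v ≤ p ∧
      D.PFSF p = periodicSum n A v - periodicSum n A u) ∧
    ∀ u v, D.part.first (D.part.idx p) < u → u ≤ v → v ≤ p →
      D.PFSF p ≤ periodicSum n A v - periodicSum n A u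

/-- The auxiliary data for type 3. -/
structure IsAuxData3 (n : ℕ) (A : Mem ℝ) (O : Mem ℕ) (D : AuxData) : Prop
    extends IsAuxData n A O D where
  nonneg : 0 ≤ periodicSum n A n
  intervals : HasNonnegIntervals n A D.MCS D.part
  PFRMMS : ∀ p < n, (∃ u v, p ≤ u ∧ u ≤ v ∧ v ≤ D.part.first (D.part.idx p) + n ∧
      D.PFRMMS p = periodicSum n A v - periodicSum n A u) ∧
    ∀ u v, p ≤ u → u ≤ v → v ≤ D.part.first (D.part.idx p) + n →
      periodicSum n A v - periodicSum n A u ≤ D.PFRMMS p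
  PFRMMCS : ∀ p < n,
    GreatestOver (fun i => D.MCS (i % n)) p (D.part.first (D.part.idx p) + n) (D.PFRMMCS p)

/-- The auxiliary data for type 2. -/
structure IsAuxData2 (n : ℕ) (A : Mem ℝ) (O : Mem ℕ) (D : AuxData) : Prop
    extends IsAuxData n A O D where
  intervals : HasNegativeIntervals n A D.MCS D.part
  PRVMS : ∀ p < n, 0 ≤ D.PRVMS p ∧ (∀ i < p, D.MCS i ≤ D.PRVMS p) ∧
    (D.PRVMS p = 0 ∨ ∃ i < p, D.PRVMS p = D.MCS i)
  INXTMS : ∀ k, k + 1 < D.part.ell → GreatestOver D.MCS (D.part.last k + 1) n (D.INXTMS k)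
  IXs : ∀ k < D.part.ell, D.part.first k ≤ D.IXs k ∧ D.IXs k ≤ D.part.last k ∧
    ∀ i, D.IXs k < i → i ≤ D.part.last k → A i ≤ 0
  peak : ∀ p < n, p < D.IXs (D.part.idx p) →
    IsPeak D.MCS p (D.IXs (D.part.idx p)) (D.X1 p) (D.X2 p) (D.BX1 p) (D.BX2 p)

namespace IsAuxData3

variable {n : ℕ} {A : Mem ℝ} {O : Mem ℕ} {D : AuxData} {x : ℝ} {p : ℕ}

/-- The subsequence of greatest sum which ends at `j` contains the gap at `p`, unless `p` is after
`j` and at most at the end of the interval of `j`. -/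
theorem add_MCS_mem (hD : IsAuxData3 n A O D) (hp : p < n) {j : ℕ} (hj : j < n)
    (h : p ≤ j ∨ D.part.last (D.part.idx j) < p) : x + D.MCS j ∈ insertedSums n A x p := by
  have hP := hD.partition
  have hk := hP.idx_lt j hj
  have h1 := hP.le_last j hj
  have h2 := hP.last_lt _ hk
  rw [hD.intervals.MCS_eq _ hk j (hP.first_le j hj) h1]
  rcases lt_or_ge (D.part.last (D.part.idx j)) p with h3 | h3
  · exact mem_with (by omega) (by omega) (by omega)
  · exact mem_with_shift (by omega) (by omega) (by omega)

theorem PFMCS_mem (hD : IsAuxData3 n A O D) (hp : p < n) (hf : D.part.first (D.part.idx p) < p) :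
    D.PFMCS p ∈ insertedSums n A x p := by
  have hP := hD.partition
  have hk := hP.idx_lt p hp
  have hl := hP.le_last p hp
  have hln := hP.last_lt _ hk
  obtain ⟨⟨i, i1, i2, i3⟩, -⟩ := hD.PFMCS p hp hf
  rw [← i3, hD.intervals.MCS_eq _ hk i i1 (by omega)]
  exact mem_without (by omega) (by omega) (by omega)

/-- The terms `x + IOMCS[k]` and `x + PFRMMCS[p]` are maxima over elements circularly from `a ≥ p`
on to before interval `k`. -/
theorem add_greatest_mem (hD : IsAuxData3 n A O D) (hp : p < n) {a k : ℕ} {m : ℝ}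
    (hk : k < D.part.ell) (hfp : D.part.first k ≤ p) (ha : p ≤ a)
    (h : GreatestOver (fun i => D.MCS (i % n)) a (D.part.first k + n) m) :
    x + m ∈ insertedSums n A x p := by
  have hP := hD.partition
  obtain ⟨⟨i, i1, i2, rfl⟩, -⟩ := h
  apply hD.add_MCS_mem hp (Nat.mod_lt i hD.n_pos)
  rcases lt_or_ge i n with h | h
  · rw [Nat.mod_eq_of_lt h]
    left
    omega
  · rw [Nat.mod_eq_sub_mod h, Nat.mod_eq_of_lt (by omega)]
    right
    have := hP.last_idx_lt_first (j := i - n) hk (by omega) (by omega)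
    omega

end IsAuxData3

namespace IsAuxData2

variable {n : ℕ} {A : Mem ℝ} {O : Mem ℕ} {D : AuxData} {x : ℝ} {p : ℕ}

theorem MCS_mem_of_lt (hD : IsAuxData2 n A O D) (hp : p < n) {j : ℕ} (hj : j < p) :
    D.MCS j ∈ insertedSums n A x p := by
  have hP := hD.partition
  have hk := hP.idx_lt j (by omega)
  have h1 := hP.first_le j (by omega)
  rw [hD.intervals.MCS_eq _ hk j h1 (hP.le_last j (by omega))]
  exact mem_without_shift (by omega) (by omega) (by omega)

theorem MCS_mem_of_last_lt (hD : IsAuxData2 n A O D) (hp : p < n) {j : ℕ} (hj : j < n)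
    (h : D.part.last (D.part.idx p) < j) : D.MCS j ∈ insertedSums n A x p := by
  have hP := hD.partition
  have hk := hP.idx_lt j (by omega)
  have h1 := hP.first_le j (by omega)
  have h2 := hP.last_lt_first_idx (hP.idx_lt p hp) hj h
  have h3 := hP.le_last p hp
  rw [hD.intervals.MCS_eq _ hk j h1 (hP.le_last j (by omega))]
  exact mem_without (by omega) (by omega) (by omega)

/-- The prefix sum at the beginning of an interval, shifted by a period, is a lower bound of those
up to the end of the shifted interval. -/
theorem periodicSum_first_le (hD : IsAuxData2 n A O D) {k : ℕ} (hk : k < D.part.ell) {v : ℕ}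
    (hv : v ≤ D.part.last k + n) :
    periodicSum n A (D.part.first k) + periodicSum n A n ≤ periodicSum n A v := by
  have hP := hD.partition
  rcases lt_or_ge v n with h | h
  · have hn := hP.last_lt k hk
    have h1 := hP.last_ell (D.part.ell - 1) (by omega)
    have h2 := hD.intervals.last_lt (D.part.ell - 1) (by omega) v (by omega)
    have h3 := hD.intervals.first_le k hk 0 (Nat.zero_le _)
    rw [h1] at h2
    rw [periodicSum_zero] at h3
    linarith
  · have h1 := hD.intervals.first_le k hk (v - n) (by omega)
    have := periodicSum_add_period n A (v - n)
    rw [Nat.sub_add_cancel h] at this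
    linarith

end IsAuxData2

namespace Query

open Timed

variable {n : ℕ} {A : Mem ℝ} {O : Mem ℕ} {D : AuxData} {x : ℝ} {p : ℕ}

theorem nonneg_val (D : AuxData) (b : Bool) (x : ℝ) (p : ℕ) (hn : 0 < D.n) (hp : p < D.n) :
    (nonneg D b x p).val =
    let k := D.part.idx p
    let r := max (x + max 0 (D.MCS ((p + D.n - 1) % D.n))) (x + D.SFMCS p)
    let r := if 1 < D.part.ell then
        if b = true then max (max r (D.IOMCS k)) (x + (D.IS k + D.IRCS k))
        else max r (x + D.IOMCS k)
      else r
    if D.part.first k < p then max (max r (D.PFMCS p)) (x + (D.total - D.PFSF p)) else r := by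
  unfold nonneg
  simp only [bind_val, read_val, lt_val, decide_eq_true_eq, ite_val, maxOf_val, add_val, sub_val,
    pure_val, subMod_val hp hn]

/-- The terms for a nonnegative `x` which are common to both types bound all sums of subsequences
that end in the interval of `p` or at the new element. -/
theorem nonneg_upper (hD : IsAuxData n A O D) (hp : p < n) (hx : 0 ≤ x) {r : ℝ}
    (hr1 : x + max 0 (D.MCS ((p + n - 1) % n)) ≤ r) (hr2 : x + D.SFMCS p ≤ r)
    (hr3 : D.part.first (D.part.idx p) < p →
      D.PFMCS p ≤ r ∧ x + (periodicSum n A n - D.PFSF p) ≤ r)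
    (hr4 : ∀ u v, D.part.last (D.part.idx p) + 1 < v → v ≤ D.part.first (D.part.idx p) + n →
      u < v → v ≤ u + n → p ≤ u → periodicSum n A v - periodicSum n A u ≤ r)
    (hr5 : ∀ u v, D.part.last (D.part.idx p) + 1 < u → u ≤ D.part.first (D.part.idx p) + n →
      v < u + n → u ≤ v → v ≤ p + n →
      x + periodicSum n A n - (periodicSum n A v - periodicSum n A u) ≤ r) :
    ∀ t ∈ insertedSums n A x p, t ≤ r := by
  have hP := hD.partition
  have hk := hP.idx_lt p hp
  have hl := hP.le_last p hp
  have hln := hP.last_lt _ hk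
  have hS := (hD.SFMCS p hp).2
  have hxr : x ≤ r := by
    have := le_max_left 0 (D.MCS ((p + n - 1) % n))
    linarith
  -- The last element of a nonempty subsequence is between `p` and the end of the interval of `p`,
  -- in another interval, or in the interval of `p` before `p`.
  rintro t ⟨u, v, huv1, huv2, huv3, rfl | rfl⟩
  · rcases eq_or_ne u v with rfl | huv
    · rw [sub_self]; linarith
    have hM := hD.MCS.le (u := u) (v := v) (by omega) (by omega)
    rcases lt_or_ge (D.part.first (D.part.idx p) + n) v with h1 | h1
    · rw [Nat.mod_eq_sub_mod (by omega), Nat.mod_eq_of_lt (by omega)] at hM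
      have := (hD.PFMCS p hp (by omega)).2 (v - 1 - n) (by omega) (by omega)
      have := hr3 (by omega)
      linarith
    · rcases lt_or_ge (D.part.last (D.part.idx p) + 1) v with h2 | h2
      · exact hr4 u v h2 h1 (by omega) (by omega) huv1
      · rw [Nat.mod_eq_of_lt (by omega)] at hM
        have := hS (v - 1) (by omega) (by omega)
        linarith
  · rcases eq_or_ne v (u + n) with rfl | huv
    · rw [periodicSum_add_period]; linarith
    have hM := hD.MCS.le (u := v) (v := u + n) (by omega) (by omega)
    rw [periodicSum_add_period] at hM
    rcases eq_or_ne u p with rfl | hup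
    · have := le_max_right 0 (D.MCS ((u + n - 1) % n))
      linarith
    · rcases lt_or_ge (D.part.first (D.part.idx p) + n) u with h1 | h1
      · have := (hD.PFSF p hp (by omega)).2 (u - n) (v - n) (by omega) (by omega) (by omega)
        have e1 := periodicSum_add_period n A (u - n)
        have e2 := periodicSum_add_period n A (v - n)
        rw [Nat.sub_add_cancel (by omega)] at e1 e2
        have := hr3 (by omega)
        linarith
      · rcases lt_or_ge (D.part.last (D.part.idx p) + 1) u with h2 | h2
        · exact hr5 u v h2 h1 (by omega) huv2 huv3
        · rw [show u + n - 1 = u - 1 + n by omega, Nat.add_mod_right,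
            Nat.mod_eq_of_lt (by omega)] at hM
          have := hS (u - 1) (by omega) (by omega)
          linarith

theorem add_max_MCS_mem (hD : IsAuxData n A O D) :
    x + max 0 (D.MCS ((p + n - 1) % n)) ∈ insertedSums n A x p := by
  apply add_max_zero_mem x_mem_insertedSums
  obtain ⟨u, h1, h2, h3⟩ := hD.MCS.exists_eq (v := p + n) hD.n_pos (by omega)
  rw [h3]
  exact mem_with_shift (by omega) le_rfl (by omega)

theorem add_sub_PFSF_mem (hD : IsAuxData n A O D) (hp : p < n)
    (hf : D.part.first (D.part.idx p) < p) :
    x + (periodicSum n A n - D.PFSF p) ∈ insertedSums n A x p := by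
  obtain ⟨⟨u, v, h1, h2, h3, h4⟩, -⟩ := hD.PFSF p hp hf
  refine ⟨u + n, v + n, by omega, by omega, by omega, Or.inr ?_⟩
  rw [h4, periodicSum_add_period, periodicSum_add_period]
  ring

theorem nonneg_type2 (hD : IsAuxData2 n A O D) (hp : p < n) (hx : 0 ≤ x) :
    IsGreatest (insertedSums n A x p) (nonneg D true x p).val := by
  have hP := hD.partition
  have hI := hD.intervals
  have hn := hD.n_pos
  have hk := hP.idx_lt p hp
  have hf := hP.first_le p hp
  have hl := hP.le_last p hp
  have hln := hP.last_lt _ hk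
  rw [nonneg_val D true x p (by rw [hD.n_eq]; exact hn) (by rw [hD.n_eq]; exact hp), hD.n_eq,
    hD.total]
  simp only [if_true]
  have hm1 := add_max_MCS_mem (x := x) (p := p) hD.toIsAuxData
  have hm2 : x + D.SFMCS p ∈ insertedSums n A x p := by
    obtain ⟨⟨i, i1, i2, i3⟩, -⟩ := hD.SFMCS p hp
    rw [← i3, hI.MCS_eq _ hk i (by omega) (by omega)]
    exact mem_with hf (by omega) (by omega)
  have hm3 : 1 < D.part.ell → D.IOMCS (D.part.idx p) ∈ insertedSums n A x p := by
    intro hell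
    obtain ⟨⟨i, i1, i2, i3⟩, -⟩ := hD.IOMCS hell _ hk
    simp only at i3
    rw [← i3]
    rcases lt_or_ge i n with h | h
    · rw [Nat.mod_eq_of_lt h]
      exact hD.MCS_mem_of_last_lt hp h (by omega)
    · rw [Nat.mod_eq_sub_mod h, Nat.mod_eq_of_lt (by omega)]
      exact hD.MCS_mem_of_lt hp (by omega)
  have hm4 : 1 < D.part.ell →
      x + (D.IS (D.part.idx p) + D.IRCS (D.part.idx p)) ∈ insertedSums n A x p := by
    intro hell
    obtain ⟨⟨i, i1, i2, i3⟩, -⟩ := hD.IRCS hell _ hk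
    rw [← i3, hD.IS _ hk, add_comm (_ - _), sub_add_sub_cancel]
    exact mem_with hf (by omega) (by omega)
  have hm5 : D.part.first (D.part.idx p) < p → D.PFMCS p ∈ insertedSums n A x p := by
    intro hfp
    obtain ⟨⟨i, i1, i2, i3⟩, -⟩ := hD.PFMCS p hp hfp
    rw [← i3]
    exact hD.MCS_mem_of_lt hp i2
  have hm6 := add_sub_PFSF_mem (x := x) hD.toIsAuxData hp
  constructor
  · split_ifs with h1 h2 h2
    · exact max_mem (max_mem (max_mem (max_mem (max_mem hm1 hm2) (hm3 h2)) (hm4 h2)) (hm5 h1))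
        (hm6 h1)
    · exact max_mem (max_mem (max_mem hm1 hm2) (hm5 h1)) (hm6 h1)
    · exact max_mem (max_mem (max_mem hm1 hm2) (hm3 h2)) (hm4 h2)
    · exact max_mem hm1 hm2
  · have hell : D.part.last (D.part.idx p) + 1 < D.part.first (D.part.idx p) + n →
        1 < D.part.ell := by
      intro h
      by_contra h'
      have := hP.first_le_of_ell_le_one hk (by omega)
      omega
    apply nonneg_upper hD.toIsAuxData hp hx
    · split_ifs <;> simp
    · split_ifs <;> simp
    · intro h
      split_ifs <;> simp
    · intro u v h1 h2 h3 h4 h5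
      have h6 := hD.MCS.le h3 h4
      have h7 := (hD.IOMCS (hell (by omega)) _ hk).2 (v - 1) (by omega) (by omega)
      refine (h6.trans h7).trans ?_
      rw [if_pos (hell (by omega))]
      split_ifs <;> simp
    · intro u v h1 h2 h3 h4 h5
      have h6 := (hD.IRCS (hell (by omega)) _ hk).2 (u - 1) (by omega) (by omega)
      have h7 := hD.periodicSum_first_le hk (v := v) (by omega)
      simp only [Nat.sub_add_cancel (show 1 ≤ u by omega)] at h6
      have h8 := hD.IS _ hk
      have : x + periodicSum n A n - (periodicSum n A v - periodicSum n A u) ≤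
          x + (D.IS (D.part.idx p) + D.IRCS (D.part.idx p)) := by linarith
      refine this.trans ?_
      rw [if_pos (hell (by omega))]
      split_ifs <;> simp

theorem nonneg_type3 (hD : IsAuxData3 n A O D) (hp : p < n) (hx : 0 ≤ x) :
    IsGreatest (insertedSums n A x p) (nonneg D false x p).val := by
  have hP := hD.partition
  have hn := hD.n_pos
  have hk := hP.idx_lt p hp
  have hf := hP.first_le p hp
  have hl := hP.le_last p hp
  have hln := hP.last_lt _ hk
  rw [nonneg_val D false x p (by rw [hD.n_eq]; exact hn) (by rw [hD.n_eq]; exact hp), hD.n_eq,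
    hD.total]
  simp only [Bool.false_eq_true, if_false]
  have hm1 := add_max_MCS_mem (x := x) (p := p) hD.toIsAuxData
  have hm2 : x + D.SFMCS p ∈ insertedSums n A x p := by
    obtain ⟨⟨i, i1, i2, i3⟩, -⟩ := hD.SFMCS p hp
    rw [← i3]
    exact hD.add_MCS_mem hp (by omega) (Or.inl i1)
  have hm3 : 1 < D.part.ell → x + D.IOMCS (D.part.idx p) ∈ insertedSums n A x p := fun hell =>
    hD.add_greatest_mem hp hk hf (by omega) (hD.IOMCS hell _ hk)
  have hm5 := fun h => hD.PFMCS_mem (x := x) hp h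
  have hm6 := add_sub_PFSF_mem (x := x) hD.toIsAuxData hp
  constructor
  · split_ifs with h1 h2 h2
    · exact max_mem (max_mem (max_mem (max_mem hm1 hm2) (hm3 h2)) (hm5 h1)) (hm6 h1)
    · exact max_mem (max_mem (max_mem hm1 hm2) (hm5 h1)) (hm6 h1)
    · exact max_mem (max_mem hm1 hm2) (hm3 h2)
    · exact max_mem hm1 hm2
  · have hell : D.part.last (D.part.idx p) + 1 < D.part.first (D.part.idx p) + n →
        1 < D.part.ell := by
      intro h
      by_contra h'
      have := hP.first_le_of_ell_le_one hk (by omega)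
      omega
    apply nonneg_upper hD.toIsAuxData hp hx
    · split_ifs <;> simp
    · split_ifs <;> simp
    · intro h
      split_ifs <;> simp
    · intro u v h1 h2 h3 h4 h5
      have h6 := hD.MCS.le h3 h4
      have h7 := (hD.IOMCS (hell (by omega)) _ hk).2 (v - 1) (by omega) (by omega)
      have : periodicSum n A v - periodicSum n A u ≤ x + D.IOMCS (D.part.idx p) := by
        linarith
      refine this.trans ?_
      rw [if_pos (hell (by omega))]
      split_ifs <;> simp
    · intro u v h1 h2 h3 h4 h5
      have h6 := hD.MCS.le (u := v) (v := u + n) (by omega) (by omega)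
      rw [periodicSum_add_period, show u + n - 1 = u - 1 + n by omega, Nat.add_mod_right] at h6
      have h7 := (hD.IOMCS (hell (by omega)) _ hk).2 (u - 1) (by omega) (by omega)
      have : x + periodicSum n A n - (periodicSum n A v - periodicSum n A u) ≤
          x + D.IOMCS (D.part.idx p) := by linarith
      refine this.trans ?_
      rw [if_pos (hell (by omega))]
      split_ifs <;> simp

theorem negType3_val (D : AuxData) (x : ℝ) (p : ℕ) (hk : D.part.idx p < D.part.ell) :
    (negType3 D x p).val =
    let k := D.part.idx p
    let k' := (k + D.part.ell - 1) % D.part.ell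
    if p = D.part.first k then
      if 1 < D.part.ell then max (max (D.IMCS k') (x + D.IOMCS k')) (D.IRCS k') else D.IMCS k'
    else max (max (D.PFMCS p) (x + D.PFRMMCS p)) (D.PFRMMS p) := by
  unfold negType3
  simp only [bind_val, read_val, eq_val, lt_val, decide_eq_true_eq, ite_val, maxOf_val, add_val,
    pure_val, subMod_val hk (show 1 ≤ D.part.ell by omega)]

/-- The interval circularly before the first index `p` of an interval begins at `b`, or at `b - n`,
and its tables refer to the ranges from `b` to `p + n` and from `p` to `b`. -/
theorem exists_previous (hD : IsAuxData3 n A O D) (hp : p < n)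
    (hpf : p = D.part.first (D.part.idx p)) :
    ∃ b, p ≤ b ∧ b < p + n ∧
      (∀ u, p ≤ u → u < p + n → periodicSum n A p ≤ periodicSum n A u) ∧
      (∀ i, b ≤ i → i < p + n →
        D.MCS (i % n) = periodicSum n A (i + 1) - periodicSum n A p) ∧
      GreatestOver (fun i => D.MCS (i % n)) b (p + n)
        (D.IMCS ((D.part.idx p + D.part.ell - 1) % D.part.ell)) ∧
      (p < b ↔ 1 < D.part.ell) ∧
      (1 < D.part.ell → x + D.IOMCS ((D.part.idx p + D.part.ell - 1) % D.part.ell) ∈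
        insertedSums n A x p) ∧
      (1 < D.part.ell → GreatestOver (fun i => D.MCS (i % n)) p b
        (D.IOMCS ((D.part.idx p + D.part.ell - 1) % D.part.ell)) ∧
      GreatestOver (fun v => periodicSum n A (v + 1) - periodicSum n A p) p b
        (D.IRCS ((D.part.idx p + D.part.ell - 1) % D.part.ell))) := by
  have hP := hD.partition
  have hn := hD.n_pos
  have hk := hP.idx_lt p hp
  have hper := fun t => periodicSum_add_period n A t
  rcases Nat.eq_zero_or_pos (D.part.idx p) with h0 | h0
  -- the previous interval is the last one, and its tables refer to the next period
  · rw [h0, hP.first_zero hn] at hpf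
    subst hpf
    rw [h0, Nat.zero_add D.part.ell, Nat.mod_eq_of_lt (by omega)]
    have hk' : D.part.ell - 1 < D.part.ell := by omega
    have hlast := hP.last_ell (D.part.ell - 1) (by omega)
    have hfl := hP.first_le_last _ hk'
    have hmin := hD.intervals.last_le _ hk'
    have hMCS := hD.intervals.MCS_eq _ hk'
    have hIM := hD.IMCS _ hk'
    have hOut := fun h => hD.IOMCS h _ hk'
    have hIR := fun h => hD.IRCS h _ hk'
    rw [hlast] at hmin hIM hOut hIR
    have hshift : ∀ {f : ℕ → ℝ} {m : ℝ}, GreatestOver f n (D.part.first (D.part.ell - 1) + n) m →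
        GreatestOver (fun i => f (i + n)) 0 (D.part.first (D.part.ell - 1)) m := by
      rintro f m ⟨⟨i, i1, i2, i3⟩, h⟩
      exact ⟨⟨i - n, by omega, by omega, by simpa [Nat.sub_add_cancel i1] using i3⟩,
        fun i _ hi => h (i + n) (by omega) (by omega)⟩
    refine ⟨D.part.first (D.part.ell - 1), Nat.zero_le _, by omega, fun u _ hu => ?_,
      fun i hi hi' => ?_, ?_, ⟨fun h => ?_, fun h => ?_⟩, fun h => ?_, fun h => ⟨?_, ?_⟩⟩
    · have := hmin (u + n) (by omega) (by omega)
      rw [hper] at this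
      rw [periodicSum_zero]
      linarith
    · rw [Nat.mod_eq_of_lt (by omega), hMCS i hi (by omega), hlast,
        show i + n + 1 = i + 1 + n by ring, hper, periodicSum_zero]
      ring
    · rw [zero_add]
      refine hIM.congr fun i _ hi => ?_
      rw [Nat.mod_eq_of_lt (by omega)]
    · by_contra hell
      rw [show D.part.ell - 1 = 0 by omega, hP.first_zero hn] at h
      exact lt_irrefl _ h
    · have h1 := hP.first_succ (D.part.ell - 1 - 1) (by omega)
      rw [Nat.sub_add_cancel (by omega)] at h1
      omega
    · obtain ⟨⟨i, i1, i2, i3⟩, -⟩ := hOut h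
      rw [← i3]
      exact hD.add_MCS_mem hp (Nat.mod_lt i hn) (Or.inl (Nat.zero_le _))
    · refine (hshift (hOut h)).congr fun i _ _ => ?_
      simp only [Nat.add_mod_right]
    · refine (hshift (hIR h)).congr fun i _ _ => ?_
      rw [show i + n + 1 = i + 1 + n by ring, hper, periodicSum_zero]
      ring
  · have hkk : (D.part.idx p + D.part.ell - 1) % D.part.ell = D.part.idx p - 1 := by
      rw [show D.part.idx p + D.part.ell - 1 = D.part.idx p - 1 + D.part.ell by omega,
        Nat.add_mod_right, Nat.mod_eq_of_lt (by omega)]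
    rw [hkk]
    have hk' : D.part.idx p - 1 < D.part.ell := by omega
    have hlast := hP.first_succ (D.part.idx p - 1) (by omega)
    rw [Nat.sub_add_cancel (by omega), ← hpf] at hlast
    have hfl := hP.first_le_last _ hk'
    have hmin := hD.intervals.last_le _ hk'
    have hMCS := hD.intervals.MCS_eq _ hk'
    have hIM := hD.IMCS _ hk'
    have hOut := fun h => hD.IOMCS h _ hk'
    have hIR := fun h => hD.IRCS h _ hk'
    rw [← hlast] at hmin hIM hOut hIR
    refine ⟨D.part.first (D.part.idx p - 1) + n, by omega, by omega, fun u hu hu' =>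
      hmin u hu (by omega), fun i hi hi' => ?_, ?_, ⟨fun _ => by omega, fun _ => by omega⟩,
      fun h => ?_, fun h => ⟨hOut h, hIR h⟩⟩
    · rw [Nat.mod_eq_sub_mod (by omega), Nat.mod_eq_of_lt (by omega),
        hMCS (i - n) (by omega) (by omega), ← hlast, Nat.sub_add_cancel (by omega)]
    · refine GreatestOver.shift n (hIM.congr (g := fun i => D.MCS (i % n)) fun i _ hi => ?_)
        fun i => ?_
      · rw [Nat.mod_eq_of_lt (by omega)]
      · rw [Nat.add_mod_right]
    · exact hD.add_greatest_mem hp hk' (by omega) le_rfl (hOut h)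

/-- If an interval begins at `p`, then the prefix sum at `p` is the least of the following period,
so that among the subsequences which avoid the gap, it suffices to consider those that begin
at `p`. -/
theorem negType3_first (hD : IsAuxData3 n A O D) (hp : p < n) (hx : x < 0)
    (hpf : p = D.part.first (D.part.idx p)) :
    IsGreatest (insertedSums n A x p) (negType3 D x p).val := by
  have hP := hD.partition
  have hn := hD.n_pos
  have hk := hP.idx_lt p hp
  have hper := fun t => periodicSum_add_period n A t
  have hnonneg := hD.nonneg
  obtain ⟨b, hb1, hb2, hmin, hMCS, hIM, hell, hOther, hO⟩ := exists_previous (x := x) hD hp hpf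
  rw [negType3_val D x p hk]
  simp only [if_pos hpf]
  generalize (D.part.idx p + D.part.ell - 1) % D.part.ell = k' at *
  have hm1 : D.IMCS k' ∈ insertedSums n A x p := by
    obtain ⟨⟨i, i1, i2, i3⟩, -⟩ := hIM
    simp only at i3
    rw [← i3, hMCS i i1 i2]
    exact mem_without le_rfl (by omega) (by omega)
  have hm3 : 1 < D.part.ell → D.IRCS k' ∈ insertedSums n A x p := by
    intro h
    obtain ⟨⟨i, i1, i2, i3⟩, -⟩ := (hO h).2
    rw [← i3]
    exact mem_without le_rfl (by omega) (by omega)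
  constructor
  · split_ifs with h
    · exact max_mem (max_mem hm1 (hOther h)) (hm3 h)
    · exact hm1
  · have h0 : 0 ≤ D.IMCS k' := by
      have h1 := hIM.2 (p + n - 1) (by omega) (by omega)
      simp only at h1
      rw [hMCS _ (by omega) (by omega), Nat.sub_add_cancel (by omega), hper] at h1
      linarith
    have hr1 : D.IMCS k' ≤
        if 1 < D.part.ell then max (max (D.IMCS k') (x + D.IOMCS k')) (D.IRCS k')
        else D.IMCS k' := by
      split_ifs <;> simp
    rintro t ⟨u, v, huv1, huv2, huv3, rfl | rfl⟩
    · rcases eq_or_ne u v with rfl | huv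
      · rw [sub_self]; linarith
      rcases lt_or_ge b v with h | h
      · have h1 := hD.MCS.le (u := u) (v := v) (by omega) (by omega)
        have h2 := hIM.2 (v - 1) (by omega) (by omega)
        linarith
      · have h1 := hell.1 (by omega)
        have h2 := (hO h1).2.2 (v - 1) (by omega) (by omega)
        simp only [Nat.sub_add_cancel (show 1 ≤ v by omega)] at h2
        have h3 := hmin u huv1 (by omega)
        rw [if_pos h1]
        exact le_max_of_le_right (by linarith)
    · rcases eq_or_ne v (u + n) with rfl | huv
      · rw [hper]; linarith
      have hM := hD.MCS.le (u := v) (v := u + n) (by omega) (by omega)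
      rw [hper] at hM
      rcases eq_or_ne u p with rfl | hup
      · have h2 := hIM.2 (u + n - 1) (by omega) (by omega)
        linarith
      · rw [show u + n - 1 = u - 1 + n by omega, Nat.add_mod_right] at hM
        rcases lt_or_ge b u with h | h
        · have h2 := hIM.2 (u - 1) (by omega) (by omega)
          linarith
        · have h1 := hell.1 (by omega)
          have h2 := (hO h1).1.2 (u - 1) (by omega) (by omega)
          rw [if_pos h1]
          exact le_max_of_le_left (le_max_of_le_right (by linarith))

theorem negType3_isGreatest (hD : IsAuxData3 n A O D) (hp : p < n) (hx : x < 0) :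
    IsGreatest (insertedSums n A x p) (negType3 D x p).val := by
  by_cases hpf : p = D.part.first (D.part.idx p)
  · exact negType3_first hD hp hx hpf
  have hP := hD.partition
  have hk := hP.idx_lt p hp
  have hf := hP.first_le p hp
  have hl := hP.le_last p hp
  have hln := hP.last_lt _ hk
  have hper := fun t => periodicSum_add_period n A t
  rw [negType3_val D x p hk]
  simp only [if_neg hpf]
  obtain ⟨⟨u0, v0, h1, h2, h3, h4⟩, hR⟩ := hD.PFRMMS p hp
  have hPF := (hD.PFMCS p hp (by omega)).2
  constructor
  · refine max_mem (max_mem (hD.PFMCS_mem hp (by omega))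
      (hD.add_greatest_mem hp hk hf le_rfl (hD.PFRMMCS p hp))) ?_
    rw [h4]
    exact mem_without h1 h2 (by omega)
  · have hr1 : D.PFMCS p ≤ max (max (D.PFMCS p) (x + D.PFRMMCS p)) (D.PFRMMS p) := by simp
    have hr2 : x + D.PFRMMCS p ≤ max (max (D.PFMCS p) (x + D.PFRMMCS p)) (D.PFRMMS p) := by simp
    have hr3 : D.PFRMMS p ≤ max (max (D.PFMCS p) (x + D.PFRMMCS p)) (D.PFRMMS p) := by simp
    have hR0 := hR p p le_rfl le_rfl (by omega)
    rw [sub_self] at hR0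
    rintro t ⟨u, v, huv1, huv2, huv3, rfl | rfl⟩
    · rcases eq_or_ne u v with rfl | huv
      · rw [sub_self]; linarith
      rcases lt_or_ge (D.part.first (D.part.idx p) + n) v with h | h
      · have hM := hD.MCS.le (u := u) (v := v) (by omega) (by omega)
        rw [Nat.mod_eq_sub_mod (by omega), Nat.mod_eq_of_lt (by omega)] at hM
        have := hPF (v - 1 - n) (by omega) (by omega)
        linarith
      · exact (hR u v huv1 huv2 h).trans hr3
    · rcases eq_or_ne v (u + n) with rfl | huv
      · rw [hper]; linarith
      have hM := hD.MCS.le (u := v) (v := u + n) (by omega) (by omega)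
      rw [hper, show u + n - 1 = u - 1 + n by omega, Nat.add_mod_right] at hM
      rcases eq_or_ne u p with rfl | hup
      · rw [Nat.mod_eq_of_lt (by omega)] at hM
        have := hPF (u - 1) (by omega) (by omega)
        linarith
      · rcases lt_or_ge (D.part.first (D.part.idx p) + n) u with h | h
        · rw [Nat.mod_eq_sub_mod (by omega), Nat.mod_eq_of_lt (by omega)] at hM
          have := hPF (u - 1 - n) (by omega) (by omega)
          linarith
        · have := (hD.PFRMMCS p hp).2 (u - 1) (by omega) (by omega)
          simp only at this
          linarith

/-- The decrease of the maximal sum at `p` that the insertion of `x < 0` at `p` causes, for type 2.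
-/
noncomputable def decrease (D : AuxData) (x : ℝ) (p : ℕ) : ℝ :=
  if p = D.part.first (D.part.idx p) then 0 else min (0 - x) (D.MCS (p - 1))

theorem negType2_val (D : AuxData) (x : ℝ) (p : ℕ) :
    (negType2 D x p).val =
    let k := D.part.idx p
    let d := decrease D x p
    let r := max (max 0 (D.PRVMS p)) (if p = 0 then x else x + max 0 (D.MCS (p - 1)))
    let r := if D.IXs k ≤ p then max r (D.MCS p - d) else
      max (max r (if D.X1 p = p then D.MCS (D.X1 p) - d
        else D.MCS (D.X1 p) - min d (D.BX1 p))) (D.MCS (D.X2 p) - min d (D.BX2 p))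
    if k + 1 < D.part.ell then max r (D.INXTMS k) else r := by
  unfold negType2 decrease
  simp only [bind_val, read_val, eq_val, lt_val, le_val, decide_eq_true_eq, ite_val, maxOf_val,
    minOf_val, add_val, sub_val, pure_val]

/-- The subsequence which ends at `q` begins with the interval of `p` and pays for `x`, or it begins
right after the gap; if `p` is the first index of the interval, then the interval itself begins
right after the gap and nothing is lost. -/
theorem sub_decrease_mem (hD : IsAuxData2 n A O D) (hp : p < n) {q : ℕ} (hpq : p ≤ q)
    (hq : q ≤ D.part.last (D.part.idx p)) : D.MCS q - decrease D x p ∈ insertedSums n A x p := by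
  have hP := hD.partition
  have hk := hP.idx_lt p hp
  have hf := hP.first_le p hp
  have hln := hP.last_lt _ hk
  rw [hD.intervals.MCS_eq _ hk q (by omega) hq, decrease]
  split_ifs with h
  · rw [sub_zero]
    exact mem_without h.le (by omega) (by omega)
  · rcases min_choice (0 - x) (D.MCS (p - 1)) with h' | h' <;> rw [h']
    · rw [zero_sub, sub_neg_eq_add, add_comm _ x]
      exact mem_with hf (by omega) (by omega)
    · rw [hD.intervals.MCS_eq _ hk (p - 1) (by omega) (by have := hP.le_last p hp; omega),
        Nat.sub_add_cancel (by omega), sub_sub_sub_cancel_right]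
      exact mem_without le_rfl (by omega) (by omega)

/-- If the minimum is `b = MCS t`, then it is the subsequence from `t + 1` to `q` which has the sum.
-/
theorem sub_min_decrease_mem (hD : IsAuxData2 n A O D) (hp : p < n) {q : ℕ} {b : ℝ}
    (hpq : p < q) (hq : q ≤ D.part.last (D.part.idx p)) (hb : LeastOver D.MCS p q b) :
    D.MCS q - min (decrease D x p) b ∈ insertedSums n A x p := by
  have hP := hD.partition
  have hk := hP.idx_lt p hp
  have hf := hP.first_le p hp
  have hln := hP.last_lt _ hk
  rcases min_choice (decrease D x p) b with h' | h' <;> rw [h']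
  · exact sub_decrease_mem hD hp hpq.le hq
  · obtain ⟨⟨t, t1, t2, rfl⟩, -⟩ := hb
    rw [hD.intervals.MCS_eq _ hk q (by omega) hq,
      hD.intervals.MCS_eq _ hk t (by omega) (by omega), sub_sub_sub_cancel_right]
    exact mem_without (by omega) (by omega) (by omega)

theorem decrease_le (hx : x < 0) : decrease D x p ≤ -x := by
  rw [decrease]
  split_ifs
  · linarith
  · simp

theorem decrease_le_periodicSum (hD : IsAuxData2 n A O D) (hp : p < n) : decrease D x p ≤
    periodicSum n A p - periodicSum n A (D.part.first (D.part.idx p)) := by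
  have hP := hD.partition
  have hk := hP.idx_lt p hp
  have hf := hP.first_le p hp
  rw [decrease]
  split_ifs with h
  · rw [← h, sub_self]
  · refine (min_le_right _ _).trans ?_
    rw [hD.intervals.MCS_eq _ hk (p - 1) (by omega) (by have := hP.le_last p hp; omega),
      Nat.sub_add_cancel (by omega)]

/-- The terms for the elements of the interval of `p` that are not before `p` bound the sums of all
subsequences which end at such an element. It suffices to consider the elements up to the last
positive one. -/
theorem negType2_upper (hD : IsAuxData2 n A O D) (hp : p < n) (hx : x < 0) {r : ℝ} (hr0 : 0 ≤ r)
    (hr1 : D.IXs (D.part.idx p) ≤ p → D.MCS p - decrease D x p ≤ r)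
    (hr2 : p < D.IXs (D.part.idx p) → D.MCS (D.X1 p) - decrease D x p ≤ r ∧
      D.MCS (D.X2 p) - min (decrease D x p) (D.BX2 p) ≤ r)
    {i : ℕ} (hpi : p ≤ i) (hi : i ≤ D.part.last (D.part.idx p)) :
    (∀ u, p ≤ u → u ≤ i → periodicSum n A (i + 1) - periodicSum n A u ≤ r) ∧
    x + (periodicSum n A (i + 1) - periodicSum n A (D.part.first (D.part.idx p))) ≤ r := by
  have hP := hD.partition
  have hk := hP.idx_lt p hp
  have hf := hP.first_le p hp
  have hl := hP.le_last p hp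
  have hln := hP.last_lt _ hk
  have hd1 := decrease_le (D := D) (p := p) hx
  have hd2 := decrease_le_periodicSum (x := x) hD hp
  obtain ⟨hX1, hX2, hX3⟩ := hD.IXs _ hk
  have hMCS := hD.intervals.MCS_eq _ hk
  have main : ∀ i, p ≤ i → i ≤ max p (D.IXs (D.part.idx p)) →
      (∀ u, p ≤ u → u ≤ i → periodicSum n A (i + 1) - periodicSum n A u ≤ r) ∧
      x + (periodicSum n A (i + 1) - periodicSum n A (D.part.first (D.part.idx p))) ≤ r := by
    intro i hpi hi
    rcases le_or_gt (D.IXs (D.part.idx p)) p with h | h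
    · rw [max_eq_left h] at hi
      obtain rfl : i = p := by omega
      have h1 := hr1 h
      rw [hMCS i hf hl] at h1
      refine ⟨fun u hu hu' => ?_, by linarith⟩
      obtain rfl : u = i := by omega
      linarith
    · rw [max_eq_right h.le] at hi
      obtain ⟨h1, h2⟩ := hr2 h
      have hpk := hD.peak p hp h
      have h3 := hpk.max_x1 i hpi hi
      have h4 := hMCS i (by omega) (by omega)
      refine ⟨fun u hu hu' => ?_, by linarith⟩
      rcases eq_or_ne u p with rfl | hup
      · linarith
      · have h5 := hpk.max_x2 (u - 1) i (by omega) (by omega) hi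
        have h6 := hMCS (u - 1) (by omega) (by omega)
        rw [Nat.sub_add_cancel (by omega)] at h6
        have h7 := min_le_right (decrease D x p) (D.BX2 p)
        have h8 : max 0 (D.MCS (D.X2 p) - D.BX2 p) ≤ r := max_le hr0 (by linarith)
        linarith
  -- the prefix sums decrease after the last positive element of the interval
  have hanti : ∀ a b, max p (D.IXs (D.part.idx p)) + 1 ≤ a → a ≤ b →
      b ≤ D.part.last (D.part.idx p) + 1 → periodicSum n A b ≤ periodicSum n A a := by
    intro a b ha hab hb
    induction b, hab using Nat.le_induction with
    | base => exact le_rfl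
    | succ b hab ih =>
      rw [periodicSum_succ, Nat.mod_eq_of_lt (by omega)]
      have := hX3 b (by have := le_max_right p (D.IXs (D.part.idx p)); omega) (by omega)
      linarith [ih (by omega)]
  rcases le_or_gt i (max p (D.IXs (D.part.idx p))) with h | h
  · exact main i hpi h
  · obtain ⟨m1, m2⟩ := main _ (le_max_left _ _) le_rfl
    have h1 := hanti (max p (D.IXs (D.part.idx p)) + 1) (i + 1) le_rfl (by omega) (by omega)
    refine ⟨fun u hu hu' => ?_, by linarith⟩
    rcases le_or_gt u (max p (D.IXs (D.part.idx p))) with h2 | h2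
    · linarith [m1 u hu h2]
    · linarith [hanti u (i + 1) (by omega) (by omega) (by omega)]

theorem negType2_isGreatest (hD : IsAuxData2 n A O D) (hp : p < n) (hx : x < 0) :
    IsGreatest (insertedSums n A x p) (negType2 D x p).val := by
  have hP := hD.partition
  have hn := hD.n_pos
  have hk := hP.idx_lt p hp
  have hf := hP.first_le p hp
  have hl := hP.le_last p hp
  have hln := hP.last_lt _ hk
  have hper := fun t => periodicSum_add_period n A t
  obtain ⟨hX1, hX2, hX3⟩ := hD.IXs _ hk
  obtain ⟨hV0, hV1, hV2⟩ := hD.PRVMS p hp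
  rw [negType2_val]
  dsimp only
  set nw := if p = 0 then x else x + max 0 (D.MCS (p - 1)) with hnw
  set r0 := max (max 0 (D.PRVMS p)) nw with hr0
  set r1 := if D.IXs (D.part.idx p) ≤ p then max r0 (D.MCS p - decrease D x p) else
      max (max r0 (if D.X1 p = p then D.MCS (D.X1 p) - decrease D x p
        else D.MCS (D.X1 p) - min (decrease D x p) (D.BX1 p)))
        (D.MCS (D.X2 p) - min (decrease D x p) (D.BX2 p)) with hr1
  constructor
  · have hm0 : r0 ∈ insertedSums n A x p := by
      refine max_mem (max_mem zero_mem_insertedSums ?_) ?_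
      · rcases hV2 with h | ⟨i, hi, h⟩ <;> rw [h]
        · exact zero_mem_insertedSums
        · exact hD.MCS_mem_of_lt hp hi
      · rw [hnw]
        split_ifs with h
        · exact x_mem_insertedSums
        · have := add_max_MCS_mem (x := x) (p := p) hD.toIsAuxData
          rwa [show p + n - 1 = p - 1 + n by omega, Nat.add_mod_right,
            Nat.mod_eq_of_lt (by omega)] at this
    have hm1 : r1 ∈ insertedSums n A x p := by
      rw [hr1]
      split_ifs with h1 h2
      · exact max_mem hm0 (sub_decrease_mem hD hp le_rfl hl)
      all_goals
        have hpk := hD.peak p hp (by omega)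
        have hx1 := hpk.x1_le
        have hx2 := hpk.x2_le
        have hx3 := hpk.le_x1
      · exact max_mem (max_mem hm0 (sub_decrease_mem hD hp hpk.le_x1 (by omega)))
          (sub_min_decrease_mem hD hp hpk.lt_x2 (by omega) hpk.least_b2)
      · refine max_mem (max_mem hm0 (sub_min_decrease_mem hD hp (by omega) (by omega) ?_))
          (sub_min_decrease_mem hD hp hpk.lt_x2 (by omega) hpk.least_b2)
        rcases hpk.least_b1 with h | h
        · exact absurd h.1 h2
        · exact h.2
    split_ifs with h
    · refine max_mem hm1 ?_
      obtain ⟨⟨i, i1, i2, i3⟩, -⟩ := hD.INXTMS _ h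
      rw [← i3]
      exact hD.MCS_mem_of_last_lt hp i2 (by omega)
    · exact hm1
  · set r := if D.part.idx p + 1 < D.part.ell then max r1 (D.INXTMS (D.part.idx p)) else r1 with hr
    have l1 : r1 ≤ r := by rw [hr]; split_ifs <;> simp
    have l0 : r0 ≤ r := by
      refine le_trans ?_ l1
      rw [hr1]
      split_ifs <;> simp
    have hr0' : 0 ≤ r := le_trans (by simp [hr0]) l0
    have hrV : D.PRVMS p ≤ r := le_trans (by simp [hr0]) l0
    have hrn : nw ≤ r := le_trans (by simp [hr0]) l0
    have hrx : x ≤ r := by linarith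
    have hmid := fun {i : ℕ} => negType2_upper hD hp hx (i := i) hr0'
      (fun h => le_trans (by rw [hr1, if_pos h]; simp) l1)
      (fun h => by
        have e : ¬ D.IXs (D.part.idx p) ≤ p := by omega
        rw [if_neg e] at hr1
        constructor
        · refine le_trans ?_ l1
          rw [hr1]
          refine le_max_of_le_left (le_max_of_le_right ?_)
          split_ifs
          · exact le_rfl
          · have := min_le_left (decrease D x p) (D.BX1 p)
            linarith
        · exact le_trans (by rw [hr1]; simp) l1)
    -- elements before `p` and after the interval of `p`
    have hprev : ∀ j < p, D.MCS j ≤ r := fun j hj => (hV1 j hj).trans hrV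
    have hnext : ∀ j < n, D.part.last (D.part.idx p) < j → D.MCS j ≤ r := by
      intro j hj hlj
      have hell : D.part.idx p + 1 < D.part.ell := by
        by_contra h
        have := hP.last_ell (D.part.idx p) (by omega)
        omega
      have := (hD.INXTMS _ hell).2 j (by omega) hj
      refine this.trans ?_
      rw [hr, if_pos hell]
      simp
    rintro t ⟨u, v, huv1, huv2, huv3, rfl | rfl⟩
    · rcases eq_or_ne u v with rfl | huv
      · rwa [sub_self]
      have hM := hD.MCS.le (u := u) (v := v) (by omega) (by omega)
      rcases lt_or_ge n v with h | h
      · rw [Nat.mod_eq_sub_mod (by omega), Nat.mod_eq_of_lt (by omega)] at hM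
        exact hM.trans (hprev _ (by omega))
      · rw [Nat.mod_eq_of_lt (by omega)] at hM
        rcases lt_or_ge (D.part.last (D.part.idx p)) (v - 1) with h1 | h1
        · exact hM.trans (hnext _ (by omega) h1)
        · have := (hmid (i := v - 1) (by omega) h1).1 u huv1 (by omega)
          rwa [Nat.sub_add_cancel (by omega)] at this
    · rcases eq_or_ne v (u + n) with rfl | huv
      · rw [hper]; linarith
      have hM := hD.MCS.le (u := v) (v := u + n) (by omega) (by omega)
      rw [hper] at hM
      rcases eq_or_ne u p with rfl | hup
      · rcases Nat.eq_zero_or_pos u with rfl | hu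
        · have h1 := hP.last_ell (D.part.ell - 1) (by omega)
          have h2 := hD.intervals.last_lt (D.part.ell - 1) (by omega) v (by omega)
          rw [h1] at h2
          rw [periodicSum_zero]
          linarith
        · rw [show u + n - 1 = u - 1 + n by omega, Nat.add_mod_right,
            Nat.mod_eq_of_lt (by omega)] at hM
          rw [if_neg (by omega)] at hnw
          have := le_max_right 0 (D.MCS (u - 1))
          linarith
      · rw [show u + n - 1 = u - 1 + n by omega, Nat.add_mod_right] at hM
        rcases lt_or_ge n u with h | h
        · rw [Nat.mod_eq_sub_mod (by omega), Nat.mod_eq_of_lt (by omega)] at hM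
          have := hprev (u - 1 - n) (by omega)
          linarith
        · rw [Nat.mod_eq_of_lt (by omega)] at hM
          rcases lt_or_ge (D.part.last (D.part.idx p)) (u - 1) with h1 | h1
          · have := hnext _ (by omega) h1
            linarith
          · have := (hmid (i := u - 1) (by omega) h1).2
            rw [Nat.sub_add_cancel (by omega)] at this
            have := hD.periodicSum_first_le hk (v := v) (by omega)
            linarith

end Query

/-! ### Circular subsequences of the sequence after an insertion, by prefix sums -/

theorem sum_drop_take (L : List ℝ) {i j : ℕ} (h : i ≤ j) :
    ((L.drop i).take (j - i)).sum = (L.take j).sum - (L.take i).sum := by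
  have h1 : L.take j = L.take i ++ (L.drop i).take (j - i) := by
    rw [← List.take_add, Nat.add_sub_cancel' h]
  rw [h1, List.sum_append]
  ring

theorem sum_subseq (L : List ℝ) {i j : ℕ} (hij : i ≤ j) (hj : j < L.length) :
    (subseq L i j).sum = (L.take (j + 1)).sum - (L.take i).sum := by
  rw [subseq, if_pos ⟨hij, hj⟩, sum_drop_take L (by omega)]

theorem sum_circSubseq_of_le (L : List ℝ) {i j : ℕ} (hij : i ≤ j) (hj : j < L.length) :
    (circSubseq L i j).sum = (L.take (j + 1)).sum - (L.take i).sum := by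
  rw [circSubseq, if_neg (by omega), sum_subseq L hij hj]

theorem sum_circSubseq_of_lt (L : List ℝ) {i j : ℕ} (hij : j < i) (hi : i < L.length) :
    (circSubseq L i j).sum = L.sum - (L.take i).sum + (L.take (j + 1)).sum := by
  rw [circSubseq, if_pos ⟨hij, hi⟩, List.sum_append, sum_subseq L (by omega) (by omega),
    sum_subseq L (by omega) (by omega), Nat.sub_add_cancel (by omega), List.take_length]
  simp

theorem sum_circSubseq_of_length_le (L : List ℝ) {i j : ℕ} (h : L.length ≤ i ∨ L.length ≤ j) :
    (circSubseq L i j).sum = 0 := by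
  rw [circSubseq, if_neg (by omega), subseq, if_neg (by omega), List.sum_nil]

theorem length_insertAt {A : List ℝ} {p : ℕ} (hp : p ≤ A.length) (x : ℝ) :
    (insertAt A p x).length = A.length + 1 := by
  simp [insertAt, hp]
  omega

theorem sum_insertAt (A : List ℝ) (p : ℕ) (x : ℝ) : (insertAt A p x).sum = x + A.sum := by
  conv_rhs => rw [← List.take_append_drop p A, List.sum_append]
  simp only [insertAt, List.sum_append, List.sum_singleton]
  ring

theorem sum_take_insertAt_of_le {A : List ℝ} {p t : ℕ} (hp : p ≤ A.length) (x : ℝ) (h : t ≤ p) :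
    ((insertAt A p x).take t).sum = (A.take t).sum := by
  rw [insertAt, List.append_assoc, List.take_append_of_le_length (by simp; omega), List.take_take,
    min_eq_left h]

theorem sum_take_insertAt_of_lt {A : List ℝ} {p t : ℕ} (hp : p ≤ A.length) (x : ℝ) (h : p ≤ t) :
    ((insertAt A p x).take (t + 1)).sum = x + (A.take t).sum := by
  have e : A.take t = A.take p ++ (A.drop p).take (t - p) := by
    rw [← List.take_add, Nat.add_sub_cancel' h]
  have hlen : (A.take p ++ [x]).length = p + 1 := by simp [hp]
  rw [insertAt, List.take_append, hlen, List.take_of_length_le (by omega),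
    Nat.add_sub_add_right, e]
  simp only [List.sum_append, List.sum_singleton]
  ring

theorem periodicSum_load (A : List ℝ) {t : ℕ} (ht : t ≤ A.length) :
    periodicSum A.length (load A) t = (A.take t).sum := by
  induction t with
  | zero => simp
  | succ t ih =>
    rw [periodicSum_succ, ih (by omega), Nat.mod_eq_of_lt (by omega),
      List.sum_take_succ _ _ (by omega)]
    simp [load, List.getD_eq_getElem?_getD, show t < A.length by omega]

/-- The maximal circular sum after an insertion is the greatest element of `insertedSums`. -/
theorem setOf_sum_circSubseq_insertAt {A : List ℝ} {p : ℕ} (hp : p ≤ A.length) (x : ℝ) :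
    {t : ℝ | ∃ i j : ℕ, t = (circSubseq (insertAt A p x) i j).sum} =
      insertedSums A.length (load A) x p := by
  have hN := length_insertAt hp x
  have hle := fun t (h : t ≤ p) => sum_take_insertAt_of_le hp x h
  have hlt := fun t (h : p ≤ t) => sum_take_insertAt_of_lt hp x h
  have htot : (insertAt A p x).sum = x + periodicSum A.length (load A) A.length := by
    rw [periodicSum_load A le_rfl, List.take_length, sum_insertAt]
  have hP := fun t (h : t ≤ A.length) => (periodicSum_load A h).symm
  have hper := periodicSum_add_period A.length (load A)
  set L := insertAt A p x
  set n := A.length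
  -- The new element has index `p`, and the indices of the elements after it are shifted by one. A
  -- subsequence which contains it has as complement one that lies between `p` and `p + n`.
  ext t
  constructor
  · rintro ⟨i, j, rfl⟩
    by_cases hout : n + 1 ≤ i ∨ n + 1 ≤ j
    · rw [sum_circSubseq_of_length_le L (by omega)]
      exact zero_mem_insertedSums
    rcases le_or_gt i j with hij | hij
    · rw [sum_circSubseq_of_le L hij (by omega)]
      rcases le_or_gt i p with hi | hi
      · rw [hle i hi, hP i (by omega)]
        rcases le_or_gt p j with hj | hj
        · rw [hlt j hj, hP j (by omega)]
          refine ⟨j, i + n, hj, by omega, by omega, Or.inr ?_⟩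
          rw [hper]
          ring
        · rw [hle (j + 1) hj, hP (j + 1) (by omega)]
          refine ⟨i + n, j + 1 + n, by omega, by omega, by omega, Or.inl ?_⟩
          rw [hper, hper]
          ring
      · obtain ⟨i, rfl⟩ : ∃ i', i = i' + 1 := ⟨i - 1, by omega⟩
        rw [hlt i (by omega), hlt j (by omega), hP i (by omega), hP j (by omega)]
        exact ⟨i, j, by omega, by omega, by omega, Or.inl (by ring)⟩
    · rw [sum_circSubseq_of_lt L hij (by omega), htot]
      rcases le_or_gt i p with hi | hi
      · rw [hle i hi, hle (j + 1) (by omega), hP i (by omega), hP (j + 1) (by omega)]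
        refine ⟨j + 1 + n, i + n, by omega, by omega, by omega, Or.inr ?_⟩
        rw [hper, hper]
        ring
      · obtain ⟨i, rfl⟩ : ∃ i', i = i' + 1 := ⟨i - 1, by omega⟩
        rw [hlt i (by omega), hP i (by omega)]
        rcases le_or_gt p j with hj | hj
        · rw [hlt j hj, hP j (by omega)]
          exact ⟨j, i, hj, by omega, by omega, Or.inr (by ring)⟩
        · rw [hle (j + 1) hj, hP (j + 1) (by omega)]
          refine ⟨i, j + 1 + n, by omega, by omega, by omega, Or.inl ?_⟩
          rw [hper]
          ring
  · rintro ⟨u, v, h1, h2, h3, rfl | rfl⟩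
    · rcases h2.eq_or_lt with rfl | h2
      · exact ⟨n + 1, n + 1, by rw [sum_circSubseq_of_length_le L (by omega)]; ring⟩
      rcases le_or_gt v n with hv | hv
      · refine ⟨u + 1, v, ?_⟩
        rw [sum_circSubseq_of_le L h2 (by omega), hlt u h1, hlt v (by omega), hP u (by omega),
          hP v hv]
        ring
      obtain ⟨v, rfl⟩ : ∃ v', v = v' + 1 + n := ⟨v - 1 - n, by omega⟩
      rcases le_or_gt n u with hu | hu
      · obtain ⟨u, rfl⟩ : ∃ u', u = u' + n := ⟨u - n, by omega⟩
        refine ⟨u, v, ?_⟩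
        rw [sum_circSubseq_of_le L (by omega) (by omega), hle u (by omega), hle (v + 1) (by omega),
          hP u (by omega), hP (v + 1) (by omega), hper, hper]
        ring
      · refine ⟨u + 1, v, ?_⟩
        rw [sum_circSubseq_of_lt L (by omega) (by omega), htot, hlt u h1, hle (v + 1) (by omega),
          hP u (by omega), hP (v + 1) (by omega), hper]
        ring
    · rcases lt_or_ge v n with hv | hv
      · refine ⟨v + 1, u, ?_⟩
        rw [sum_circSubseq_of_lt L (by omega) (by omega), htot, hlt u h1, hlt v (by omega),
          hP u (by omega), hP v (by omega)]
        ring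
      obtain ⟨v, rfl⟩ : ∃ v', v = v' + n := ⟨v - n, by omega⟩
      rcases le_or_gt u n with hu | hu
      · refine ⟨v, u, ?_⟩
        rw [sum_circSubseq_of_le L (by omega) (by omega), hle v (by omega), hlt u h1,
          hP u hu, hP v (by omega), hper]
        ring
      · obtain ⟨u, rfl⟩ : ∃ u', u = u' + 1 + n := ⟨u - 1 - n, by omega⟩
        refine ⟨v, u, ?_⟩
        rw [sum_circSubseq_of_lt L (by omega) (by omega), htot, hle v (by omega),
          hle (u + 1) (by omega), hP v (by omega), hP (u + 1) (by omega), hper, hper]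
        ring

theorem insertedSums_add_period (n : ℕ) (A : Mem ℝ) (x : ℝ) (p : ℕ) :
    insertedSums n A x (p + n) = insertedSums n A x p := by
  have hper := periodicSum_add_period n A
  ext t
  constructor
  · rintro ⟨u, v, h1, h2, h3, h⟩
    obtain ⟨u, rfl⟩ : ∃ u', u = u' + n := ⟨u - n, by omega⟩
    obtain ⟨v, rfl⟩ : ∃ v', v = v' + n := ⟨v - n, by omega⟩
    refine ⟨u, v, by omega, by omega, by omega, ?_⟩
    rwa [hper, hper, add_sub_add_right_eq_sub] at h
  · rintro ⟨u, v, h1, h2, h3, h⟩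
    refine ⟨u + n, v + n, by omega, by omega, by omega, ?_⟩
    rwa [hper, hper, add_sub_add_right_eq_sub]

theorem insertedSums_rotate {n : ℕ} (hn : 0 < n) {A A' : Mem ℝ} {c : ℕ}
    (hA : ∀ i < n, A' i = A ((i + c) % n)) (x : ℝ) (p : ℕ) :
    insertedSums n A' x p = insertedSums n A x (p + c) := by
  have hr := periodicSum_rotate hn hA
  have htot : periodicSum n A' n = periodicSum n A n := by
    rw [hr, add_comm n c, periodicSum_add_period]
    ring
  ext t
  constructor
  · rintro ⟨u, v, h1, h2, h3, h⟩
    refine ⟨u + c, v + c, by omega, by omega, by omega, ?_⟩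
    rwa [hr u, hr v, htot, sub_sub_sub_cancel_right] at h
  · rintro ⟨u, v, h1, h2, h3, h⟩
    obtain ⟨u, rfl⟩ : ∃ u', u = u' + c := ⟨u - c, by omega⟩
    obtain ⟨v, rfl⟩ : ∃ v', v = v' + c := ⟨v - c, by omega⟩
    refine ⟨u, v, by omega, by omega, by omega, ?_⟩
    rwa [hr u, hr v, htot, sub_sub_sub_cancel_right]

/-- The position `p ≤ n` corresponds to the position `p - c` modulo `n` of the sequence which is
circularly shifted by `c`. -/
theorem insertedSums_subMod {n : ℕ} (hn : 0 < n) {A A' : Mem ℝ} {c : ℕ} (hc : c < n)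
    (hA : ∀ i < n, A' i = A ((i + c) % n)) (x : ℝ) {p : ℕ} (hp : p ≤ n) :
    insertedSums n A' x (((if p = n then 0 else p) + n - c) % n) = insertedSums n A x p := by
  have h0 : insertedSums n A x (if p = n then 0 else p) = insertedSums n A x p := by
    split_ifs with h
    · have := insertedSums_add_period n A x 0
      rw [zero_add] at this
      rw [h, this]
    · rfl
  have hlt : (if p = n then 0 else p) < n := by split_ifs <;> omega
  rw [← h0, insertedSums_rotate hn hA]
  generalize (if p = n then 0 else p) = q at *
  rcases lt_or_ge q c with h | h
  · rw [Nat.mod_eq_of_lt (by omega), Nat.sub_add_cancel (by omega), insertedSums_add_period]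
  · rw [show q + n - c = q - c + n by omega, Nat.add_mod_right, Nat.mod_eq_of_lt (by omega),
      Nat.sub_add_cancel h]

/-- If all sums of subsequences without the new element are between `0` and the total sum, then the
greatest sum is obtained from all or none of the elements, with or without the new one. -/
theorem isGreatest_insertedSums_of_between {n : ℕ} {A : Mem ℝ} (x : ℝ) {p : ℕ}
    (h : ∀ u v, p ≤ u → u ≤ v → v ≤ p + n →
      min 0 (periodicSum n A n) ≤ periodicSum n A v - periodicSum n A u ∧
      periodicSum n A v - periodicSum n A u ≤ max 0 (periodicSum n A n)) :
    IsGreatest (insertedSums n A x p) (max 0 (periodicSum n A n) + max 0 x) := by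
  have htot : periodicSum n A n = periodicSum n A (p + n) - periodicSum n A p := by
    rw [periodicSum_add_period]
    ring
  have hmem : periodicSum n A n ∈ insertedSums n A x p :=
    ⟨p, p + n, le_rfl, by omega, le_rfl, Or.inl htot⟩
  have hmem' : x + periodicSum n A n ∈ insertedSums n A x p :=
    ⟨p, p, le_rfl, le_rfl, by omega, Or.inr (by ring)⟩
  constructor
  · rcases max_choice 0 (periodicSum n A n) with h1 | h1 <;>
      rcases max_choice 0 x with h2 | h2 <;> rw [h1, h2]
    · rw [add_zero]
      exact zero_mem_insertedSums
    · rw [zero_add]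
      exact x_mem_insertedSums
    · rwa [add_zero]
    · rwa [add_comm]
  · rintro t ⟨u, v, h1, h2, h3, rfl | rfl⟩
    · have := (h u v h1 h2 h3).2
      have := le_max_left 0 x
      linarith
    · have h4 := (h u v h1 h2 h3).1
      have := le_max_right 0 x
      have := min_add_max 0 (periodicSum n A n)
      linarith

theorem isGreatest_insertedSums_of_nonneg {n : ℕ} {A : Mem ℝ} (hA : ∀ i < n, 0 ≤ A i) (x : ℝ)
    (p : ℕ) : IsGreatest (insertedSums n A x p) (max 0 (periodicSum n A n) + max 0 x) := by
  refine isGreatest_insertedSums_of_between x fun u v h1 h2 h3 => ?_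
  rcases Nat.eq_zero_or_pos n with rfl | hn
  · rw [show u = v by omega]
    simp
  have hm : Monotone (periodicSum n A) := by
    refine monotone_nat_of_le_succ fun t => ?_
    rw [periodicSum_succ]
    linarith [hA _ (Nat.mod_lt t hn)]
  have h4 := hm h1
  have h5 := hm h2
  have h6 := hm h3
  rw [periodicSum_add_period] at h6
  rw [min_eq_left (by linarith), max_eq_right (by linarith)]
  constructor <;> linarith

theorem isGreatest_insertedSums_of_nonpos {n : ℕ} {A : Mem ℝ} (hA : ∀ i < n, A i ≤ 0) (x : ℝ)
    (p : ℕ) : IsGreatest (insertedSums n A x p) (max 0 (periodicSum n A n) + max 0 x) := by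
  refine isGreatest_insertedSums_of_between x fun u v h1 h2 h3 => ?_
  rcases Nat.eq_zero_or_pos n with rfl | hn
  · rw [show u = v by omega]
    simp
  have hm : Antitone (periodicSum n A) := by
    refine antitone_nat_of_succ_le fun t => ?_
    rw [periodicSum_succ]
    linarith [hA _ (Nat.mod_lt t hn)]
  have h4 := hm h1
  have h5 := hm h2
  have h6 := hm h3
  rw [periodicSum_add_period] at h6
  rw [min_eq_right (by linarith), max_eq_left (by linarith)]
  constructor <;> linarith

/-! ### Correctness of the preprocessing algorithm -/

section

open Timed Preprocessing

variable {n : ℕ} {A : Mem ℝ} {O : Mem ℕ} {D : AuxData}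

theorem isAuxData_of_eq (hn : 0 < n) (hM : IsMaxCircSums n A D.MCS O) (h_n : D.n = n)
    (htotal : D.total = periodicSum n A n) (hpart : D.part = (partition n O).val)
    (hIS : D.IS = (intervalSums n D.part A).val.1)
    (hIMCS : D.IMCS = (intervalMax n D.part D.MCS).val)
    (hSFMCS : D.SFMCS = (suffixMax n D.part D.MCS).val)
    (hPFMCS : D.PFMCS = (prefixMax n D.part D.MCS).val)
    (hPFSF : D.PFSF = (prefixMinSum n D.part A).val)
    (hIRCS : D.IRCS =
      (otherIntervals D.part.ell (intervalSums n D.part A).val.2 D.IS).val)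
    (hIOMCS : D.IOMCS = (otherIntervals D.part.ell D.IMCS (zeroMem ℝ)).val) :
    IsAuxData n A O D := by
  have hP : IsPartition n O D.part := hpart ▸ partition_val n O
  have h1 : ∀ k < D.part.ell, _ := fun k hk => intervalSums_val hP A hk
  have h2 : ∀ k < D.part.ell, _ := fun k hk => intervalMax_val hP D.MCS hk
  rw [← hIS] at h1
  rw [← hIMCS] at h2
  refine ⟨hn, h_n, htotal, hP, hM, fun k hk => (h1 k hk).1, h2, fun hell k hk => ?_,
    fun hell k hk => ?_, fun p hp => ?_, fun p hp hfp => ?_, fun p hp hfp => ?_⟩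
  · rw [hIOMCS]
    exact otherIntervals_max hP hell D.MCS h2 hk
  · rw [hIRCS]
    exact otherIntervals_prefix hP hell (fun k hk => (h1 k hk).1) (fun k hk => (h1 k hk).2) hk
  · rw [hSFMCS]
    exact suffixMax_val hP D.MCS hp
  · rw [hPFMCS]
    exact prefixMax_val hP D.MCS hp hfp
  · rw [hPFSF]
    exact prefixMinSum_val hP A hp hfp

theorem IsAuxData.type3 (hD : IsAuxData n A O D) (ha : IsAligned n O)
    (hpos : 0 ≤ periodicSum n A n)
    (hPFRMMS : D.PFRMMS = (rotatedMaxSum n D.part A D.IRCS).val)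
    (hPFRMMCS : D.PFRMMCS = (rotatedMaxCircSum n D.part D.MCS D.IOMCS).val) :
    IsAuxData3 n A O D := by
  have hP := hD.partition
  have hI := hasNonnegIntervals hP hD.MCS ha hpos
  refine ⟨hD, hpos, hI, fun p hp => ?_, fun p hp => ?_⟩
  · rw [hPFRMMS]
    refine rotatedMaxSum_val hP (fun k hk u h1 h2 => hI.last_le k hk u h1 ?_) hD.IRCS hp
    have := hP.first_le_last k hk
    omega
  · rw [hPFRMMCS]
    exact rotatedMaxCircSum_val hP hD.IOMCS hp

theorem IsAuxData.type2 (hD : IsAuxData n A O D) (ha : IsAligned n O)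
    (hneg : periodicSum n A n < 0) (hPRVMS : D.PRVMS = (prevMaxSums n D.MCS).val)
    (hINXTMS : D.INXTMS = (nextMaxSums n D.part D.MCS).val)
    (hIXs : D.IXs = (lastPositive n D.part A).val)
    (hX : (D.X1, D.X2, D.BX1, D.BX2) = (peakArrays n D.part D.MCS D.IXs).val) :
    IsAuxData2 n A O D := by
  have hP := hD.partition
  have hI := hasNegativeIntervals hP hD.MCS ha hneg
  have h1 : ∀ k < D.part.ell, _ := fun k hk => lastPositive_val hP A hk
  rw [← hIXs] at h1
  refine ⟨hD, hI, fun p hp => ?_, fun k hk => ?_,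
    fun k hk => ⟨(h1 k hk).1, (h1 k hk).2.1, (h1 k hk).2.2.1⟩, fun p hp hpX => ?_⟩
  · rw [hPRVMS]
    exact prevMaxSums_val n D.MCS hp.le
  · rw [hINXTMS]
    exact nextMaxSums_val hP D.MCS hk
  · have := peakArrays_val hP (M := D.MCS) (fun k hk => ⟨(h1 k hk).1, (h1 k hk).2.1⟩)
      (fun k hk p hfp hpX => ?_) hp hpX
    · rwa [← hX] at this
    · obtain ⟨h2, h3, -, h4⟩ := h1 k hk
      have h5 := hP.last_lt k hk
      rw [hI.MCS_eq k hk p hfp (by omega), hI.MCS_eq k hk (p + 1) (by omega) (by omega),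
        periodicSum_succ n A (p + 1), Nat.mod_eq_of_lt (show p + 1 < n by omega)]
      rcases h4 with h4 | h4
      · omega
      · rw [← hpX] at h4
        linarith

/-- What the preprocessing algorithm computes: for type 2 and type 3, the auxiliary data of the
shifted sequence `A'`. -/
theorem preprocess_val (n : ℕ) (A : Mem ℝ) :
    ((preprocess n A).val.kind = .type1 ∧ (preprocess n A).val.total = periodicSum n A n ∧
      ((∀ i < n, 0 ≤ A i) ∨ ∀ i < n, A i ≤ 0)) ∨
    ∃ A' O', (preprocess n A).val.shift < n ∧
      (∀ i < n, A' i = A ((i + (preprocess n A).val.shift) % n)) ∧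
      ((preprocess n A).val.kind = .type2 ∧ IsAuxData2 n A' O' (preprocess n A).val ∨
        (preprocess n A).val.kind = .type3 ∧ IsAuxData3 n A' O' (preprocess n A).val) := by
  obtain ⟨hsum, hpos, hneg⟩ := sumAndSigns_val n A
  have hsum' : (sumAndSigns n A).val.1 = periodicSum n A n := by
    rw [hsum, periodicSum]
    exact Finset.sum_congr rfl fun i hi => by rw [Nat.mod_eq_of_lt (Finset.mem_range.1 hi)]
  by_cases hs : ((sumAndSigns n A).val.2.1 && (sumAndSigns n A).val.2.2) = true
  · right
    have hn : 0 < n := by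
      simp only [Bool.and_eq_true] at hs
      obtain ⟨i, hi, -⟩ := hpos.1 hs.1
      omega
    have hM := maxCircSums_val hn A
    set M := (maxCircSums n A).val.1 with hMdef
    set O := (maxCircSums n A).val.2 with hOdef
    set c := (findShift n O).val with hcdef
    have hc : c < n := findShift_lt hn hM
    have hO : ∀ i < n, O i < n := fun i hi => hM.OMCS_lt hi
    have hsh : ∀ i < n, _ := fun i hi => shiftArrays_val hc A M hO hi
    set A' := (shiftArrays n c A M O).val.1 with hA'
    set M' := (shiftArrays n c A M O).val.2.1 with hM'
    set O' := (shiftArrays n c A M O).val.2.2 with hO'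
    have hMr := hM.rotate hn hc (fun i hi => (hsh i hi).1) (fun i hi => (hsh i hi).2.1)
      (fun i hi => (hsh i hi).2.2)
    have ha := isAligned_rotate hn hM (fun i hi => (hsh i hi).2.2)
    have htot : (sumAndSigns n A).val.1 = periodicSum n A' n := by
      rw [hsum', periodicSum_rotate hn (fun i hi => (hsh i hi).1), add_comm n c,
        periodicSum_add_period]
      ring
    have htype := (hasNegative_val n M').trans (exists_neg_iff (partition_val n O') hn hMr ha)
    refine ⟨A', O', ?_⟩
    by_cases ht : (hasNegative n M').val = true
    · have hD : (preprocess n A).val.shift = c ∧ (preprocess n A).val.kind = .type2 ∧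
          IsAuxData2 n A' O' (preprocess n A).val := by
        unfold preprocess
        simp only [bind_val, hs, if_true, ← hMdef, ← hOdef, ← hcdef, ← hA', ← hM', ← hO', ht,
          pure_val]
        exact ⟨trivial, trivial,
          (isAuxData_of_eq hn hMr rfl htot rfl rfl rfl rfl rfl rfl rfl rfl).type2 ha
            (htype.1 ht) rfl rfl rfl rfl⟩
      rw [hD.1]
      exact ⟨hc, fun i hi => (hsh i hi).1, Or.inl hD.2⟩
    · have hD : (preprocess n A).val.shift = c ∧ (preprocess n A).val.kind = .type3 ∧
          IsAuxData3 n A' O' (preprocess n A).val := by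
        unfold preprocess
        simp only [bind_val, hs, if_true, ← hMdef, ← hOdef, ← hcdef, ← hA', ← hM', ← hO', ht,
          Bool.false_eq_true, if_false, pure_val]
        exact ⟨trivial, trivial,
          (isAuxData_of_eq hn hMr rfl htot rfl rfl rfl rfl rfl rfl rfl rfl).type3 ha
            (not_lt.1 fun h => ht (htype.2 h)) rfl rfl⟩
      rw [hD.1]
      exact ⟨hc, fun i hi => (hsh i hi).1, Or.inr hD.2⟩
  · left
    have hD : (preprocess n A).val.kind = .type1 ∧
        (preprocess n A).val.total = (sumAndSigns n A).val.1 := by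
      unfold preprocess
      simp only [bind_val, ite_val, hs, pure_val]
      exact ⟨rfl, rfl⟩
    refine ⟨hD.1, hD.2.trans hsum', ?_⟩
    by_contra hcon
    push Not at hcon
    exact hs (by rw [Bool.and_eq_true, hpos, hneg]; exact hcon.symm)

end

/-! ### Correctness of the whole algorithm -/

open Timed in
theorem query_isGreatest (n : ℕ) (A : Mem ℝ) (x : ℝ) {p : ℕ} (hp : p ≤ n) :
    IsGreatest (insertedSums n A x p) (query (preprocess n A).val x p).val := by
  rcases preprocess_val n A with ⟨hkind, htot, hA⟩ | ⟨A', O', hc, hA', h⟩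
  · unfold query
    rw [hkind]
    simp only [bind_val, maxOf_val, add_val, htot]
    exact hA.elim (isGreatest_insertedSums_of_nonneg · x p)
      (isGreatest_insertedSums_of_nonpos · x p)
  generalize (preprocess n A).val = D at *
  have hn : 0 < n := by omega
  have hp0 : (if p = n then 0 else p) < n := by split_ifs <;> omega
  have hlt := Nat.mod_lt ((if p = n then 0 else p) + n - D.shift) hn
  rw [← insertedSums_subMod hn hc hA' x hp]
  unfold query
  rcases h with ⟨hkind, hD⟩ | ⟨hkind, hD⟩
  · rw [hkind]
    simp only [bind_val, ite_val, eq_val, le_val, pure_val, decide_eq_true_eq, hD.n_eq,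
      subMod_val hp0 hc.le]
    generalize (if p = n then 0 else p) = q at *
    split_ifs with hx
    · exact Query.nonneg_type2 hD hlt hx
    · exact Query.negType2_isGreatest hD hlt (not_le.1 hx)
  · rw [hkind]
    simp only [bind_val, ite_val, eq_val, le_val, pure_val, decide_eq_true_eq, hD.n_eq,
      subMod_val hp0 hc.le]
    generalize (if p = n then 0 else p) = q at *
    split_ifs with hx
    · exact Query.nonneg_type3 hD hlt hx
    · exact Query.negType3_isGreatest hD hlt (not_le.1 hx)

theorem isMaxCircSum_query (A : List ℝ) (x : ℝ) {p : ℕ} (hp : p ≤ A.length) :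
    IsMaxCircSum (insertAt A p x) (query (preprocess A.length (load A)).val x p).val := by
  rw [IsMaxCircSum, setOf_sum_circSubseq_insertAt hp]
  exact query_isGreatest A.length (load A) x hp

open Timed in
theorem forall₂_answerQueries {D : AuxData} {R : ℝ × ℕ → ℝ → Prop} {qs : List (ℝ × ℕ)}
    (h : ∀ q ∈ qs, R q (query D q.1 q.2).val) :
    List.Forall₂ R qs (answerQueries D qs).val := by
  induction qs with
  | nil => exact List.Forall₂.nil
  | cons q qs ih =>
    exact List.Forall₂.cons (h q (by simp)) (ih fun q' hq' => h q' (by simp [hq']))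

theorem mainTheorem1 :
    ∃ C : ℕ, ∀ A : List ℝ,
      -- the preprocessing algorithm takes linear time
      (preprocess A.length (load A)).cost ≤ C * (A.length + 1) ∧
      -- afterwards each query is answered correctly in constant worst-case time
      (∀ (x : ℝ) (p : ℕ), p ≤ A.length →
        IsMaxCircSum (insertAt A p x) (query (preprocess A.length (load A)).val x p).val ∧
        (query (preprocess A.length (load A)).val x p).cost ≤ C) ∧
      -- hence independent insertions are all handled in time linear in the size of the input
      (∀ qs : List (ℝ × ℕ), (∀ q ∈ qs, q.2 ≤ A.length) →
        List.Forall₂ (fun q r => IsMaxCircSum (insertAt A q.2 q.1) r) qs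
          (solveInsertions A.length (load A) qs).val ∧
        (solveInsertions A.length (load A) qs).cost ≤ C * (A.length + qs.length + 1)) := by
  refine ⟨1001, fun A => ?_⟩
  have hpre := preprocess_cost A.length (load A)
  refine ⟨by omega, fun x p hp => ⟨isMaxCircSum_query A x hp, ?_⟩, fun qs hqs => ⟨?_, ?_⟩⟩
  · exact (query_cost _ x p).trans (by norm_num)
  · exact forall₂_answerQueries fun q hq => isMaxCircSum_query A q.1 (hqs q hq)
  · have := answerQueries_cost (preprocess A.length (load A)).val qs
    change (preprocess A.length (load A)).cost +
      (answerQueries (preprocess A.length (load A)).val qs).cost ≤ _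
    omega
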